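/- Let $\mathcal G \rightrightarrows X$ be a complex Lie groupoid (source $s$, target $t$) acting holomorphically and linearly on a holomorphic line bundle $L \to X$; equivalently, the pull-back $L_{\mathcal G} = t^*L$ carries the LB-groupoid structure $(L_{\mathcal G} \rightrightarrows 0_X; \mathcal G \rightrightarrows X)$ with product $(g,\ell)(h,\ell') = (gh, \ell + g.\ell')$. Let $H \subset T^{1,0}\mathcal G$ be a holomorphic contact structure whose normal bundle is identified with $L_{\mathcal G}$ by means of a surjective holomorphic structure form $\theta : T^{1,0}\mathcal G \to t^*L$ with $\ker\theta = H$; if $H$ is multiplicative, it is understood that $L_{\mathcal G}$ is the LB-groupoid $T^{1,0}\mathcal G/H$, i.e. that $\theta$ is a map of groupoids: $\theta(V\cdot W) = \theta(V) + g.\theta(W)$ for all composable $V \in T^{1,0}_g\mathcal G$, $W \in T^{1,0}_h\mathcal G$. Let $\widehat{\mathcal G} \rightrightarrows \widehat M$ be the groupoid formed by the real projective bundles of the complex duals $L_{\mathcal G}^* \to \mathcal G$ and $L^* \to X$. Its arrows are pairs $(g,[\epsilon])$ with $g\in\mathcal G$, $0 \ne \epsilon \in L^*_{t(g)}$, and $[\epsilon]$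 the real line spanned by $\epsilon$; the target of $(g,[\epsilon])$ is $[\epsilon]$, its source is $[\epsilon\circ g]$, and $(g,[\epsilon])(h,[\epsilon\circ g]) = (gh,[\epsilon])$. On $\widetilde{\mathcal G} = L_{\mathcal G}^*\smallsetminus 0$, with projection $p : \widetilde{\mathcal G}\to\mathcal G$ and holomorphic Euler vector field $\mathcal Z$, let $\Theta_\epsilon = \langle \epsilon, \theta\circ p_*\rangle$ and $\Omega = d\Theta$. Let $\widehat H \subset T\widehat{\mathcal G}$ be the real contact structure induced by $H$, i.e. the one whose symplectization is $\operatorname{Re}\Omega$: it is the image of $\ker \iota_{2\operatorname{Re}\mathcal Z}\operatorname{Re}\Omega$ under the differential of the projection $\widetilde{\mathcal G} \to \widehat{\mathcal G}$. Call $H$ multiplicative if it is a VB-subgroupoid of the tangent groupoid $T^{1,0}\mathcal G \rightrightarrows T^{1,0}X$ covering the whole of $T^{1,0}X$, and $\widehat H$ multiplicative if it is a VB-subgroupoid of $T\widehat{\mathcal G} \rightrightarrows T\widehat M$ covering the whole of $T\widehat M$. Then $\widehat H$ is multiplicative if and only if $H$ is multiplicative. -/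

import Mathlib

open scoped Manifold ContDiff Bundle LinearAlgebra.Projectivization
open Bundle

namespace HolContact

noncomputable section

theorem contMDiffOn_restrictScalars {E F : Type*} [NormedAddCommGroup E] [NormedSpace ℂ E]
    [NormedAddCommGroup F] [NormedSpace ℂ F]
    {B : Type*} [TopologicalSpace B] [ChartedSpace E B] {f : B → F} {s : Set B}
    (hf : ContMDiffOn 𝓘(ℂ, E) 𝓘(ℂ, F) ω f s) : ContMDiffOn 𝓘(ℝ, E) 𝓘(ℝ, F) ∞ f s := by
  intro x hx
  have h := hf x hx
  rw [contMDiffWithinAt_iff] at h ⊢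
  exact ⟨h.1, (h.2.restrict_scalars ℝ).of_le le_top⟩

theorem isManifold_real (E : Type*) [NormedAddCommGroup E] [NormedSpace ℂ E]
    (B : Type*) [TopologicalSpace B] [ChartedSpace E B] [IsManifold 𝓘(ℂ, E) ω B] :
    IsManifold 𝓘(ℝ, E) ∞ B := by
  apply isManifold_of_contDiffOn
  intro e e' he he'
  have h := contDiffGroupoid ω 𝓘(ℂ, E) |>.compatible he he'
  have h := (contDiffGroupoid ω 𝓘(ℂ, E)).compatible (M := B) he he'
  rw [contDiffGroupoid, mem_groupoid_of_pregroupoid] at h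
  exact (ContDiffOn.restrict_scalars ℝ h.1).of_le le_top

/-- If `P` is charted over the `C^n` manifold `N` with `C^n` coordinate changes, then `P` with the
composed charts is a `C^n` manifold. -/
theorem isManifold_comp {𝕜 : Type*} [NontriviallyNormedField 𝕜] {E : Type*} [NormedAddCommGroup E]
    [NormedSpace 𝕜 E] {H : Type*} [TopologicalSpace H] (I : ModelWithCorners 𝕜 E H) (n : WithTop ℕ∞)
    (N P : Type*) [TopologicalSpace N] [ChartedSpace H N] [IsManifold I n N]
    (c : ChartedSpaceCore N P)
    (hc : ∀ e ∈ c.atlas, ∀ e' ∈ c.atlas,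
      ContMDiffOn I I n (e.symm.trans e') (e.symm.trans e').source) :
    @IsManifold 𝕜 _ E _ _ H _ I n P c.toTopologicalSpace
      (@ChartedSpace.comp H _ N _ P c.toTopologicalSpace _ c.toChartedSpace) := by
  let _ := c.toTopologicalSpace
  let _ := c.toChartedSpace
  let PG : Pregroupoid N :=
    { property := fun f s => ContMDiffOn I I n f s
      comp := fun hf hg _ _ _ => hg.comp' hf
      id_mem := contMDiffOn_id
      locality := fun {f u} _ h x hx => by
        obtain ⟨v, hv, hxv, hfv⟩ := h x hx
        exact ((hfv x ⟨hx, hxv⟩).mono_of_mem_nhdsWithin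
          (inter_mem_nhdsWithin _ (hv.mem_nhds hxv)))
      congr := fun _ h hf => hf.congr h }
  have : HasGroupoid P PG.groupoid := by
    constructor
    rintro _ _ ⟨_, ⟨e, rfl⟩, _, ⟨he, rfl⟩, rfl⟩ ⟨_, ⟨e', rfl⟩, _, ⟨he', rfl⟩, rfl⟩
    rw [mem_groupoid_of_pregroupoid]
    exact ⟨hc _ he _ he', hc _ he' _ he⟩
  let _ := ChartedSpace.comp H N P
  refine { StructureGroupoid.HasGroupoid.comp PG.groupoid ?_ with }
  intro e he
  rw [mem_groupoid_of_pregroupoid] at he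
  rw [isLocalStructomorphOn_contDiffGroupoid_iff]
  exact he

section LineBundle

variable {EX : Type*} [NormedAddCommGroup EX] [NormedSpace ℂ EX]
  {X : Type*} [TopologicalSpace X] [ChartedSpace EX X]
  (L : X → Type*) [∀ x, AddCommGroup (L x)] [∀ x, Module ℂ (L x)] [∀ x, TopologicalSpace (L x)]
  [TopologicalSpace (TotalSpace ℂ L)] [FiberBundle ℂ L] [VectorBundle ℂ ℂ L]

/-- The coordinate of a covector `ε ∈ L_x^*` in the trivialization of `L` around `x₀`. -/
def lineCoord (x₀ x : X) (ε : L x →L[ℂ] ℂ) : ℂ :=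
  ε ((trivializationAt ℂ L x₀).symmL ℂ x 1)

/-- The covector `ε ∈ L_x^*` with coordinate `z` in the trivialization of `L` around `x₀`. -/
def ofLineCoord (x₀ x : X) (z : ℂ) : L x →L[ℂ] ℂ :=
  z • (trivializationAt ℂ L x₀).continuousLinearMapAt ℂ x

variable {L}

theorem lineCoord_smul (x₀ x : X) (c : ℂ) (ε : L x →L[ℂ] ℂ) :
    lineCoord L x₀ x (c • ε) = c * lineCoord L x₀ x ε := rfl

theorem lineCoord_ofLineCoord {x₀ x : X} (hx : x ∈ (trivializationAt ℂ L x₀).baseSet) (z : ℂ) :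
    lineCoord L x₀ x (ofLineCoord L x₀ x z) = z := by
  have h := (trivializationAt ℂ L x₀).continuousLinearMapAt_symmL (R := ℂ) hx 1
  simp only [lineCoord, ofLineCoord, smul_apply, h, smul_eq_mul, mul_one]

theorem ofLineCoord_lineCoord {x₀ x : X} (hx : x ∈ (trivializationAt ℂ L x₀).baseSet)
    (ε : L x →L[ℂ] ℂ) : ofLineCoord L x₀ x (lineCoord L x₀ x ε) = ε := by
  ext v
  have h := (trivializationAt ℂ L x₀).symmL_continuousLinearMapAt (R := ℂ) hx v
  simp only [lineCoord, ofLineCoord, smul_apply, smul_eq_mul]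
  conv_rhs => rw [← h]
  rw [mul_comm, ← smul_eq_mul, ← map_smul, ← map_smul]
  simp

theorem lineCoord_ne_zero {x₀ x : X} (hx : x ∈ (trivializationAt ℂ L x₀).baseSet)
    {ε : L x →L[ℂ] ℂ} (hε : ε ≠ 0) : lineCoord L x₀ x ε ≠ 0 := by
  intro h
  apply hε
  rw [← ofLineCoord_lineCoord hx ε, h]
  simp [ofLineCoord]

theorem ofLineCoord_ne_zero {x₀ x : X} (hx : x ∈ (trivializationAt ℂ L x₀).baseSet)
    {z : ℂ} (hz : z ≠ 0) : ofLineCoord L x₀ x z ≠ 0 := by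
  intro h
  apply hz
  rw [← lineCoord_ofLineCoord hx z, h]
  simp [lineCoord]

variable (L) in
/-- The transition function of `L^*` between the trivializations around `x₀` and `x₁`. -/
def lineTransition (x₀ x₁ x : X) : ℂ := lineCoord L x₁ x (ofLineCoord L x₀ x 1)

theorem lineCoord_ofLineCoord' (x₀ x₁ x : X) (z : ℂ) :
    lineCoord L x₁ x (ofLineCoord L x₀ x z) = z * lineTransition L x₀ x₁ x := by
  rw [lineTransition, ← lineCoord_smul]
  congr 1
  simp [ofLineCoord]

theorem contMDiffOn_lineTransition [ContMDiffVectorBundle ω ℂ L 𝓘(ℂ, EX)] (x₀ x₁ : X) :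
    ContMDiffOn 𝓘(ℂ, EX) 𝓘(ℂ, ℂ) ω (lineTransition L x₀ x₁)
      ((trivializationAt ℂ L x₀).baseSet ∩ (trivializationAt ℂ L x₁).baseSet) := by
  have h := contMDiffOn_coordChangeL (IB := 𝓘(ℂ, EX)) (n := ω)
    (trivializationAt ℂ L x₁) (trivializationAt ℂ L x₀)
  rw [Set.inter_comm] at h
  refine (h.clm_apply (contMDiffOn_const (c := (1 : ℂ)))).congr ?_
  intro x hx
  rw [ContinuousLinearEquiv.coe_coe, Trivialization.coordChangeL_apply _ _ hx.symm]
  simp [lineTransition, lineCoord, ofLineCoord, Trivialization.continuousLinearMapAt_apply,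
    Trivialization.linearMapAt_apply, hx.1,
    Trivialization.symmL_apply _ hx.2]

end LineBundle

section Total

variable {EX : Type*} [NormedAddCommGroup EX] [NormedSpace ℂ EX]
  {X : Type*} [TopologicalSpace X] [ChartedSpace EX X]
  (L : X → Type*) [∀ x, AddCommGroup (L x)] [∀ x, Module ℂ (L x)] [∀ x, TopologicalSpace (L x)]
  [TopologicalSpace (TotalSpace ℂ L)] [FiberBundle ℂ L] [VectorBundle ℂ ℂ L]
  {E : Type*} [NormedAddCommGroup E] [NormedSpace ℂ E]
  {B : Type*} [TopologicalSpace B] [ChartedSpace E B]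
  (f : ContMDiffMap 𝓘(ℂ, E) 𝓘(ℂ, EX) B X ω)

/-- The complex homogenization `(f^*L)^* ∖ 0` of the pull-back of the holomorphic line bundle
`L → X` along a holomorphic map `f : B → X`. -/
@[ext]
structure Slit where
  base : B
  covec : L (f base) →L[ℂ] ℂ
  ne_zero : covec ≠ 0

/-- The real projective bundle of the complex dual of `f^*L`: its points are the real lines in
the fibres of `(f^*L)^*`. -/
@[ext]
structure RProj where
  base : B
  line : ℙ ℝ (L (f base) →L[ℂ] ℂ)

variable {L f}

open Classical in
/-- The trivialization of `(f^*L)^* ∖ 0` around `x₀`. -/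
def slitTriv (x₀ : X) : PartialEquiv (Slit L f) (B × ℂ) where
  toFun p := (p.base, lineCoord L x₀ (f p.base) p.covec)
  invFun q :=
    if h : ofLineCoord L x₀ (f q.1) q.2 ≠ 0 then ⟨q.1, _, h⟩
    else ⟨q.1, ofLineCoord L (f q.1) (f q.1) 1,
      ofLineCoord_ne_zero (FiberBundle.mem_baseSet_trivializationAt' _) one_ne_zero⟩
  source := {p | f p.base ∈ (trivializationAt ℂ L x₀).baseSet}
  target := {q | f q.1 ∈ (trivializationAt ℂ L x₀).baseSet ∧ q.2 ≠ 0}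
  map_source' p hp := ⟨hp, lineCoord_ne_zero hp p.ne_zero⟩
  map_target' q hq := by
    rw [dif_pos (ofLineCoord_ne_zero hq.1 hq.2)]
    exact hq.1
  left_inv' p hp := by
    have h := ofLineCoord_lineCoord hp p.covec
    have h' : ofLineCoord L x₀ (f p.base) (lineCoord L x₀ (f p.base) p.covec) ≠ 0 := by
      rw [h]; exact p.ne_zero
    simp only [dif_pos h']
    cases p
    simp only [Slit.mk.injEq, heq_eq_eq, true_and]
    exact h
  right_inv' q hq := by
    rw [dif_pos (ofLineCoord_ne_zero hq.1 hq.2)]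
    exact Prod.ext rfl (lineCoord_ofLineCoord hq.1 q.2)

theorem slitTriv_symm (x₀ : X) {q : B × ℂ} (hq : q ∈ (slitTriv (L := L) (f := f) x₀).target) :
    (slitTriv (L := L) (f := f) x₀).symm q =
      ⟨q.1, _, ofLineCoord_ne_zero hq.1 hq.2⟩ :=
  dif_pos (ofLineCoord_ne_zero hq.1 hq.2)

theorem slitTriv_trans_source (x₀ x₁ : X) :
    ((slitTriv (L := L) (f := f) x₀).symm.trans (slitTriv x₁)).source =
      {q | f q.1 ∈ (trivializationAt ℂ L x₀).baseSet ∩ (trivializationAt ℂ L x₁).baseSet ∧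
        q.2 ≠ 0} := by
  ext q
  rw [PartialEquiv.trans_source, PartialEquiv.symm_source]
  constructor
  · rintro ⟨h, h'⟩
    rw [Set.mem_preimage, slitTriv_symm x₀ h] at h'
    exact ⟨⟨h.1, h'⟩, h.2⟩
  · rintro ⟨h, h'⟩
    refine ⟨⟨h.1, h'⟩, ?_⟩
    rw [Set.mem_preimage, slitTriv_symm x₀ ⟨h.1, h'⟩]
    exact h.2

theorem contMDiffOn_slitTriv_trans [ContMDiffVectorBundle ω ℂ L 𝓘(ℂ, EX)] (x₀ x₁ : X) :
    ContMDiffOn (𝓘(ℂ, E).prod 𝓘(ℂ, ℂ)) (𝓘(ℂ, E).prod 𝓘(ℂ, ℂ)) ω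
      ((slitTriv (L := L) (f := f) x₀).symm.trans (slitTriv x₁))
      ((slitTriv (L := L) (f := f) x₀).symm.trans (slitTriv x₁)).source := by
  rw [slitTriv_trans_source]
  have h1 : ContMDiffOn (𝓘(ℂ, E).prod 𝓘(ℂ, ℂ)) 𝓘(ℂ, ℂ) ω
      (fun q : B × ℂ => q.2 * lineTransition L x₀ x₁ (f q.1))
      {q | f q.1 ∈ (trivializationAt ℂ L x₀).baseSet ∩ (trivializationAt ℂ L x₁).baseSet ∧
        q.2 ≠ 0} := by
    have h2 := (contMDiffOn_lineTransition (L := L) (EX := EX) x₀ x₁).comp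
      (f.contMDiff.comp (contMDiff_fst (I := 𝓘(ℂ, E)) (J := 𝓘(ℂ, ℂ)))).contMDiffOn
      (fun q (hq : q ∈ {q : B × ℂ | f q.1 ∈ (trivializationAt ℂ L x₀).baseSet ∩
        (trivializationAt ℂ L x₁).baseSet ∧ q.2 ≠ 0}) => hq.1)
    exact (contMDiff_snd (I := 𝓘(ℂ, E)) (J := 𝓘(ℂ, ℂ))).contMDiffOn.smul h2
  refine ((contMDiff_fst (I := 𝓘(ℂ, E)) (J := 𝓘(ℂ, ℂ))).contMDiffOn.prodMk h1).congr ?_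
  intro q hq
  have hq' : q ∈ (slitTriv (L := L) (f := f) x₀).target := ⟨hq.1.1, hq.2⟩
  rw [PartialEquiv.coe_trans, Function.comp_apply, slitTriv_symm x₀ hq']
  exact Prod.ext rfl (lineCoord_ofLineCoord' x₀ x₁ (f q.1) q.2)

/-- The affine coordinate of the real line spanned by `w` relative to the real line spanned by
`c`, i.e. the real number `τ` with `w ∈ ℝ (1 + i τ) c`. -/
def slope (c w : ℂ) : ℝ := (w / c).im / (w / c).re

theorem slope_real_smul (c w : ℂ) {r : ℝ} (hr : r ≠ 0) : slope c (r * w) = slope c w := by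
  rw [slope, slope, mul_div_assoc, Complex.re_ofReal_mul, Complex.im_ofReal_mul,
    mul_div_mul_left _ _ hr]

theorem slope_line {c : ℂ} (hc : c ≠ 0) (τ : ℝ) : slope c ((1 + τ * Complex.I) * c) = τ := by
  rw [slope, mul_div_cancel_right₀ _ hc]
  simp

theorem lineCoord_real_smul (x₀ x : X) (r : ℝ) (ε : L x →L[ℂ] ℂ) :
    lineCoord L x₀ x (r • ε) = r * lineCoord L x₀ x ε := by
  simp [lineCoord]

theorem lineCoord_rep_mk (x₀ x : X) {ε : L x →L[ℂ] ℂ} (hε : ε ≠ 0) :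
    ∃ r : ℝ, r ≠ 0 ∧
      lineCoord L x₀ x (Projectivization.mk ℝ ε hε).rep = r * lineCoord L x₀ x ε := by
  obtain ⟨a, ha⟩ := Projectivization.exists_smul_eq_mk_rep ℝ ε hε
  refine ⟨a, a.ne_zero, ?_⟩
  rw [← ha, Units.smul_def, lineCoord_real_smul]

theorem one_add_mul_I_ne_zero (τ : ℝ) : (1 + τ * Complex.I : ℂ) ≠ 0 := by
  intro h
  have := congrArg Complex.re h
  simp at this

theorem mk_ofLineCoord {x₀ x : X} (hx : x ∈ (trivializationAt ℂ L x₀).baseSet) {c : ℂ}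
    (ℓ : ℙ ℝ (L x →L[ℂ] ℂ)) (h : (lineCoord L x₀ x ℓ.rep / c).re ≠ 0)
    (h' : ofLineCoord L x₀ x ((1 + slope c (lineCoord L x₀ x ℓ.rep) * Complex.I) * c) ≠ 0) :
    Projectivization.mk ℝ _ h' = ℓ := by
  have hc : c ≠ 0 := by rintro rfl; simp at h
  set w := lineCoord L x₀ x ℓ.rep with hw
  conv_rhs => rw [← ℓ.mk_rep]
  rw [Projectivization.mk_eq_mk_iff']
  refine ⟨(w / c).re⁻¹, ?_⟩
  rw [← ofLineCoord_lineCoord hx ((w / c).re⁻¹ • ℓ.rep), lineCoord_real_smul, ← hw]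
  congr 1
  have hwc : w = (w / c) * c := (div_mul_cancel₀ w hc).symm
  have h2 : ((w / c).re⁻¹ : ℂ) * (w / c) = 1 + slope c w * Complex.I := by
    apply Complex.ext
    · rw [← Complex.ofReal_inv, Complex.re_ofReal_mul]; simp [h]
    · rw [← Complex.ofReal_inv, Complex.im_ofReal_mul]; simp [slope]; ring
  rw [← h2, mul_assoc, div_mul_cancel₀ w hc, Complex.ofReal_inv]

open Classical in
/-- The trivialization, over the domain of the trivialization of `L` around `x₀`, of the open set
of the real lines in `(f^*L)^*` that are not orthogonal to the real line with coordinate `c`. -/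
def rprojTriv (x₀ : X) (c : ℂ) : PartialEquiv (RProj L f) (B × ℝ) where
  toFun p := (p.base, slope c (lineCoord L x₀ (f p.base) p.line.rep))
  invFun q :=
    if h : ofLineCoord L x₀ (f q.1) ((1 + q.2 * Complex.I) * c) ≠ 0 then
      ⟨q.1, Projectivization.mk ℝ _ h⟩
    else ⟨q.1, Projectivization.mk ℝ (ofLineCoord L (f q.1) (f q.1) 1)
      (ofLineCoord_ne_zero (FiberBundle.mem_baseSet_trivializationAt' _) one_ne_zero)⟩
  source := {p | f p.base ∈ (trivializationAt ℂ L x₀).baseSet ∧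
    (lineCoord L x₀ (f p.base) p.line.rep / c).re ≠ 0}
  target := {q | f q.1 ∈ (trivializationAt ℂ L x₀).baseSet ∧ c ≠ 0}
  map_source' p hp := ⟨hp.1, by rintro rfl; simpa using hp.2⟩
  map_target' q hq := by
    have h := ofLineCoord_ne_zero hq.1 (mul_ne_zero (one_add_mul_I_ne_zero q.2) hq.2)
    rw [dif_pos h]
    refine ⟨hq.1, ?_⟩
    obtain ⟨r, hr, h'⟩ := lineCoord_rep_mk x₀ (f q.1) h
    change (lineCoord L x₀ (f q.1) (Projectivization.mk ℝ _ h).rep / c).re ≠ 0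
    rw [h', lineCoord_ofLineCoord hq.1, ← mul_assoc, mul_div_cancel_right₀ _ hq.2,
      Complex.re_ofReal_mul]
    simpa using hr
  left_inv' p hp := by
    have hc : c ≠ 0 := by rintro rfl; simpa using hp.2
    have h := ofLineCoord_ne_zero hp.1 (mul_ne_zero (one_add_mul_I_ne_zero
      (slope c (lineCoord L x₀ (f p.base) p.line.rep))) hc)
    simp only [dif_pos h]
    cases p
    simp only [RProj.mk.injEq, heq_eq_eq, true_and]
    exact mk_ofLineCoord hp.1 _ hp.2 h
  right_inv' q hq := by
    have h := ofLineCoord_ne_zero hq.1 (mul_ne_zero (one_add_mul_I_ne_zero q.2) hq.2)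
    rw [dif_pos h]
    refine Prod.ext rfl ?_
    obtain ⟨r, hr, h'⟩ := lineCoord_rep_mk x₀ (f q.1) h
    change slope c (lineCoord L x₀ (f q.1) (Projectivization.mk ℝ _ h).rep) = q.2
    rw [h', slope_real_smul _ _ hr, lineCoord_ofLineCoord hq.1, slope_line hq.2]

theorem rprojTriv_symm (x₀ : X) {c : ℂ} {q : B × ℝ}
    (hq : q ∈ (rprojTriv (L := L) (f := f) x₀ c).target) :
    (rprojTriv (L := L) (f := f) x₀ c).symm q =
      ⟨q.1, Projectivization.mk ℝ _
        (ofLineCoord_ne_zero hq.1 (mul_ne_zero (one_add_mul_I_ne_zero q.2) hq.2))⟩ :=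
  dif_pos (ofLineCoord_ne_zero hq.1 (mul_ne_zero (one_add_mul_I_ne_zero q.2) hq.2))

theorem rprojTriv_trans_source (x₀ x₁ : X) (c d : ℂ) :
    ((rprojTriv (L := L) (f := f) x₀ c).symm.trans (rprojTriv x₁ d)).source =
      {q | f q.1 ∈ (trivializationAt ℂ L x₀).baseSet ∩ (trivializationAt ℂ L x₁).baseSet ∧
        ((1 + q.2 * Complex.I) * c * lineTransition L x₀ x₁ (f q.1) / d).re ≠ 0} := by
  have key : ∀ q (hq : q ∈ (rprojTriv (L := L) (f := f) x₀ c).target),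
      ((lineCoord L x₁ (f q.1) (Projectivization.mk ℝ _
        (ofLineCoord_ne_zero hq.1 (mul_ne_zero (one_add_mul_I_ne_zero q.2) hq.2))).rep / d).re ≠ 0
      ↔ ((1 + q.2 * Complex.I) * c * lineTransition L x₀ x₁ (f q.1) / d).re ≠ 0) := by
    intro q hq
    obtain ⟨r, hr, h'⟩ := lineCoord_rep_mk x₁ (f q.1)
      (ofLineCoord_ne_zero hq.1 (mul_ne_zero (one_add_mul_I_ne_zero q.2) hq.2))
    rw [h', lineCoord_ofLineCoord', mul_div_assoc, Complex.re_ofReal_mul, mul_ne_zero_iff]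
    exact and_iff_right hr
  ext q
  rw [PartialEquiv.trans_source, PartialEquiv.symm_source]
  constructor
  · rintro ⟨h, h'⟩
    rw [Set.mem_preimage, rprojTriv_symm x₀ h] at h'
    exact ⟨⟨h.1, h'.1⟩, (key q h).1 h'.2⟩
  · rintro ⟨h, h'⟩
    have hc : c ≠ 0 := by rintro rfl; simp at h'
    refine ⟨⟨h.1, hc⟩, ?_⟩
    rw [Set.mem_preimage, rprojTriv_symm x₀ ⟨h.1, hc⟩]
    exact ⟨h.2, (key q ⟨h.1, hc⟩).2 h'⟩

theorem rprojTriv_trans_apply (x₀ x₁ : X) (c d : ℂ) {q : B × ℝ}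
    (hq : q ∈ (rprojTriv (L := L) (f := f) x₀ c).target) :
    (rprojTriv (L := L) (f := f) x₀ c).symm.trans (rprojTriv x₁ d) q =
      (q.1, slope d ((1 + q.2 * Complex.I) * c * lineTransition L x₀ x₁ (f q.1))) := by
  rw [PartialEquiv.coe_trans, Function.comp_apply, rprojTriv_symm x₀ hq]
  refine Prod.ext rfl ?_
  obtain ⟨r, hr, h'⟩ := lineCoord_rep_mk x₁ (f q.1)
    (ofLineCoord_ne_zero hq.1 (mul_ne_zero (one_add_mul_I_ne_zero q.2) hq.2))
  refine (congrArg (slope d) h').trans ?_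
  rw [slope_real_smul _ _ hr, lineCoord_ofLineCoord']

theorem contMDiffOn_line_arg [ContMDiffVectorBundle ω ℂ L 𝓘(ℂ, EX)] (x₀ x₁ : X) (c d : ℂ) :
    ContMDiffOn (𝓘(ℝ, E).prod 𝓘(ℝ, ℝ)) 𝓘(ℝ, ℂ) ∞
      (fun q : B × ℝ => (1 + q.2 * Complex.I) * c * lineTransition L x₀ x₁ (f q.1) / d)
      {q | f q.1 ∈ (trivializationAt ℂ L x₀).baseSet ∩ (trivializationAt ℂ L x₁).baseSet} := by
  have h1 : ContMDiffOn 𝓘(ℂ, E) 𝓘(ℂ, ℂ) ω (fun b : B => lineTransition L x₀ x₁ (f b))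
      {b | f b ∈ (trivializationAt ℂ L x₀).baseSet ∩ (trivializationAt ℂ L x₁).baseSet} :=
    (contMDiffOn_lineTransition (L := L) (EX := EX) x₀ x₁).comp f.contMDiff.contMDiffOn
      (fun _ h => h)
  have h2 : ContMDiffOn (𝓘(ℝ, E).prod 𝓘(ℝ, ℝ)) 𝓘(ℝ, ℂ) ∞
      (fun q : B × ℝ => lineTransition L x₀ x₁ (f q.1))
      {q | f q.1 ∈ (trivializationAt ℂ L x₀).baseSet ∩ (trivializationAt ℂ L x₁).baseSet} :=
    (contMDiffOn_restrictScalars h1).comp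
      (contMDiff_fst (I := 𝓘(ℝ, E)) (J := 𝓘(ℝ, ℝ))).contMDiffOn (fun _ h => h)
  have h3 : ContDiff ℝ ∞ (fun t : ℝ => (1 + t * Complex.I) * c) :=
    ((contDiff_const.add (Complex.ofRealCLM.contDiff.mul contDiff_const)).mul contDiff_const)
  have h4 : ContMDiffOn (𝓘(ℝ, E).prod 𝓘(ℝ, ℝ)) 𝓘(ℝ, ℂ) ∞
      (fun q : B × ℝ => (1 + q.2 * Complex.I) * c)
      {q | f q.1 ∈ (trivializationAt ℂ L x₀).baseSet ∩ (trivializationAt ℂ L x₁).baseSet} :=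
    h3.contMDiff.comp_contMDiffOn (contMDiff_snd (I := 𝓘(ℝ, E)) (J := 𝓘(ℝ, ℝ))).contMDiffOn
  have h5 : ContDiff ℝ ∞ (fun p : ℂ × ℂ => p.1 * p.2 / d) := by
    simp only [div_eq_mul_inv]
    exact (contDiff_fst.mul contDiff_snd).mul contDiff_const
  exact h5.contMDiff.comp_contMDiffOn (h4.prodMk_space h2)

theorem contMDiffOn_rprojTriv_trans [ContMDiffVectorBundle ω ℂ L 𝓘(ℂ, EX)] (x₀ x₁ : X) (c d : ℂ) :
    ContMDiffOn (𝓘(ℝ, E).prod 𝓘(ℝ, ℝ)) (𝓘(ℝ, E).prod 𝓘(ℝ, ℝ)) ∞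
      ((rprojTriv (L := L) (f := f) x₀ c).symm.trans (rprojTriv x₁ d))
      ((rprojTriv (L := L) (f := f) x₀ c).symm.trans (rprojTriv x₁ d)).source := by
  have hsub : ∀ q ∈ ((rprojTriv (L := L) (f := f) x₀ c).symm.trans (rprojTriv x₁ d)).source,
      q ∈ (rprojTriv (L := L) (f := f) x₀ c).target := fun q hq => hq.1
  have h1 : ContMDiffOn (𝓘(ℝ, E).prod 𝓘(ℝ, ℝ)) 𝓘(ℝ, ℝ) ∞
      (fun q : B × ℝ => slope d ((1 + q.2 * Complex.I) * c * lineTransition L x₀ x₁ (f q.1)))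
      ((rprojTriv (L := L) (f := f) x₀ c).symm.trans (rprojTriv x₁ d)).source := by
    have h2 := (contMDiffOn_line_arg (L := L) (f := f) x₀ x₁ c d).mono
      (t := ((rprojTriv (L := L) (f := f) x₀ c).symm.trans (rprojTriv x₁ d)).source) (by
        rw [rprojTriv_trans_source]; exact fun q hq => hq.1)
    have him := Complex.imCLM.contDiff (n := ∞) |>.contMDiff.comp_contMDiffOn h2
    have hre := Complex.reCLM.contDiff (n := ∞) |>.contMDiff.comp_contMDiffOn h2
    refine him.div₀ hre ?_
    intro q hq
    rw [rprojTriv_trans_source] at hq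
    exact hq.2
  refine ((contMDiff_fst (I := 𝓘(ℝ, E)) (J := 𝓘(ℝ, ℝ))).contMDiffOn.prodMk h1).congr ?_
  intro q hq
  exact rprojTriv_trans_apply x₀ x₁ c d (hsub q hq)

variable [ContMDiffVectorBundle ω ℂ L 𝓘(ℂ, EX)]

variable (L f) in
/-- The atlas of `(f^*L)^* ∖ 0` given by the trivializations of `L`. -/
def slitCore : ChartedSpaceCore (B × ℂ) (Slit L f) where
  atlas := Set.range slitTriv
  chartAt p := slitTriv (f p.base)
  mem_chart_source _ := FiberBundle.mem_baseSet_trivializationAt' _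
  chart_mem_atlas p := ⟨f p.base, rfl⟩
  open_source := by
    rintro _ _ ⟨x₀, rfl⟩ ⟨x₁, rfl⟩
    rw [slitTriv_trans_source]
    exact (((trivializationAt ℂ L x₀).open_baseSet.inter
      (trivializationAt ℂ L x₁).open_baseSet).preimage
        (f.contMDiff.continuous.comp continuous_fst)).inter
      (isOpen_ne.preimage continuous_snd)
  continuousOn_toFun := by
    rintro _ _ ⟨x₀, rfl⟩ ⟨x₁, rfl⟩
    exact (contMDiffOn_slitTriv_trans x₀ x₁).continuousOn

variable (L f) in
/-- The atlas of the real projective bundle of `(f^*L)^*` given by the trivializations of `L` and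
the affine charts of the real projective line. -/
def rprojCore : ChartedSpaceCore (B × ℝ) (RProj L f) where
  atlas := Set.range fun i : X × ℂ => rprojTriv i.1 i.2
  chartAt p := rprojTriv (f p.base) (lineCoord L (f p.base) (f p.base) p.line.rep)
  mem_chart_source p := by
    have h : f p.base ∈ (trivializationAt ℂ L (f p.base)).baseSet :=
      FiberBundle.mem_baseSet_trivializationAt' _
    refine ⟨h, ?_⟩
    rw [div_self (lineCoord_ne_zero h p.line.rep_nonzero)]
    simp
  chart_mem_atlas p := ⟨(f p.base, lineCoord L (f p.base) (f p.base) p.line.rep), rfl⟩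
  open_source := by
    rintro _ _ ⟨⟨x₀, c⟩, rfl⟩ ⟨⟨x₁, d⟩, rfl⟩
    simp only [rprojTriv_trans_source]
    exact (Complex.continuous_re.comp_continuousOn
      (contMDiffOn_line_arg (L := L) (f := f) x₀ x₁ c d).continuousOn).isOpen_inter_preimage
      (((trivializationAt ℂ L x₀).open_baseSet.inter
        (trivializationAt ℂ L x₁).open_baseSet).preimage
          (f.contMDiff.continuous.comp continuous_fst)) isOpen_ne
  continuousOn_toFun := by
    rintro _ _ ⟨⟨x₀, c⟩, rfl⟩ ⟨⟨x₁, d⟩, rfl⟩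
    exact (contMDiffOn_rprojTriv_trans x₀ x₁ c d).continuousOn

instance : TopologicalSpace (Slit L f) := (slitCore L f).toTopologicalSpace

instance : ChartedSpace (ModelProd E ℂ) (Slit L f) :=
  letI := (slitCore L f).toChartedSpace
  ChartedSpace.comp (ModelProd E ℂ) (B × ℂ) (Slit L f)

instance [IsManifold 𝓘(ℂ, E) ω B] : IsManifold (𝓘(ℂ, E).prod 𝓘(ℂ, ℂ)) ω (Slit L f) :=
  isManifold_comp _ _ (B × ℂ) (Slit L f) (slitCore L f) (by
    rintro _ ⟨x₀, rfl⟩ _ ⟨x₁, rfl⟩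
    exact contMDiffOn_slitTriv_trans x₀ x₁)

instance : TopologicalSpace (RProj L f) := (rprojCore L f).toTopologicalSpace

instance : ChartedSpace (ModelProd E ℝ) (RProj L f) :=
  letI := (rprojCore L f).toChartedSpace
  ChartedSpace.comp (ModelProd E ℝ) (B × ℝ) (RProj L f)

instance [IsManifold 𝓘(ℂ, E) ω B] : IsManifold (𝓘(ℝ, E).prod 𝓘(ℝ, ℝ)) ∞ (RProj L f) :=
  have := isManifold_real E B
  isManifold_comp _ _ (B × ℝ) (RProj L f) (rprojCore L f) (by
    rintro _ ⟨⟨x₀, c⟩, rfl⟩ _ ⟨⟨x₁, d⟩, rfl⟩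
    exact contMDiffOn_rprojTriv_trans x₀ x₁ c d)

/-- The projection `(f^*L)^* ∖ 0 → ℝℙ((f^*L)^*)`, with fibres the orbits of `ℝ^×`. -/
def Slit.toRProj (p : Slit L f) : RProj L f := ⟨p.base, Projectivization.mk ℝ p.covec p.ne_zero⟩

/-- The flow of the Euler vector field, `(z, ε) ↦ exp(z) ε`. -/
def Slit.flow (p : Slit L f) (z : ℂ) : Slit L f :=
  ⟨p.base, Complex.exp z • p.covec, smul_ne_zero (Complex.exp_ne_zero z) p.ne_zero⟩

end Total

section Groupoids

/-- A groupoid with arrows `G` and objects `M`. An arrow `g` goes from `src g` to `tgt g`, and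
`mul g h` is the product of arrows with `src g = tgt h` (its other values are irrelevant). -/
structure GroupoidStr (G M : Type*) where
  src : G → M
  tgt : G → M
  unit : M → G
  inv : G → G
  mul : G → G → G
  src_unit : ∀ x, src (unit x) = x
  tgt_unit : ∀ x, tgt (unit x) = x
  src_inv : ∀ g, src (inv g) = tgt g
  tgt_inv : ∀ g, tgt (inv g) = src g
  src_mul : ∀ g h, src g = tgt h → src (mul g h) = src h
  tgt_mul : ∀ g h, src g = tgt h → tgt (mul g h) = tgt g
  mul_assoc : ∀ g h k, src g = tgt h → src h = tgt k → mul (mul g h) k = mul g (mul h k)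
  unit_mul : ∀ g, mul (unit (tgt g)) g = g
  mul_unit : ∀ g, mul g (unit (src g)) = g
  mul_inv : ∀ g, mul g (inv g) = unit (tgt g)
  inv_mul : ∀ g, mul (inv g) g = unit (src g)

variable {𝕜 : Type*} [NontriviallyNormedField 𝕜]
  {E : Type*} [NormedAddCommGroup E] [NormedSpace 𝕜 E] {K : Type*} [TopologicalSpace K]
  (I : ModelWithCorners 𝕜 E K)
  {F : Type*} [NormedAddCommGroup F] [NormedSpace 𝕜 F] {K' : Type*} [TopologicalSpace K']
  (J : ModelWithCorners 𝕜 F K')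
  (n : WithTop ℕ∞)
  (G : Type*) [TopologicalSpace G] [ChartedSpace K G]
  (M : Type*) [TopologicalSpace M] [ChartedSpace K' M]

/-- The set `G⁽²⁾` of composable pairs of arrows. -/
def GroupoidStr.composable {G M : Type*} (Γ : GroupoidStr G M) : Set (G × G) :=
  {p | Γ.src p.1 = Γ.tgt p.2}

/-- Lie groupoids of class `C^n`; for `𝕜 = ℂ` and `n = ω` these are the complex Lie groupoids.
Smoothness of the multiplication on the closed submanifold `G⁽²⁾` of `G × G` is smoothness within
that subset. -/
structure LieGroupoid extends GroupoidStr G M where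
  contMDiff_src : ContMDiff I J n src
  contMDiff_tgt : ContMDiff I J n tgt
  contMDiff_unit : ContMDiff J I n unit
  contMDiff_inv : ContMDiff I I n inv
  contMDiffOn_mul : ContMDiffOn (I.prod I) I n (fun p : G × G => mul p.1 p.2)
    toGroupoidStr.composable
  submersion_src : ∀ g, Function.Surjective (mfderiv I J src g)
  submersion_tgt : ∀ g, Function.Surjective (mfderiv I J tgt g)

variable {I J n G M}

/-- The target map, bundled. -/
def LieGroupoid.tgtMap (Γ : LieGroupoid I J n G M) : ContMDiffMap I J G M n :=
  ⟨Γ.tgt, Γ.contMDiff_tgt⟩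

/-- The multiplication of the tangent groupoid `TG ⇉ TM`: the differential of the multiplication
along `G⁽²⁾`. It is meaningful for tangent vectors `V`, `W` with `ds(V) = dt(W)`. -/
def GroupoidStr.tangentMul (Γ : GroupoidStr G M) (I : ModelWithCorners 𝕜 E K)
    (V W : TangentBundle I G) : TangentBundle I G :=
  ⟨Γ.mul V.proj W.proj,
    mfderivWithin (I.prod I) I (fun p : G × G => Γ.mul p.1 p.2) Γ.composable (V.proj, W.proj)
      (V.snd, W.snd)⟩

/-- A distribution `D ⊂ TG` is multiplicative and covers `TM` if it is a VB-subgroupoid of the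
tangent groupoid `TG ⇉ TM` with space of objects all of `TM`. -/
structure IsMultiplicative (Γ : GroupoidStr G M) (I : ModelWithCorners 𝕜 E K)
    (J : ModelWithCorners 𝕜 F K') (D : ∀ g : G, Submodule 𝕜 (TangentSpace I g)) : Prop where
  covers : ∀ g, ∀ u : TangentSpace J (Γ.src g), ∃ v ∈ D g, mfderiv I J Γ.src g v = u
  unit_mem : ∀ x, ∀ u : TangentSpace J x, mfderiv J I Γ.unit x u ∈ D (Γ.unit x)
  inv_mem : ∀ g, ∀ v ∈ D g, mfderiv I I Γ.inv g v ∈ D (Γ.inv g)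
  mul_mem : ∀ V W : TangentBundle I G, tangentMap I J Γ.src V = tangentMap I J Γ.tgt W →
    V.snd ∈ D V.proj → W.snd ∈ D W.proj →
    (Γ.tangentMul I V W).snd ∈ D (Γ.tangentMul I V W).proj

/-- A distribution `D` is maximally non-integrable if its curvature `D × D → TG / D`,
`(v, w) ↦ [V, W] mod D`, is non-degenerate; here `V`, `W` are any local sections of `D` that
extend `v`, `w`. -/
def IsMaximallyNonintegrable (I : ModelWithCorners 𝕜 E K) [IsManifold I 1 G] (n : WithTop ℕ∞)
    (D : ∀ g : G, Submodule 𝕜 (TangentSpace I g)) : Prop :=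
  ∀ g, ∀ v ∈ D g, v ≠ 0 → ∃ V W : ∀ y : G, TangentSpace I y,
    ContMDiffAt I I.tangent n (fun y => (⟨y, V y⟩ : TangentBundle I G)) g ∧
    ContMDiffAt I I.tangent n (fun y => (⟨y, W y⟩ : TangentBundle I G)) g ∧
    (∀ᶠ y in nhds g, V y ∈ D y) ∧ (∀ᶠ y in nhds g, W y ∈ D y) ∧
    V g = v ∧ VectorField.mlieBracket I V W g ∉ D g

/-- The exterior derivative of a `1`-form on a manifold without boundary, computed in the
preferred chart at each point: `dα(v, w) = v(α(w)) - w(α(v))` for constant `v`, `w`. -/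
def extDerivOne (I : ModelWithCorners 𝕜 E K) (α : ∀ p : G, TangentSpace I p →L[𝕜] 𝕜) (p : G) :
    TangentSpace I p →L[𝕜] TangentSpace I p →L[𝕜] 𝕜 :=
  let φ := extChartAt I p
  let a : E → E →L[𝕜] 𝕜 := fun y => (α (φ.symm y)).comp (mfderiv 𝓘(𝕜, E) I φ.symm y)
  let A : E →L[𝕜] E →L[𝕜] 𝕜 := fderiv 𝕜 a (φ p)
  let d : E →L[𝕜] E := mfderiv I 𝓘(𝕜, E) φ p
  let r : E →L[𝕜] E →L[𝕜] 𝕜 := (A - A.flip).bilinearComp d d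
  r

end Groupoids

section Contact

variable {EX : Type*} [NormedAddCommGroup EX] [NormedSpace ℂ EX]
  {X : Type*} [TopologicalSpace X] [ChartedSpace EX X]
  {EG : Type*} [NormedAddCommGroup EG] [NormedSpace ℂ EG]
  {G : Type*} [TopologicalSpace G] [ChartedSpace EG G]
  (Γ : LieGroupoid 𝓘(ℂ, EG) 𝓘(ℂ, EX) ω G X)
  (L : X → Type*) [∀ x, AddCommGroup (L x)] [∀ x, Module ℂ (L x)] [∀ x, TopologicalSpace (L x)]
  [TopologicalSpace (TotalSpace ℂ L)] [FiberBundle ℂ L] [VectorBundle ℂ ℂ L]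

/-- A holomorphic action of the complex Lie groupoid `G ⇉ X` on the holomorphic line bundle
`L → X`, by linear isomorphisms `g : L_{s(g)} → L_{t(g)}`. Vectors of fibres of `L` over points
that are only propositionally equal are compared as points of the total space of `L`. Such an
action is the same as an LB-groupoid structure on `t^*L ⇉ 0_X`, with product
`(g, ℓ)(h, ℓ') = (gh, ℓ + g.ℓ')`. -/
structure LineAction where
  act : ∀ g, L (Γ.src g) ≃L[ℂ] L (Γ.tgt g)
  act_unit : ∀ x, ∀ v : L (Γ.src (Γ.unit x)),
    (⟨_, act (Γ.unit x) v⟩ : TotalSpace ℂ L) = ⟨_, v⟩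
  act_mul : ∀ g h, Γ.src g = Γ.tgt h →
    ∀ (u : L (Γ.src (Γ.mul g h))) (v : L (Γ.src h)) (w : L (Γ.src g)),
      (⟨_, u⟩ : TotalSpace ℂ L) = ⟨_, v⟩ → (⟨_, w⟩ : TotalSpace ℂ L) = ⟨_, act h v⟩ →
      (⟨_, act (Γ.mul g h) u⟩ : TotalSpace ℂ L) = ⟨_, act g w⟩
  holomorphic : ∀ g₀, ContMDiffAt 𝓘(ℂ, EG) 𝓘(ℂ, ℂ →L[ℂ] ℂ) ω
    (fun g => ContinuousLinearMap.inCoordinates ℂ L ℂ L (Γ.src g₀) (Γ.src g) (Γ.tgt g₀) (Γ.tgt g)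
      (act g : L (Γ.src g) →L[ℂ] L (Γ.tgt g))) g₀

variable {Γ L}

/-- Holomorphy of a `t^*L`-valued `(1,0)`-form on `G`. -/
def IsHolomorphicForm [IsManifold 𝓘(ℂ, EG) ω G]
    (θ : ∀ g, TangentSpace 𝓘(ℂ, EG) g →L[ℂ] L (Γ.tgt g)) : Prop :=
  ∀ g₀, ContMDiffAt 𝓘(ℂ, EG) 𝓘(ℂ, EG →L[ℂ] ℂ) ω
    (fun g => ContinuousLinearMap.inCoordinates EG (TangentSpace 𝓘(ℂ, EG)) ℂ L g₀ g
      (Γ.tgt g₀) (Γ.tgt g) (θ g)) g₀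

/-- The map `θ : TG → t^*L` is a map of groupoids from the tangent groupoid to the LB-groupoid
`t^*L ⇉ 0_X` of the action: `θ(V · W) = θ(V) + g.θ(W)` for composable `V ∈ T_gG`, `W ∈ T_hG`.
If `θ` is surjective with multiplicative kernel `H`, this says that the induced isomorphism
`TG / H ≅ t^*L` is one of LB-groupoids, where the product in `TG / H` is `[V] · [W] = [V · W]`. -/
def IsGroupoidMap (A : LineAction Γ L)
    (θ : ∀ g, TangentSpace 𝓘(ℂ, EG) g →L[ℂ] L (Γ.tgt g)) : Prop :=
  ∀ V W : TangentBundle 𝓘(ℂ, EG) G,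
    tangentMap 𝓘(ℂ, EG) 𝓘(ℂ, EX) Γ.src V = tangentMap 𝓘(ℂ, EG) 𝓘(ℂ, EX) Γ.tgt W →
    ∀ ℓ : L (Γ.src V.proj), (⟨_, ℓ⟩ : TotalSpace ℂ L) = ⟨_, θ W.proj W.snd⟩ →
      (⟨_, θ _ (Γ.tangentMul 𝓘(ℂ, EG) V W).snd⟩ : TotalSpace ℂ L) =
        ⟨_, θ V.proj V.snd + A.act V.proj ℓ⟩

variable (X) in
/-- The identity of `X`, bundled. -/
def idMap : ContMDiffMap 𝓘(ℂ, EX) 𝓘(ℂ, EX) X X ω := ⟨fun x => x, contMDiff_id⟩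

/-- `M̂`, the real projective bundle of the complex dual of `L`. -/
abbrev BaseHat (_ : LieGroupoid 𝓘(ℂ, EG) 𝓘(ℂ, EX) ω G X) (L : X → Type*)
    [∀ x, AddCommGroup (L x)] [∀ x, Module ℂ (L x)] [∀ x, TopologicalSpace (L x)] := RProj L (idMap (EX := EX) X)

variable (Γ L) in
/-- `Ĝ`, the real projective bundle of the complex dual of `L_G = t^*L`. -/
abbrev ArrowHat := RProj L Γ.tgtMap

variable (Γ L) in
/-- `G̃ = L_G^* ∖ 0`, the complex homogenization of `L_G = t^*L`. -/
abbrev ArrowTilde := Slit L Γ.tgtMap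

/-- `ε ↦ ε ∘ g`, the action of `g⁻¹` on covectors. -/
def LineAction.dual (A : LineAction Γ L) (g : G) :
    (L (Γ.tgt g) →L[ℂ] ℂ) →ₗ[ℝ] (L (Γ.src g) →L[ℂ] ℂ) where
  toFun ε := ε.comp (A.act g : L (Γ.src g) →L[ℂ] L (Γ.tgt g))
  map_add' _ _ := rfl
  map_smul' _ _ := rfl

theorem LineAction.dual_injective (A : LineAction Γ L) (g : G) :
    Function.Injective (A.dual g) := by
  intro ε η h
  ext v
  have h' : ε (A.act g ((A.act g).symm v)) = η (A.act g ((A.act g).symm v)) :=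
    DFunLike.congr_fun h ((A.act g).symm v)
  rwa [ContinuousLinearEquiv.apply_symm_apply] at h'

/-- The target of an arrow `(g, [ε])` of `Ĝ`. -/
def tgtHat (z : ArrowHat Γ L) : BaseHat Γ L := ⟨Γ.tgt z.base, z.line⟩

/-- The source `[ε ∘ g]` of an arrow `(g, [ε])` of `Ĝ`. -/
def srcHat (A : LineAction Γ L) (z : ArrowHat Γ L) : BaseHat Γ L :=
  ⟨Γ.src z.base, z.line.map (A.dual z.base) (A.dual_injective z.base)⟩

/-- Transport of real lines in the fibres of `L^*` along an equality of base points. -/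
def castLine {x y : X} (h : x = y) (ℓ : ℙ ℝ (L y →L[ℂ] ℂ)) : ℙ ℝ (L x →L[ℂ] ℂ) := h ▸ ℓ

/-- The arrow of `Ĝ` over `g` with target `p`. -/
def arrowOf (g : G) (p : BaseHat Γ L) (h : Γ.tgt g = p.base) : ArrowHat Γ L :=
  ⟨g, castLine h p.line⟩

theorem tgtHat_arrowOf (g : G) (p : BaseHat Γ L) (h : Γ.tgt g = p.base) :
    tgtHat (arrowOf (Γ := Γ) g p h) = p := by
  obtain ⟨x, ℓ⟩ := p
  change Γ.tgt g = x at h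
  subst h
  rfl

theorem arrowHat_ext {z w : ArrowHat Γ L} (h : z.base = w.base) (h' : tgtHat z = tgtHat w) :
    z = w := by
  obtain ⟨g, ℓ⟩ := z
  obtain ⟨g', ℓ'⟩ := w
  obtain rfl : g = g' := h
  exact congrArg (RProj.mk g) (eq_of_heq (RProj.mk.inj h').2)

theorem srcHat_arrowOf_eq (A : LineAction Γ L) (g : G) {x y : X} {ε : L x →L[ℂ] ℂ} (hε : ε ≠ 0)
    {η : L y →L[ℂ] ℂ} (hη : η ≠ 0) (hx : Γ.tgt g = x) (hy : Γ.src g = y)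
    (H : ∀ (v : L (Γ.src g)) (v' : L y) (w : L x), (⟨_, v⟩ : TotalSpace ℂ L) = ⟨_, v'⟩ →
      (⟨_, A.act g v⟩ : TotalSpace ℂ L) = ⟨_, w⟩ → η v' = ε w) :
    srcHat A (arrowOf g ⟨x, Projectivization.mk ℝ ε hε⟩ hx) =
      ⟨y, Projectivization.mk ℝ η hη⟩ := by
  subst hx hy
  have : η = A.dual g ε := by
    ext v
    exact H v v _ rfl rfl
  subst this
  rfl

theorem exists_srcHat_arrowOf (A : LineAction Γ L) (g : G) {x : X} {ε : L x →L[ℂ] ℂ}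
    (hε : ε ≠ 0) (hx : Γ.tgt g = x) :
    ∃ (η : L (Γ.src g) →L[ℂ] ℂ) (hη : η ≠ 0),
      srcHat A (arrowOf g ⟨x, Projectivization.mk ℝ ε hε⟩ hx) =
        ⟨Γ.src g, Projectivization.mk ℝ η hη⟩ ∧
      ∀ (v : L (Γ.src g)) (w : L x), (⟨_, A.act g v⟩ : TotalSpace ℂ L) = ⟨_, w⟩ → η v = ε w := by
  subst hx
  refine ⟨A.dual g ε, fun h => hε (A.dual_injective g (h.trans (map_zero _).symm)), rfl, ?_⟩
  intro v w h
  have : A.act g v = w := by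
    rw [TotalSpace.mk.injEq] at h
    exact eq_of_heq h.2
  rw [← this]
  rfl

theorem exists_mk (p : BaseHat Γ L) : ∃ (x : X) (ε : L x →L[ℂ] ℂ) (hε : ε ≠ 0),
    p = ⟨x, Projectivization.mk ℝ ε hε⟩ :=
  ⟨p.base, p.line.rep, p.line.rep_nonzero, by rw [Projectivization.mk_rep]⟩

theorem srcHat_unit (A : LineAction Γ L) (p : BaseHat Γ L) :
    srcHat A (arrowOf (Γ.unit p.base) p (Γ.tgt_unit _)) = p := by
  obtain ⟨x, ε, hε, rfl⟩ := exists_mk p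
  refine srcHat_arrowOf_eq A _ hε hε _ (Γ.src_unit x) ?_
  intro v v' w h1 h2
  rw [A.act_unit, h1, TotalSpace.mk.injEq] at h2
  rw [eq_of_heq h2.2]

theorem srcHat_mul (A : LineAction Γ L) (g h : G) (hgh : Γ.src g = Γ.tgt h) (p : BaseHat Γ L)
    (hp : Γ.tgt g = p.base) :
    srcHat A (arrowOf (Γ.mul g h) p ((Γ.tgt_mul g h hgh).trans hp)) =
      srcHat A (arrowOf h (srcHat A (arrowOf g p hp)) hgh.symm) := by
  obtain ⟨x, ε, hε, rfl⟩ := exists_mk p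
  obtain ⟨η, hη, e1, H1⟩ := exists_srcHat_arrowOf A g hε hp
  obtain ⟨κ, hκ, e2, H2⟩ := exists_srcHat_arrowOf A h hη hgh.symm
  simp only [e1]
  rw [e2]
  refine srcHat_arrowOf_eq A _ hε hκ _ (Γ.src_mul g h hgh) ?_
  intro u v w h1 h2
  obtain ⟨w', hw'⟩ : ∃ w' : L (Γ.src g),
      (⟨_, w'⟩ : TotalSpace ℂ L) = ⟨Γ.tgt h, A.act h v⟩ := by
    rw [hgh]
    exact ⟨_, rfl⟩
  rw [H2 v w' hw'.symm]
  exact H1 w' w ((A.act_mul g h hgh u v w' h1 hw').symm.trans h2)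

theorem srcHat_congr (A : LineAction Γ L) {g g' : G} {p p' : BaseHat Γ L} (hg : g = g')
    (hp : p = p') (h : Γ.tgt g = p.base) (h' : Γ.tgt g' = p'.base) :
    srcHat A (arrowOf g p h) = srcHat A (arrowOf g' p' h') := by
  subst hg hp
  rfl

theorem arrowOf_tgtHat (z : ArrowHat Γ L) : arrowOf z.base (tgtHat z) rfl = z :=
  arrowHat_ext rfl (tgtHat_arrowOf _ _ _)

open Classical in
/-- The multiplication of `Ĝ`: `(g, [ε]) (h, [ε ∘ g]) = (gh, [ε])`. -/
def mulHat (z w : ArrowHat Γ L) : ArrowHat Γ L :=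
  if h : Γ.src z.base = Γ.tgt w.base then
    arrowOf (Γ.mul z.base w.base) (tgtHat z) (Γ.tgt_mul _ _ h) else z

theorem mulHat_eq {z w : ArrowHat Γ L} (h : Γ.src z.base = Γ.tgt w.base) :
    mulHat z w = arrowOf (Γ.mul z.base w.base) (tgtHat z) (Γ.tgt_mul _ _ h) := dif_pos h

theorem mulHat_base {z w : ArrowHat Γ L} (h : Γ.src z.base = Γ.tgt w.base) :
    (mulHat z w).base = Γ.mul z.base w.base := by rw [mulHat_eq h]; rfl

theorem tgtHat_mulHat {z w : ArrowHat Γ L} (h : Γ.src z.base = Γ.tgt w.base) :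
    tgtHat (mulHat z w) = tgtHat z := by rw [mulHat_eq h]; exact tgtHat_arrowOf _ _ _

/-- The groupoid `Ĝ ⇉ M̂`, i.e. the action groupoid of the action of `G` on `M̂` induced by the
one on `L`. -/
def groupoidHat (A : LineAction Γ L) : GroupoidStr (ArrowHat Γ L) (BaseHat Γ L) where
  src := srcHat A
  tgt := tgtHat
  unit p := arrowOf (Γ.unit p.base) p (Γ.tgt_unit _)
  inv z := arrowOf (Γ.inv z.base) (srcHat A z) (Γ.tgt_inv _)
  mul := mulHat
  src_unit p := srcHat_unit A p
  tgt_unit p := tgtHat_arrowOf _ _ _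
  src_inv z := by
    have h := srcHat_mul A z.base (Γ.inv z.base) (Γ.tgt_inv _).symm (tgtHat z) rfl
    refine Eq.trans (srcHat_congr A rfl (by rw [arrowOf_tgtHat]) _ _) (h.symm.trans ?_)
    exact (srcHat_congr A (Γ.mul_inv _) rfl _ (Γ.tgt_unit _)).trans (srcHat_unit A (tgtHat z))
  tgt_inv z := tgtHat_arrowOf _ _ _
  src_mul z w h := by
    have h0 : Γ.src z.base = Γ.tgt w.base := congrArg RProj.base h
    rw [mulHat_eq h0]
    refine (srcHat_mul A z.base w.base h0 (tgtHat z) rfl).trans ?_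
    refine (srcHat_congr A rfl ?_ _ rfl).trans (congrArg (srcHat A) (arrowOf_tgtHat w))
    rw [arrowOf_tgtHat, h]
  tgt_mul z w h := tgtHat_mulHat (congrArg RProj.base h)
  mul_assoc z w u h h' := by
    have h0 : Γ.src z.base = Γ.tgt w.base := congrArg RProj.base h
    have h0' : Γ.src w.base = Γ.tgt u.base := congrArg RProj.base h'
    have h1 : Γ.src (mulHat z w).base = Γ.tgt u.base := by
      rw [mulHat_base h0, Γ.src_mul _ _ h0, h0']
    have h2 : Γ.src z.base = Γ.tgt (mulHat w u).base := by
      rw [mulHat_base h0', Γ.tgt_mul _ _ h0', h0]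
    apply arrowHat_ext
    · rw [mulHat_base h1, mulHat_base h2, mulHat_base h0, mulHat_base h0',
        Γ.mul_assoc _ _ _ h0 h0']
    · rw [tgtHat_mulHat h1, tgtHat_mulHat h2, tgtHat_mulHat h0]
  unit_mul z := by
    have h : Γ.src (arrowOf (Γ.unit (tgtHat z).base) (tgtHat z) (Γ.tgt_unit _)).base =
      Γ.tgt z.base := Γ.src_unit _
    apply arrowHat_ext
    · exact (mulHat_base h).trans (Γ.unit_mul _)
    · exact (tgtHat_mulHat h).trans (tgtHat_arrowOf _ _ _)
  mul_unit z := by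
    have h : Γ.src z.base = Γ.tgt (arrowOf (Γ := Γ) (Γ.unit (srcHat A z).base)
      (srcHat A z) (Γ.tgt_unit _)).base := (Γ.tgt_unit _).symm
    apply arrowHat_ext
    · exact (mulHat_base h).trans (Γ.mul_unit _)
    · exact tgtHat_mulHat h
  mul_inv z := by
    have h : Γ.src z.base = Γ.tgt (arrowOf (Γ := Γ) (Γ.inv z.base)
      (srcHat A z) (Γ.tgt_inv _)).base := (Γ.tgt_inv _).symm
    apply arrowHat_ext
    · exact (mulHat_base h).trans (Γ.mul_inv _)
    · exact (tgtHat_mulHat h).trans (tgtHat_arrowOf _ _ _).symm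
  inv_mul z := by
    have h : Γ.src (arrowOf (Γ := Γ) (Γ.inv z.base) (srcHat A z) (Γ.tgt_inv _)).base =
      Γ.tgt z.base := Γ.src_inv _
    apply arrowHat_ext
    · exact (mulHat_base h).trans (Γ.inv_mul _)
    · exact (tgtHat_mulHat h).trans ((tgtHat_arrowOf _ _ _).trans (tgtHat_arrowOf _ _ _).symm)

variable [ContMDiffVectorBundle ω ℂ L 𝓘(ℂ, EX)]

/-- The holomorphic Euler vector field `Z` on `G̃`: the velocity of `z ↦ exp(z) ε` at `z = 0`.
Under the identification `T^{1,0}G̃ ≅ TG̃` it is the real vector field `2 Re Z`. -/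
def eulerField (p : ArrowTilde Γ L) : TangentSpace (𝓘(ℂ, EG).prod 𝓘(ℂ, ℂ)) p :=
  (mfderiv 𝓘(ℂ, ℂ) (𝓘(ℂ, EG).prod 𝓘(ℂ, ℂ)) p.flow 0 (1 : ℂ) :)

/-- The holomorphic `1`-form `Θ` on `G̃`, `Θ_ε(v) = ⟨ε, θ(dp(v))⟩`, with `p : G̃ → G` the
projection. -/
def liouvilleForm (θ : ∀ g, TangentSpace 𝓘(ℂ, EG) g →L[ℂ] L (Γ.tgt g)) (p : ArrowTilde Γ L) :
    TangentSpace (𝓘(ℂ, EG).prod 𝓘(ℂ, ℂ)) p →L[ℂ] ℂ :=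
  (p.covec.comp (θ p.base)).comp
    (mfderiv (𝓘(ℂ, EG).prod 𝓘(ℂ, ℂ)) 𝓘(ℂ, EG) Slit.base p)

/-- The complex symplectization form `Ω = dΘ` on `G̃`. -/
def symplectization (θ : ∀ g, TangentSpace 𝓘(ℂ, EG) g →L[ℂ] L (Γ.tgt g)) (p : ArrowTilde Γ L) :
    TangentSpace (𝓘(ℂ, EG).prod 𝓘(ℂ, ℂ)) p →L[ℂ]
      TangentSpace (𝓘(ℂ, EG).prod 𝓘(ℂ, ℂ)) p →L[ℂ] ℂ :=
  extDerivOne (𝓘(ℂ, EG).prod 𝓘(ℂ, ℂ)) (liouvilleForm θ) p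

/-- The kernel of the real `1`-form `ι_{2 Re Z} Re Ω` on `G̃`. -/
def reKernel (θ : ∀ g, TangentSpace 𝓘(ℂ, EG) g →L[ℂ] L (Γ.tgt g)) (p : ArrowTilde Γ L) :
    Submodule ℝ (TangentSpace (𝓘(ℝ, EG).prod 𝓘(ℝ, ℂ)) p) where
  carrier := {v | (symplectization θ p (eulerField p) v).re = 0}
  add_mem' {v w} hv hw := by
    have h := (symplectization θ p (eulerField p)).map_add v w
    simp only [Set.mem_ofPred_eq] at hv hw ⊢
    exact (congrArg Complex.re h).trans (by rw [Complex.add_re, hv, hw, add_zero])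
  zero_mem' := congrArg Complex.re ((symplectization θ p (eulerField p)).map_zero)
  smul_mem' r v hv := by
    have h := (symplectization θ p (eulerField p)).map_smul (r : ℂ) v
    simp only [Set.mem_ofPred_eq] at hv ⊢
    exact (congrArg Complex.re h).trans (by rw [smul_eq_mul, Complex.re_ofReal_mul, hv, mul_zero])

/-- The contact structure `Ĥ` on `Ĝ` induced by `H = ker θ`, whose symplectization is `Re Ω`: at
a point `z` of `Ĝ` it is the image, under the projection `G̃ → Ĝ`, of the kernel of
`ι_{2 Re Z} Re Ω` at a point of `G̃` over `z`. By homogeneity this image is the same for all the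
points over `z`, so that the supremum below is of a constant family. -/
def contactHat (θ : ∀ g, TangentSpace 𝓘(ℂ, EG) g →L[ℂ] L (Γ.tgt g)) (z : ArrowHat Γ L) :
    Submodule ℝ (TangentSpace (𝓘(ℝ, EG).prod 𝓘(ℝ, ℝ)) z) :=
  ⨆ (p : ArrowTilde Γ L) (h : p.toRProj = z),
    h ▸ (reKernel θ p).map (mfderiv (𝓘(ℝ, EG).prod 𝓘(ℝ, ℂ)) (𝓘(ℝ, EG).prod 𝓘(ℝ, ℝ))
      Slit.toRProj p).toLinearMap

end Contact

end

end HolContact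

/-!
Since `ι_Z Ω = Θ`, the space `Ĥ` at `z = (g, [ε])` consists of the tangent vectors of `Ĝ` whose
projection `v ∈ T_g G` satisfies `Re ⟨ε, θ v⟩ = 0`. The projection `Ĝ → G` is a morphism of Lie
groupoids, and a tangent vector of `Ĝ` amounts to one of `G` together with a lift to `T M̂` of its
image under the source map, or under the target map.

If `θ` is a map of groupoids with multiplicative kernel, the condition at a product or an inverse
reduces, through `⟨ε, g.ℓ⟩ = ⟨ε ∘ g, ℓ⟩`, to the conditions at the factors. Conversely, suppose that
`Ĥ` is multiplicative. A vector of `L` vanishes as soon as `Re ε` annihilates it for all `ε`, so the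
closure of `ker θ` under units, inverses and products follows from that of `Ĥ` at all lines
`[ε]` over a given point. For a single `ε`, the vectors `v` with `Re ⟨ε, θ_g v⟩ = 0` cover `T X`.
So do those with `⟨ε, θ_g v⟩ = 0`, unless `⟨ε, θ_g⟩` vanishes on `ker ds`; but then the real part of
`⟨ε, θ_g⟩` vanishes identically, and so does `⟨ε, θ_g⟩`.
-/

namespace HolContact

open Filter Topology

noncomputable section

section RestrictScalars

variable (𝕜 : Type*) [NontriviallyNormedField 𝕜] {𝕜' : Type*} [NontriviallyNormedField 𝕜']
  {E : Type*} [NormedAddCommGroup E] [NormedSpace 𝕜 E] [NormedSpace 𝕜' E]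
  {H : Type*} [TopologicalSpace H] {I' : ModelWithCorners 𝕜' E H} {I : ModelWithCorners 𝕜 E H}
  {M : Type*} [TopologicalSpace M] [ChartedSpace H M]

theorem extChartAt_congr_model (hI : I.toPartialEquiv = I'.toPartialEquiv) (x : M) :
    extChartAt I x = extChartAt I' x := by
  simp only [extChartAt, OpenPartialHomeomorph.extend, hI]

theorem range_congr_model (hI : I.toPartialEquiv = I'.toPartialEquiv) :
    Set.range I = Set.range I' :=
  congrArg (fun e : PartialEquiv H E => Set.range e) hI

variable [NormedAlgebra 𝕜 𝕜'] [IsScalarTower 𝕜 𝕜' E]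
  {F : Type*} [NormedAddCommGroup F] [NormedSpace 𝕜 F] [NormedSpace 𝕜' F] [IsScalarTower 𝕜 𝕜' F]
  {K : Type*} [TopologicalSpace K] {J' : ModelWithCorners 𝕜' F K} {J : ModelWithCorners 𝕜 F K}
  {N : Type*} [TopologicalSpace N] [ChartedSpace K N] {f : M → N} {s : Set M} {x : M}

theorem contMDiffWithinAt_restrictScalars {n : WithTop ℕ∞}
    (hf : ContMDiffWithinAt I' J' n f s x) (hI : I.toPartialEquiv = I'.toPartialEquiv)
    (hJ : J.toPartialEquiv = J'.toPartialEquiv) : ContMDiffWithinAt I J n f s x := by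
  rw [contMDiffWithinAt_iff] at hf ⊢
  rw [extChartAt_congr_model 𝕜 hI, extChartAt_congr_model 𝕜 hJ, range_congr_model 𝕜 hI]
  exact ⟨hf.1, hf.2.restrict_scalars 𝕜⟩

theorem contMDiff_restrictScalars {n : WithTop ℕ∞} (hf : ContMDiff I' J' n f)
    (hI : I.toPartialEquiv = I'.toPartialEquiv) (hJ : J.toPartialEquiv = J'.toPartialEquiv) :
    ContMDiff I J n f :=
  fun x => contMDiffWithinAt_restrictScalars 𝕜 (hf x) hI hJ

theorem hasMFDerivWithinAt_restrictScalars {f' : E →L[𝕜'] F}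
    (hf : HasMFDerivWithinAt I' J' f s x f') (hI : I.toPartialEquiv = I'.toPartialEquiv)
    (hJ : J.toPartialEquiv = J'.toPartialEquiv) :
    HasMFDerivWithinAt I J f s x (f'.restrictScalars 𝕜) := by
  refine ⟨hf.1, ?_⟩
  have h := HasFDerivWithinAt.restrictScalars 𝕜 hf.2
  rw [writtenInExtChartAt, extChartAt_congr_model 𝕜 hI, extChartAt_congr_model 𝕜 hJ,
    range_congr_model 𝕜 hI]
  exact h

theorem hasMFDerivAt_restrictScalars {f' : E →L[𝕜'] F} (hf : HasMFDerivAt I' J' f x f')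
    (hI : I.toPartialEquiv = I'.toPartialEquiv) (hJ : J.toPartialEquiv = J'.toPartialEquiv) :
    HasMFDerivAt I J f x (f'.restrictScalars 𝕜) :=
  hasMFDerivWithinAt_univ.1
    (hasMFDerivWithinAt_restrictScalars 𝕜 (hasMFDerivWithinAt_univ.2 hf) hI hJ)

end RestrictScalars

section CompositeCharts

variable {𝕜 : Type*} [NontriviallyNormedField 𝕜] {E : Type*} [NormedAddCommGroup E]
  [NormedSpace 𝕜 E] {H : Type*} [TopologicalSpace H] (I : ModelWithCorners 𝕜 E H)
  (n : WithTop ℕ∞) {N P : Type*} [TopologicalSpace N] [ChartedSpace H N] [IsManifold I n N]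

theorem contMDiffOn_chart_comp [TopologicalSpace P] [ChartedSpace N P]
    (hP : @IsManifold 𝕜 _ E _ _ H _ I n P _ (ChartedSpace.comp H N P))
    {e : OpenPartialHomeomorph P N} (he : e ∈ atlas N P) :
    letI := ChartedSpace.comp H N P
    ContMDiffOn I I n e e.source := by
  let _ := ChartedSpace.comp H N P
  intro x hx
  have hmem : e.trans (chartAt H (e x)) ∈ IsManifold.maximalAtlas I n P :=
    StructureGroupoid.subset_maximalAtlas _ ⟨e, he, _, chart_mem_atlas H (e x), rfl⟩
  have hx' : x ∈ (e.trans (chartAt H (e x))).source := by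
    rw [OpenPartialHomeomorph.trans_source]
    exact ⟨hx, mem_chart_source H (e x)⟩
  have hsymm : ContMDiffAt I I n (chartAt H (e x)).symm (e.trans (chartAt H (e x)) x) :=
    contMDiffAt_symm_of_mem_maximalAtlas (IsManifold.chart_mem_maximalAtlas (e x))
      (mem_chart_target H (e x))
  refine ((hsymm.comp x (contMDiffAt_of_mem_maximalAtlas hmem hx')).congr_of_eventuallyEq
    ?_).contMDiffWithinAt
  filter_upwards [(e.trans (chartAt H (e x))).open_source.mem_nhds hx'] with y hy
  rw [OpenPartialHomeomorph.trans_source] at hy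
  exact ((chartAt H (e x)).left_inv hy.2).symm

theorem contMDiffOn_chart_comp_symm [TopologicalSpace P] [ChartedSpace N P]
    (hP : @IsManifold 𝕜 _ E _ _ H _ I n P _ (ChartedSpace.comp H N P))
    {e : OpenPartialHomeomorph P N} (he : e ∈ atlas N P) :
    letI := ChartedSpace.comp H N P
    ContMDiffOn I I n e.symm e.target := by
  let _ := ChartedSpace.comp H N P
  intro y hy
  have hmem : e.trans (chartAt H y) ∈ IsManifold.maximalAtlas I n P :=
    StructureGroupoid.subset_maximalAtlas _ ⟨e, he, _, chart_mem_atlas H y, rfl⟩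
  have hchart : ContMDiffAt I I n (chartAt H y) y :=
    contMDiffAt_of_mem_maximalAtlas (IsManifold.chart_mem_maximalAtlas y) (mem_chart_source H y)
  have hy' : chartAt H y y ∈ (e.trans (chartAt H y)).target := by
    rw [OpenPartialHomeomorph.trans_target]
    refine ⟨mem_chart_target H y, ?_⟩
    rw [Set.mem_preimage, OpenPartialHomeomorph.left_inv _ (mem_chart_source H y)]
    exact hy
  refine (((contMDiffAt_symm_of_mem_maximalAtlas hmem hy').comp y hchart).congr_of_eventuallyEq
    ?_).contMDiffWithinAt
  filter_upwards [(chartAt H y).open_source.mem_nhds (mem_chart_source H y)] with z hz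
  exact congrArg e.symm ((chartAt H y).left_inv hz).symm

variable (c : ChartedSpaceCore N P)
  (hP : @IsManifold 𝕜 _ E _ _ H _ I n P c.toTopologicalSpace
    (@ChartedSpace.comp H _ N _ P c.toTopologicalSpace _ c.toChartedSpace))
  {e : PartialEquiv P N}

include hP

theorem contMDiffOn_core (he : e ∈ c.atlas) :
    letI := c.toTopologicalSpace
    letI := c.toChartedSpace
    letI := ChartedSpace.comp H N P
    ContMDiffOn I I n e e.source := by
  let _ := c.toTopologicalSpace
  let _ := c.toChartedSpace
  exact contMDiffOn_chart_comp I n hP (e := c.openPartialHomeomorph e he)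
    (Set.mem_iUnion₂.2 ⟨e, he, rfl⟩)

theorem contMDiffOn_core_symm (he : e ∈ c.atlas) :
    letI := c.toTopologicalSpace
    letI := c.toChartedSpace
    letI := ChartedSpace.comp H N P
    ContMDiffOn I I n e.symm e.target := by
  let _ := c.toTopologicalSpace
  let _ := c.toChartedSpace
  exact contMDiffOn_chart_comp_symm I n hP (e := c.openPartialHomeomorph e he)
    (Set.mem_iUnion₂.2 ⟨e, he, rfl⟩)

end CompositeCharts

section Manifolds

variable {𝕜 : Type*} [NontriviallyNormedField 𝕜]
  {E : Type*} [NormedAddCommGroup E] [NormedSpace 𝕜 E] {H : Type*} [TopologicalSpace H]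
  {I : ModelWithCorners 𝕜 E H} {M : Type*} [TopologicalSpace M] [ChartedSpace H M]
  {F : Type*} [NormedAddCommGroup F] [NormedSpace 𝕜 F] {K : Type*} [TopologicalSpace K]
  {J : ModelWithCorners 𝕜 F K} {N : Type*} [TopologicalSpace N] [ChartedSpace K N]

theorem hasMFDerivAt_of_eq {f : M → N} {x y : M} (hxy : x = y) {f' : E →L[𝕜] F}
    (hf : HasMFDerivAt I J f x f') : HasMFDerivAt I J f y f' := by
  subst hxy
  exact hf

theorem hasMFDerivAt_comp_apply_eq {F₂ : Type*} [NormedAddCommGroup F₂] [NormedSpace 𝕜 F₂]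
    {K₂ : Type*} [TopologicalSpace K₂] {J₂ : ModelWithCorners 𝕜 F₂ K₂}
    {N₂ : Type*} [TopologicalSpace N₂] [ChartedSpace K₂ N₂]
    {E' : Type*} [NormedAddCommGroup E'] [NormedSpace 𝕜 E'] {H' : Type*} [TopologicalSpace H']
    {I' : ModelWithCorners 𝕜 E' H'} {P : Type*} [TopologicalSpace P] [ChartedSpace H' P]
    {f : M → N} {g : N → P} {f₂ : M → N₂} {g₂ : N₂ → P} {x : M} {f' : E →L[𝕜] F}
    {g' : F →L[𝕜] E'} {f₂' : E →L[𝕜] F₂} {g₂' : F₂ →L[𝕜] E'} (h : ∀ y, g (f y) = g₂ (f₂ y))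
    (hg : HasMFDerivAt J I' g (f x) g') (hf : HasMFDerivAt I J f x f')
    (hg₂ : HasMFDerivAt J₂ I' g₂ (f₂ x) g₂') (hf₂ : HasMFDerivAt I J₂ f₂ x f₂') (v : E) :
    g' (f' v) = g₂' (f₂' v) := by
  have hcomp : g ∘ f = g₂ ∘ f₂ := funext h
  exact DFunLike.congr_fun (hasMFDerivAt_unique (hg.comp x hf) (hcomp ▸ hg₂.comp x hf₂)) v

/-- A derivative within a set that is not a neighbourhood is not unique, but its values on
velocities of curves in the set are. -/
theorem hasMFDerivWithinAt_apply_eq_of_curve {f : M → N} {s : Set M} {x : M} {f₁ f₂ : E →L[𝕜] F}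
    (h₁ : HasMFDerivWithinAt I J f s x f₁) (h₂ : HasMFDerivWithinAt I J f s x f₂) {c : 𝕜 → M}
    {v : E} (hc0 : c 0 = x) (hcs : ∀ᶠ τ in 𝓝 0, c τ ∈ s)
    (hc : HasMFDerivAt 𝓘(𝕜, 𝕜) I c 0 (ContinuousLinearMap.toSpanSingleton 𝕜 v)) :
    f₁ v = f₂ v := by
  subst hc0
  have hfc : ∀ {f'}, HasMFDerivWithinAt I J f s (c 0) f' →
      HasMFDerivAt 𝓘(𝕜, 𝕜) J (f ∘ c) 0 (f'.comp (ContinuousLinearMap.toSpanSingleton 𝕜 v)) :=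
    fun h => (h.comp (0 : 𝕜) hc.hasMFDerivWithinAt subset_rfl).hasMFDerivAt hcs
  have h : f₁ ((1 : 𝕜) • v) = f₂ ((1 : 𝕜) • v) :=
    DFunLike.congr_fun (hasMFDerivAt_unique (hfc h₁) (hfc h₂)) (1 : 𝕜)
  rwa [one_smul] at h

theorem hasMFDerivAt_extChartAt_symm_comp [I.Boundaryless] {x : M} {γ : 𝕜 → E} {γ' : 𝕜 →L[𝕜] E}
    (h0 : γ 0 = extChartAt I x x) (h : HasFDerivAt γ γ' 0) :
    HasMFDerivAt 𝓘(𝕜, 𝕜) I (fun τ => (extChartAt I x).symm (γ τ)) 0 γ' := by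
  have hx : (extChartAt I x).symm (γ 0) = x := by rw [h0, extChartAt_to_inv]
  refine ⟨ContinuousAt.comp (h0 ▸ continuousAt_extChartAt_symm x) h.continuousAt, ?_⟩
  simp only [writtenInExtChartAt, extChartAt_model_space_eq_id, hx]
  refine (h.congr_of_eventuallyEq ?_).hasFDerivWithinAt
  filter_upwards [h.continuousAt (h0 ▸ extChartAt_target_mem_nhds x)] with τ hτ
  exact (extChartAt I x).right_inv hτ

end Manifolds

section FiberProducts

theorem exists_curve_of_mem_ker {𝕜 : Type*} [NontriviallyNormedField 𝕜] [CompleteSpace 𝕜]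
    {E : Type*} [NormedAddCommGroup E] [NormedSpace 𝕜 E] [CompleteSpace E]
    {F : Type*} [NormedAddCommGroup F] [NormedSpace 𝕜 F] [FiniteDimensional 𝕜 F]
    {f : E → F} {f' : E →L[𝕜] F} {a v : E} (hf : HasStrictFDerivAt f f' a)
    (hf' : Function.Surjective f') (hv : f' v = 0) :
    ∃ γ : 𝕜 → E, γ 0 = a ∧ (∀ᶠ τ in 𝓝 0, f (γ τ) = f a) ∧
      HasFDerivAt γ (ContinuousLinearMap.toSpanSingleton 𝕜 v) 0 := by
  have hr : f'.range = ⊤ := LinearMap.range_eq_top.2 hf'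
  let k : f'.ker := ⟨v, hv⟩
  let ψ := hf.implicitFunction f f' hr (f a)
  have hline : HasFDerivAt (fun τ : 𝕜 => τ • k) (ContinuousLinearMap.toSpanSingleton 𝕜 k) 0 :=
    (ContinuousLinearMap.toSpanSingleton 𝕜 k).hasFDerivAt
  have hψ : HasFDerivAt ψ f'.ker.subtypeL ((0 : 𝕜) • k) := by
    rw [zero_smul]
    exact (hf.to_implicitFunction hr).hasFDerivAt
  refine ⟨fun τ => ψ (τ • k), ?_, ?_, (hψ.comp (0 : 𝕜) hline).congr_fderiv ?_⟩
  · simp only [zero_smul]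
    exact hf.implicitFunction_apply_image hr
  · have htendsto : Tendsto (fun τ : 𝕜 => (f a, τ • k)) (𝓝 0) (𝓝 (f a, 0)) := by
      have h := hline.continuousAt.tendsto
      rw [zero_smul] at h
      exact tendsto_const_nhds.prodMk_nhds h
    exact htendsto.eventually (hf.map_implicitFunction_eq hr)
  · ext
    simp [k]

variable {𝕜 : Type*} [RCLike 𝕜] {E₁ E₂ E₃ : Type*}
  [NormedAddCommGroup E₁] [NormedSpace 𝕜 E₁] [NormedAddCommGroup E₂] [NormedSpace 𝕜 E₂]
  [NormedAddCommGroup E₃] [NormedSpace 𝕜 E₃]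
  {H₁ H₂ H₃ : Type*} [TopologicalSpace H₁] [TopologicalSpace H₂] [TopologicalSpace H₃]
  {I₁ : ModelWithCorners 𝕜 E₁ H₁} {I₂ : ModelWithCorners 𝕜 E₂ H₂} {I₃ : ModelWithCorners 𝕜 E₃ H₃}
  {M₁ M₂ M₃ : Type*} [TopologicalSpace M₁] [ChartedSpace H₁ M₁]
  [TopologicalSpace M₂] [ChartedSpace H₂ M₂] [TopologicalSpace M₃] [ChartedSpace H₃ M₃]
  [I₁.Boundaryless]

theorem hasStrictFDerivAt_writtenInExtChartAt {f : M₁ → M₃} {x : M₁}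
    (hf : ContMDiffAt I₁ I₃ 1 f x) :
    HasStrictFDerivAt (writtenInExtChartAt I₁ I₃ x f) (mfderiv I₁ I₃ f x : E₁ →L[𝕜] E₃)
      (extChartAt I₁ x x) := by
  have h := (contMDiffAt_iff.1 hf).2
  rw [I₁.range_eq_univ, contDiffWithinAt_univ] at h
  rw [(hf.mdifferentiableAt one_ne_zero).mfderiv, I₁.range_eq_univ, fderivWithin_univ]
  exact h.hasStrictFDerivAt one_ne_zero

variable [CompleteSpace E₁] [CompleteSpace E₂] [FiniteDimensional 𝕜 E₃]

theorem exists_chart_curve_fiberProduct [I₂.Boundaryless] {f : M₁ → M₃} {g : M₂ → M₃} {x : M₁}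
    {y : M₂} (hf : ContMDiffAt I₁ I₃ 1 f x) (hg : ContMDiffAt I₂ I₃ 1 g y) (hxy : f x = g y)
    (hs : Function.Surjective (mfderiv I₂ I₃ g y)) {V : E₁} {W : E₂}
    (hVW : (mfderiv I₁ I₃ f x V : E₃) = (mfderiv I₂ I₃ g y W : E₃)) :
    ∃ γ : 𝕜 → E₁ × E₂, γ 0 = (extChartAt I₁ x x, extChartAt I₂ y y) ∧
      (∀ᶠ τ in 𝓝 0, writtenInExtChartAt I₁ I₃ x f (γ τ).1 =
        writtenInExtChartAt I₂ I₃ y g (γ τ).2) ∧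
      HasFDerivAt γ (ContinuousLinearMap.toSpanSingleton 𝕜 (V, W)) 0 := by
  let a : E₁ × E₂ := (extChartAt I₁ x x, extChartAt I₂ y y)
  let f' : E₁ →L[𝕜] E₃ := mfderiv I₁ I₃ f x
  let g' : E₂ →L[𝕜] E₃ := mfderiv I₂ I₃ g y
  have hD : HasStrictFDerivAt
      (fun b : E₁ × E₂ => writtenInExtChartAt I₁ I₃ x f b.1 - writtenInExtChartAt I₂ I₃ y g b.2)
      (f' ∘L .fst 𝕜 E₁ E₂ - g' ∘L .snd 𝕜 E₁ E₂) a :=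
    ((hasStrictFDerivAt_writtenInExtChartAt hf).comp a hasStrictFDerivAt_fst).sub
      ((hasStrictFDerivAt_writtenInExtChartAt hg).comp a hasStrictFDerivAt_snd)
  have hsurj : Function.Surjective (f' ∘L .fst 𝕜 E₁ E₂ - g' ∘L .snd 𝕜 E₁ E₂) := by
    intro w
    obtain ⟨b, hb⟩ : ∃ b, g' b = -w := hs (-w : E₃)
    exact ⟨(0, b), by simp [hb]⟩
  obtain ⟨γ, hγ0, hγ, hγ'⟩ := exists_curve_of_mem_ker (v := (V, W)) hD hsurj (sub_eq_zero.2 hVW)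
  refine ⟨γ, hγ0, hγ.mono fun τ hτ => sub_eq_zero.1 (hτ.trans ?_), hγ'⟩
  simp [a, writtenInExtChartAt, hxy]

theorem exists_curve_fiberProduct [I₂.Boundaryless] {f : M₁ → M₃} {g : M₂ → M₃} {x : M₁} {y : M₂}
    (hf : ContMDiffAt I₁ I₃ 1 f x) (hg : ContMDiffAt I₂ I₃ 1 g y) (hxy : f x = g y)
    (hs : Function.Surjective (mfderiv I₂ I₃ g y)) {V : E₁} {W : E₂}
    (hVW : (mfderiv I₁ I₃ f x V : E₃) = (mfderiv I₂ I₃ g y W : E₃)) :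
    ∃ c : 𝕜 → M₁ × M₂, c 0 = (x, y) ∧ (∀ᶠ τ in 𝓝 0, f (c τ).1 = g (c τ).2) ∧
      HasMFDerivAt 𝓘(𝕜, 𝕜) (I₁.prod I₂) c 0
        (ContinuousLinearMap.toSpanSingleton 𝕜 ((V, W) : E₁ × E₂)) := by
  obtain ⟨γ, hγ0, hγ, hγ'⟩ := exists_chart_curve_fiberProduct hf hg hxy hs hVW
  have h₁ : HasMFDerivAt 𝓘(𝕜, 𝕜) I₁ (fun τ => (extChartAt I₁ x).symm (γ τ).1) 0
      (ContinuousLinearMap.toSpanSingleton 𝕜 V) :=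
    hasMFDerivAt_extChartAt_symm_comp (congrArg Prod.fst hγ0)
      (hγ'.fst.congr_fderiv (ContinuousLinearMap.ext fun _ => rfl))
  have h₂ : HasMFDerivAt 𝓘(𝕜, 𝕜) I₂ (fun τ => (extChartAt I₂ y).symm (γ τ).2) 0
      (ContinuousLinearMap.toSpanSingleton 𝕜 W) :=
    hasMFDerivAt_extChartAt_symm_comp (congrArg Prod.snd hγ0)
      (hγ'.snd.congr_fderiv (ContinuousLinearMap.ext fun _ => rfl))
  have e₁ : (extChartAt I₁ x).symm (γ 0).1 = x := by rw [hγ0]; exact extChartAt_to_inv x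
  have e₂ : (extChartAt I₂ y).symm (γ 0).2 = y := by rw [hγ0]; exact extChartAt_to_inv y
  refine ⟨fun τ => ((extChartAt I₁ x).symm (γ τ).1, (extChartAt I₂ y).symm (γ τ).2),
    Prod.ext e₁ e₂, ?_, (h₁.prodMk h₂).congr_mfderiv (ContinuousLinearMap.ext fun _ => rfl)⟩
  have hf₁ : ∀ᶠ τ in 𝓝 0, f ((extChartAt I₁ x).symm (γ τ).1) ∈ (extChartAt I₃ (f x)).source :=
    (hf.continuousAt.comp_of_eq h₁.1 e₁).eventually_mem (by
      simpa only [Function.comp_apply, e₁] using extChartAt_source_mem_nhds (I := I₃) (f x))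
  have hg₂ : ∀ᶠ τ in 𝓝 0, g ((extChartAt I₂ y).symm (γ τ).2) ∈ (extChartAt I₃ (f x)).source :=
    (hg.continuousAt.comp_of_eq h₂.1 e₂).eventually_mem (by
      simpa only [Function.comp_apply, e₂, hxy] using extChartAt_source_mem_nhds (I := I₃) (g y))
  filter_upwards [hγ, hf₁, hg₂] with τ hτ hτ₁ hτ₂
  refine (extChartAt I₃ (f x)).injOn hτ₁ hτ₂ (hτ.trans ?_)
  rw [hxy]
  rfl

end FiberProducts

theorem GroupoidStr.inv_inv {G M : Type*} (Γ : GroupoidStr G M) (g : G) :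
    Γ.inv (Γ.inv g) = g := by
  have hinv := Γ.unit_mul (Γ.inv (Γ.inv g))
  have hassoc := Γ.mul_assoc g (Γ.inv g) (Γ.inv (Γ.inv g)) (Γ.tgt_inv g).symm (Γ.tgt_inv _).symm
  rw [Γ.mul_inv, Γ.mul_inv, Γ.tgt_inv, Γ.mul_unit] at hassoc
  rw [Γ.tgt_inv, Γ.src_inv] at hinv
  exact hinv.symm.trans hassoc

namespace LieGroupoid

section Derivatives

variable {𝕜 : Type*} [NontriviallyNormedField 𝕜]
  {E : Type*} [NormedAddCommGroup E] [NormedSpace 𝕜 E] {K : Type*} [TopologicalSpace K]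
  {I : ModelWithCorners 𝕜 E K}
  {F : Type*} [NormedAddCommGroup F] [NormedSpace 𝕜 F] {K' : Type*} [TopologicalSpace K']
  {J : ModelWithCorners 𝕜 F K'} {n : WithTop ℕ∞}
  {G : Type*} [TopologicalSpace G] [ChartedSpace K G]
  {M : Type*} [TopologicalSpace M] [ChartedSpace K' M] (Γ : LieGroupoid I J n G M)

include Γ

section

variable (hn : n ≠ 0)

include hn

theorem hasMFDerivAt_src (g : G) : HasMFDerivAt I J Γ.src g (mfderiv I J Γ.src g) :=
  (Γ.contMDiff_src.mdifferentiable hn g).hasMFDerivAt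

theorem hasMFDerivAt_tgt (g : G) : HasMFDerivAt I J Γ.tgt g (mfderiv I J Γ.tgt g) :=
  (Γ.contMDiff_tgt.mdifferentiable hn g).hasMFDerivAt

theorem hasMFDerivAt_unit (x : M) : HasMFDerivAt J I Γ.unit x (mfderiv J I Γ.unit x) :=
  (Γ.contMDiff_unit.mdifferentiable hn x).hasMFDerivAt

theorem hasMFDerivAt_inv (g : G) : HasMFDerivAt I I Γ.inv g (mfderiv I I Γ.inv g) :=
  (Γ.contMDiff_inv.mdifferentiable hn g).hasMFDerivAt

theorem hasMFDerivWithinAt_mul {g h : G} (hgh : Γ.src g = Γ.tgt h) :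
    HasMFDerivWithinAt (I.prod I) I (fun p : G × G => Γ.mul p.1 p.2) Γ.composable (g, h)
      (mfderivWithin (I.prod I) I (fun p : G × G => Γ.mul p.1 p.2) Γ.composable (g, h)) :=
  ((Γ.contMDiffOn_mul (g, h) hgh).mdifferentiableWithinAt hn).hasMFDerivWithinAt

theorem mfderiv_tgt_inv (g : G) (v : E) :
    (mfderiv I J Γ.tgt (Γ.inv g) (mfderiv I I Γ.inv g v : E) : F) = mfderiv I J Γ.src g v :=
  hasMFDerivAt_comp_apply_eq (g₂ := id) Γ.tgt_inv (Γ.hasMFDerivAt_tgt hn _)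
    (Γ.hasMFDerivAt_inv hn g) (hasMFDerivAt_id (Γ.src g)) (Γ.hasMFDerivAt_src hn g) v

theorem mfderiv_src_inv (g : G) (v : E) :
    (mfderiv I J Γ.src (Γ.inv g) (mfderiv I I Γ.inv g v : E) : F) = mfderiv I J Γ.tgt g v :=
  hasMFDerivAt_comp_apply_eq (g₂ := id) Γ.src_inv (Γ.hasMFDerivAt_src hn _)
    (Γ.hasMFDerivAt_inv hn g) (hasMFDerivAt_id (Γ.tgt g)) (Γ.hasMFDerivAt_tgt hn g) v

theorem mfderiv_inv_inv (g : G) (v : E) :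
    (mfderiv I I Γ.inv (Γ.inv g) (mfderiv I I Γ.inv g v : E) : E) = v :=
  hasMFDerivAt_comp_apply_eq Γ.inv_inv (Γ.hasMFDerivAt_inv hn _) (Γ.hasMFDerivAt_inv hn g)
    (hasMFDerivAt_id _) (hasMFDerivAt_id g) v

theorem mfderiv_inv_surjective (g : G) : Function.Surjective (mfderiv I I Γ.inv g) := by
  obtain ⟨h, rfl⟩ : ∃ h, Γ.inv h = g := ⟨Γ.inv g, Γ.inv_inv g⟩
  exact fun v => ⟨mfderiv I I Γ.inv h v, Γ.mfderiv_inv_inv hn h v⟩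

theorem tangentMul_inv (g : G) (v : E) :
    ((Γ.tangentMul I ⟨g, v⟩ ⟨Γ.inv g, mfderiv I I Γ.inv g v⟩).snd : E) =
      mfderiv J I Γ.unit (Γ.tgt g) (mfderiv I J Γ.tgt g v) := by
  have hmaps : Set.univ ⊆ (fun h => (id h, Γ.inv h)) ⁻¹' Γ.composable :=
    fun h _ => (Γ.tgt_inv h).symm
  have hmul := ((Γ.hasMFDerivWithinAt_mul hn (Γ.tgt_inv g).symm).comp g
    ((hasMFDerivAt_id g).prodMk (Γ.hasMFDerivAt_inv hn g)).hasMFDerivWithinAt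
      hmaps).hasMFDerivAt univ_mem
  have hcomp : (fun p : G × G => Γ.mul p.1 p.2) ∘ (fun h => (id h, Γ.inv h)) = Γ.unit ∘ Γ.tgt :=
    funext Γ.mul_inv
  rw [hcomp] at hmul
  exact DFunLike.congr_fun (hasMFDerivAt_unique hmul
    ((Γ.hasMFDerivAt_unit hn (Γ.tgt g)).comp g (Γ.hasMFDerivAt_tgt hn g))) v

end

end Derivatives

section TangentGroupoid

variable {𝕜 : Type*} [RCLike 𝕜]
  {E : Type*} [NormedAddCommGroup E] [NormedSpace 𝕜 E] [CompleteSpace E]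
  {K : Type*} [TopologicalSpace K] {I : ModelWithCorners 𝕜 E K} [I.Boundaryless]
  {F : Type*} [NormedAddCommGroup F] [NormedSpace 𝕜 F] [FiniteDimensional 𝕜 F]
  {K' : Type*} [TopologicalSpace K'] {J : ModelWithCorners 𝕜 F K'} {n : WithTop ℕ∞}
  {G : Type*} [TopologicalSpace G] [ChartedSpace K G]
  {M : Type*} [TopologicalSpace M] [ChartedSpace K' M]
  {E' : Type*} [NormedAddCommGroup E'] [NormedSpace 𝕜 E'] {H' : Type*} [TopologicalSpace H']
  {I' : ModelWithCorners 𝕜 E' H'} {G' M' : Type*} [TopologicalSpace G'] [ChartedSpace H' G']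

/-- The derivative of the multiplication of `Γ'` is arbitrary, since a derivative within the
composable pairs is not unique. -/
theorem map_tangentMul (Γ : LieGroupoid I J n G M) (hn : n ≠ 0) (Γ' : GroupoidStr G' M')
    {φ : G → G'} (hφ : MDifferentiable I I' φ)
    (hcomp : ∀ g h, Γ.src g = Γ.tgt h → Γ'.src (φ g) = Γ'.tgt (φ h))
    (hmul : ∀ g h, Γ.src g = Γ.tgt h → φ (Γ.mul g h) = Γ'.mul (φ g) (φ h))
    {g h : G} (hgh : Γ.src g = Γ.tgt h) {V W : E}
    (hVW : (mfderiv I J Γ.src g V : F) = mfderiv I J Γ.tgt h W) {m' : E' × E' →L[𝕜] E'}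
    (hm' : HasMFDerivWithinAt (I'.prod I') I' (fun p : G' × G' => Γ'.mul p.1 p.2) Γ'.composable
      (φ g, φ h) m') :
    mfderiv I I' φ (Γ.mul g h) (Γ.tangentMul I ⟨g, V⟩ ⟨h, W⟩).snd =
      m' (mfderiv I I' φ g V, mfderiv I I' φ h W) := by
  have hn' : 1 ≤ n := ENat.one_le_iff_ne_zero_withTop.2 hn
  obtain ⟨c, hc0, hcs, hc⟩ := exists_curve_fiberProduct ((Γ.contMDiff_src g).of_le hn')
    ((Γ.contMDiff_tgt h).of_le hn') hgh (Γ.submersion_tgt h) hVW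
  have hφmul := (hφ (Γ.mul g h)).hasMFDerivAt.comp_hasMFDerivWithinAt (g, h)
    (Γ.hasMFDerivWithinAt_mul hn hgh)
  have hmaps : Γ.composable ⊆ (fun p : G × G => (φ p.1, φ p.2)) ⁻¹' Γ'.composable :=
    fun p hp => hcomp p.1 p.2 hp
  have hmulφ := hm'.comp (g, h) ((((hφ g).hasMFDerivAt.comp (g, h) (hasMFDerivAt_fst (g, h))).prodMk
    ((hφ h).hasMFDerivAt.comp (g, h) (hasMFDerivAt_snd (g, h)))).hasMFDerivWithinAt) hmaps
  exact hasMFDerivWithinAt_apply_eq_of_curve hφmul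
    (hmulφ.congr_mono (fun p hp => hmul p.1 p.2 hp) (hmul g h hgh) subset_rfl) hc0 hcs hc

end TangentGroupoid

end LieGroupoid

section ProjectiveBundle

theorem contDiff_one_add_mul_I_mul {n : WithTop ℕ∞} (c : ℂ) :
    ContDiff ℝ n (fun t : ℝ => (1 + t * Complex.I) * c) :=
  (contDiff_const.add (Complex.ofRealCLM.contDiff.mul contDiff_const)).mul contDiff_const

theorem isOpen_re_div_ne_zero (c : ℂ) : IsOpen {w : ℂ | (w / c).re ≠ 0} :=
  isOpen_ne.preimage (Complex.continuous_re.comp (continuous_id.div_const c))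

theorem contDiffOn_slope {n : WithTop ℕ∞} (c : ℂ) :
    ContDiffOn ℝ n (slope c) {w | (w / c).re ≠ 0} := by
  have hdiv : ContDiff ℝ n (fun w : ℂ => w / c) := by
    simp only [div_eq_mul_inv]
    exact contDiff_id.mul contDiff_const
  exact (Complex.imCLM.contDiff.comp hdiv).contDiffOn.div
    (Complex.reCLM.contDiff.comp hdiv).contDiffOn (fun _ hw => hw)

variable {EX : Type*} [NormedAddCommGroup EX] [NormedSpace ℂ EX]
  {X : Type*} [TopologicalSpace X] [ChartedSpace EX X]
  {L : X → Type*} [∀ x, AddCommGroup (L x)] [∀ x, Module ℂ (L x)] [∀ x, TopologicalSpace (L x)]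
  {E : Type*} [NormedAddCommGroup E] [NormedSpace ℂ E]
  {B : Type*} [TopologicalSpace B] [ChartedSpace E B]
  {f : ContMDiffMap 𝓘(ℂ, E) 𝓘(ℂ, EX) B X ω}

theorem Slit.toRProj_surjective : Function.Surjective (Slit.toRProj : Slit L f → RProj L f) :=
  fun z => ⟨⟨z.base, z.line.rep, z.line.rep_nonzero⟩, by
    simp only [Slit.toRProj, Projectivization.mk_rep]⟩

variable [TopologicalSpace (TotalSpace ℂ L)] [FiberBundle ℂ L] [VectorBundle ℂ ℂ L]

theorem Slit.mem_slitTriv_source (p : Slit L f) :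
    p ∈ (slitTriv (L := L) (f := f) (f p.base)).source :=
  FiberBundle.mem_baseSet_trivializationAt' _

theorem Slit.toRProj_mem_source_iff (x₀ : X) (c : ℂ) (p : Slit L f) :
    p.toRProj ∈ (rprojTriv (L := L) (f := f) x₀ c).source ↔
      p ∈ (slitTriv (L := L) (f := f) x₀).source ∧
        (((slitTriv (L := L) (f := f) x₀) p).2 / c).re ≠ 0 := by
  obtain ⟨r, hr, h⟩ := lineCoord_rep_mk x₀ (f p.base) p.ne_zero
  refine and_congr Iff.rfl ?_
  change (lineCoord L x₀ (f p.base) (Projectivization.mk ℝ p.covec p.ne_zero).rep / c).re ≠ 0 ↔ _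
  rw [h, mul_div_assoc, Complex.re_ofReal_mul, mul_ne_zero_iff]
  exact and_iff_right hr

theorem Slit.rprojTriv_toRProj (x₀ : X) (c : ℂ) (p : Slit L f) :
    rprojTriv x₀ c p.toRProj = ((slitTriv x₀ p).1, slope c (slitTriv x₀ p).2) := by
  obtain ⟨r, hr, h⟩ := lineCoord_rep_mk x₀ (f p.base) p.ne_zero
  exact Prod.ext rfl ((congrArg (slope c) h).trans (slope_real_smul _ _ hr))

/-- The section of `(f^*L)^* ∖ 0 → ℝℙ((f^*L)^*)` over the source of `rprojTriv x₀ c`, with image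
the affine real line `(1 + iℝ) c` in every fibre. -/
def RProj.toSlit (x₀ : X) (c : ℂ) (z : RProj L f) : Slit L f :=
  (slitTriv x₀).symm
    ((rprojTriv x₀ c z).1, (1 + ((rprojTriv x₀ c z).2 : ℂ) * Complex.I) * c)

theorem RProj.mem_slitTriv_target {x₀ : X} {c : ℂ} {z : RProj L f}
    (hz : z ∈ (rprojTriv (L := L) (f := f) x₀ c).source) :
    ((rprojTriv x₀ c z).1, (1 + ((rprojTriv x₀ c z).2 : ℂ) * Complex.I) * c) ∈
      (slitTriv (L := L) (f := f) x₀).target :=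
  have h := (rprojTriv x₀ c).map_source hz
  ⟨h.1, mul_ne_zero (one_add_mul_I_ne_zero _) h.2⟩

theorem RProj.toRProj_toSlit {x₀ : X} {c : ℂ} {z : RProj L f}
    (hz : z ∈ (rprojTriv (L := L) (f := f) x₀ c).source) : (z.toSlit x₀ c).toRProj = z := by
  have hc : c ≠ 0 := ((rprojTriv x₀ c).map_source hz).2
  have htarget := RProj.mem_slitTriv_target hz
  have htriv : slitTriv x₀ (z.toSlit x₀ c) = _ := (slitTriv x₀).right_inv htarget
  refine (rprojTriv x₀ c).injOn ?_ hz ?_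
  · rw [Slit.toRProj_mem_source_iff, htriv, mul_div_cancel_right₀ _ hc]
    refine ⟨(slitTriv x₀).map_target htarget, ?_⟩
    simp
  · rw [Slit.rprojTriv_toRProj, htriv, slope_line hc]

theorem Slit.toSlit_toRProj {x₀ : X} {p : Slit L f}
    (hp : p ∈ (slitTriv (L := L) (f := f) x₀).source) :
    p.toRProj.toSlit x₀ (slitTriv x₀ p).2 = p := by
  have hslope : slope (slitTriv x₀ p).2 (slitTriv x₀ p).2 = 0 := by
    simp [slope, div_self ((slitTriv x₀).map_source hp).2]
  rw [RProj.toSlit, Slit.rprojTriv_toRProj, hslope, Complex.ofReal_zero, zero_mul, add_zero,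
    one_mul]
  exact (slitTriv x₀).left_inv hp

variable [ContMDiffVectorBundle ω ℂ L 𝓘(ℂ, EX)]

theorem isOpen_slitTriv_source (x₀ : X) : IsOpen (slitTriv (L := L) (f := f) x₀).source :=
  (slitCore L f).open_source' ⟨x₀, rfl⟩

theorem isOpen_slitTriv_target (x₀ : X) : IsOpen (slitTriv (L := L) (f := f) x₀).target :=
  (slitCore L f).open_target ⟨x₀, rfl⟩

theorem isOpen_rprojTriv_source (x₀ : X) (c : ℂ) :
    IsOpen (rprojTriv (L := L) (f := f) x₀ c).source :=
  (rprojCore L f).open_source' ⟨(x₀, c), rfl⟩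

theorem isOpen_rprojTriv_target (x₀ : X) (c : ℂ) :
    IsOpen (rprojTriv (L := L) (f := f) x₀ c).target :=
  (rprojCore L f).open_target ⟨(x₀, c), rfl⟩

theorem RProj.exists_mem_source (z : RProj L f) :
    ∃ c, z ∈ (rprojTriv (L := L) (f := f) (f z.base) c).source :=
  ⟨_, (rprojCore L f).mem_chart_source z⟩

variable [IsManifold 𝓘(ℂ, E) ω B]

theorem contMDiffOn_slitTriv (x₀ : X) :
    ContMDiffOn (𝓘(ℂ, E).prod 𝓘(ℂ, ℂ)) (𝓘(ℂ, E).prod 𝓘(ℂ, ℂ)) ω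
      (slitTriv (L := L) (f := f) x₀) (slitTriv (L := L) (f := f) x₀).source :=
  contMDiffOn_core _ _ (slitCore L f) inferInstance ⟨x₀, rfl⟩

theorem contMDiffOn_slitTriv_symm (x₀ : X) :
    ContMDiffOn (𝓘(ℂ, E).prod 𝓘(ℂ, ℂ)) (𝓘(ℂ, E).prod 𝓘(ℂ, ℂ)) ω
      (slitTriv (L := L) (f := f) x₀).symm (slitTriv (L := L) (f := f) x₀).target :=
  contMDiffOn_core_symm _ _ (slitCore L f) inferInstance ⟨x₀, rfl⟩

theorem contMDiffOn_real_slitTriv (x₀ : X) :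
    ContMDiffOn (𝓘(ℝ, E).prod 𝓘(ℝ, ℂ)) (𝓘(ℝ, E).prod 𝓘(ℝ, ℂ)) ∞
      (slitTriv (L := L) (f := f) x₀) (slitTriv (L := L) (f := f) x₀).source :=
  fun p hp =>
    (contMDiffWithinAt_restrictScalars ℝ (contMDiffOn_slitTriv x₀ p hp) rfl rfl).of_le le_top

theorem contMDiffOn_real_slitTriv_symm (x₀ : X) :
    ContMDiffOn (𝓘(ℝ, E).prod 𝓘(ℝ, ℂ)) (𝓘(ℝ, E).prod 𝓘(ℝ, ℂ)) ∞
      (slitTriv (L := L) (f := f) x₀).symm (slitTriv (L := L) (f := f) x₀).target :=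
  fun q hq =>
    (contMDiffWithinAt_restrictScalars ℝ (contMDiffOn_slitTriv_symm x₀ q hq) rfl rfl).of_le le_top

theorem contMDiffOn_rprojTriv (x₀ : X) (c : ℂ) :
    ContMDiffOn (𝓘(ℝ, E).prod 𝓘(ℝ, ℝ)) (𝓘(ℝ, E).prod 𝓘(ℝ, ℝ)) ∞
      (rprojTriv (L := L) (f := f) x₀ c) (rprojTriv (L := L) (f := f) x₀ c).source :=
  have := isManifold_real E B
  contMDiffOn_core _ _ (rprojCore L f) inferInstance ⟨(x₀, c), rfl⟩

theorem contMDiffOn_rprojTriv_symm (x₀ : X) (c : ℂ) :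
    ContMDiffOn (𝓘(ℝ, E).prod 𝓘(ℝ, ℝ)) (𝓘(ℝ, E).prod 𝓘(ℝ, ℝ)) ∞
      (rprojTriv (L := L) (f := f) x₀ c).symm (rprojTriv (L := L) (f := f) x₀ c).target :=
  have := isManifold_real E B
  contMDiffOn_core_symm _ _ (rprojCore L f) inferInstance ⟨(x₀, c), rfl⟩

theorem Slit.contMDiff_base :
    ContMDiff (𝓘(ℂ, E).prod 𝓘(ℂ, ℂ)) 𝓘(ℂ, E) ω (Slit.base : Slit L f → B) := fun p =>
  contMDiff_fst.contMDiffAt.comp p ((contMDiffOn_slitTriv (f p.base)).contMDiffAt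
    ((isOpen_slitTriv_source _).mem_nhds p.mem_slitTriv_source))

theorem RProj.contMDiff_base :
    ContMDiff (𝓘(ℝ, E).prod 𝓘(ℝ, ℝ)) 𝓘(ℝ, E) ∞ (RProj.base : RProj L f → B) := by
  intro z
  obtain ⟨c, hz⟩ := z.exists_mem_source
  exact contMDiff_fst.contMDiffAt.comp z
    ((contMDiffOn_rprojTriv (f z.base) c).contMDiffAt ((isOpen_rprojTriv_source _ _).mem_nhds hz))

section Maps

variable {F : Type*} [NormedAddCommGroup F] [NormedSpace ℝ F] {K : Type*} [TopologicalSpace K]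
  {J : ModelWithCorners ℝ F K} {N : Type*} [TopologicalSpace N] [ChartedSpace K N]

theorem RProj.contMDiffWithinAt_of_rprojTriv {Φ : N → RProj L f} {s : Set N} {x : N} (x₀ : X)
    (c : ℂ) (hx : Φ x ∈ (rprojTriv (L := L) (f := f) x₀ c).source)
    (hs : ∀ᶠ y in 𝓝[s] x, Φ y ∈ (rprojTriv (L := L) (f := f) x₀ c).source)
    (h : ContMDiffWithinAt J (𝓘(ℝ, E).prod 𝓘(ℝ, ℝ)) ∞ (fun y => rprojTriv x₀ c (Φ y)) s x) :
    ContMDiffWithinAt J (𝓘(ℝ, E).prod 𝓘(ℝ, ℝ)) ∞ Φ s x := by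
  have hsymm := (contMDiffOn_rprojTriv_symm (L := L) (f := f) x₀ c).contMDiffAt
    ((isOpen_rprojTriv_target _ _).mem_nhds (PartialEquiv.map_source _ hx))
  refine (hsymm.comp_contMDiffWithinAt x h).congr_of_eventuallyEq ?_ ?_
  · filter_upwards [hs] with y hy using ((rprojTriv x₀ c).left_inv hy).symm
  · exact ((rprojTriv x₀ c).left_inv hx).symm

theorem Slit.contMDiffAt_of_slitTriv {Φ : N → Slit L f} {x : N} (x₀ : X)
    (hx : ∀ᶠ y in 𝓝 x, Φ y ∈ (slitTriv (L := L) (f := f) x₀).source)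
    (h : ContMDiffAt J (𝓘(ℝ, E).prod 𝓘(ℝ, ℂ)) ∞ (fun y => slitTriv x₀ (Φ y)) x) :
    ContMDiffAt J (𝓘(ℝ, E).prod 𝓘(ℝ, ℂ)) ∞ Φ x := by
  have hsymm := (contMDiffOn_real_slitTriv_symm (L := L) (f := f) x₀).contMDiffAt
    ((isOpen_slitTriv_target _).mem_nhds (PartialEquiv.map_source _ hx.self_of_nhds))
  refine (hsymm.comp x h).congr_of_eventuallyEq ?_
  filter_upwards [hx] with y hy using ((slitTriv x₀).left_inv hy).symm

theorem Slit.contMDiff_toRProj :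
    ContMDiff (𝓘(ℝ, E).prod 𝓘(ℝ, ℂ)) (𝓘(ℝ, E).prod 𝓘(ℝ, ℝ)) ∞
      (Slit.toRProj : Slit L f → RProj L f) := by
  intro p
  obtain ⟨c, hc⟩ := p.toRProj.exists_mem_source
  have hp := (p.toRProj_mem_source_iff _ c).1 hc
  have htriv := (contMDiffOn_real_slitTriv (L := L) (f := f) (f p.base)).contMDiffAt
    ((isOpen_slitTriv_source _).mem_nhds hp.1)
  have hcoord := contMDiff_snd.contMDiffAt.comp p htriv
  have hslope := ((contDiffOn_slope (n := ∞) c).contDiffAt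
    ((isOpen_re_div_ne_zero c).mem_nhds hp.2)).contMDiffAt
  refine RProj.contMDiffWithinAt_of_rprojTriv (f p.base) c hc ?_ ?_
  · rw [nhdsWithin_univ]
    filter_upwards [(isOpen_slitTriv_source _).mem_nhds hp.1,
      hcoord.continuousAt.preimage_mem_nhds ((isOpen_re_div_ne_zero c).mem_nhds hp.2)] with q hq hq'
    exact (q.toRProj_mem_source_iff _ c).2 ⟨hq, hq'⟩
  · simp only [Slit.rprojTriv_toRProj]
    exact (contMDiff_fst.contMDiffAt.comp p htriv).prodMk (hslope.comp p hcoord)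

theorem RProj.contMDiffOn_toSlit (x₀ : X) (c : ℂ) :
    ContMDiffOn (𝓘(ℝ, E).prod 𝓘(ℝ, ℝ)) (𝓘(ℝ, E).prod 𝓘(ℝ, ℂ)) ∞
      (RProj.toSlit (L := L) (f := f) x₀ c) (rprojTriv (L := L) (f := f) x₀ c).source := by
  have htriv := contMDiffOn_rprojTriv (L := L) (f := f) x₀ c
  exact (contMDiffOn_real_slitTriv_symm x₀).comp
    ((contMDiff_fst.comp_contMDiffOn htriv).prodMk
      ((contDiff_one_add_mul_I_mul c).contMDiff.comp_contMDiffOn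
        (contMDiff_snd.comp_contMDiffOn htriv)))
    (fun _ hz => RProj.mem_slitTriv_target hz)

theorem Slit.exists_section_toRProj (p : Slit L f) : ∃ σ : RProj L f → Slit L f,
    ContMDiffAt (𝓘(ℝ, E).prod 𝓘(ℝ, ℝ)) (𝓘(ℝ, E).prod 𝓘(ℝ, ℂ)) ∞ σ p.toRProj ∧
      σ p.toRProj = p ∧ ∀ᶠ z in 𝓝 p.toRProj, (σ z).toRProj = z := by
  set c := (slitTriv (L := L) (f := f) (f p.base) p).2
  have hc : c ≠ 0 := ((slitTriv (f p.base)).map_source p.mem_slitTriv_source).2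
  have hsource : (rprojTriv (L := L) (f := f) (f p.base) c).source ∈ 𝓝 p.toRProj :=
    (isOpen_rprojTriv_source _ _).mem_nhds ((p.toRProj_mem_source_iff _ c).2
      ⟨p.mem_slitTriv_source, by simp [c, div_self hc]⟩)
  refine ⟨RProj.toSlit (f p.base) c, (RProj.contMDiffOn_toSlit _ c).contMDiffAt hsource,
    Slit.toSlit_toRProj p.mem_slitTriv_source, ?_⟩
  filter_upwards [hsource] with z hz using RProj.toRProj_toSlit hz

theorem contMDiffAt_of_comp_toRProj {Φ : RProj L f → N} {p : Slit L f}
    (h : ContMDiffAt (𝓘(ℝ, E).prod 𝓘(ℝ, ℂ)) J ∞ (fun q : Slit L f => Φ q.toRProj) p) :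
    ContMDiffAt (𝓘(ℝ, E).prod 𝓘(ℝ, ℝ)) J ∞ Φ p.toRProj := by
  obtain ⟨σ, hσ, hσp, hsection⟩ := p.exists_section_toRProj
  rw [← hσp] at h
  refine (h.comp _ hσ).congr_of_eventuallyEq ?_
  filter_upwards [hsection] with z hz using (congrArg Φ hz).symm

end Maps

end ProjectiveBundle

section TangentOfProjectiveBundle

variable {EX : Type*} [NormedAddCommGroup EX] [NormedSpace ℂ EX]
  {X : Type*} [TopologicalSpace X] [ChartedSpace EX X]
  {L : X → Type*} [∀ x, AddCommGroup (L x)] [∀ x, Module ℂ (L x)] [∀ x, TopologicalSpace (L x)]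
  [TopologicalSpace (TotalSpace ℂ L)] [FiberBundle ℂ L] [VectorBundle ℂ ℂ L]
  [ContMDiffVectorBundle ω ℂ L 𝓘(ℂ, EX)]
  {E : Type*} [NormedAddCommGroup E] [NormedSpace ℂ E]
  {B : Type*} [TopologicalSpace B] [ChartedSpace E B]
  {f : ContMDiffMap 𝓘(ℂ, E) 𝓘(ℂ, EX) B X ω}

/-- The differential of the projection of a real projective bundle to its base. -/
abbrev RProj.dbase (z : RProj L f) : E × ℝ →L[ℝ] E :=
  mfderiv (𝓘(ℝ, E).prod 𝓘(ℝ, ℝ)) 𝓘(ℝ, E) RProj.base z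

variable [IsManifold 𝓘(ℂ, E) ω B]

theorem RProj.hasMFDerivAt_base (z : RProj L f) :
    HasMFDerivAt (𝓘(ℝ, E).prod 𝓘(ℝ, ℝ)) 𝓘(ℝ, E) RProj.base z z.dbase :=
  (RProj.contMDiff_base.mdifferentiable (by simp) z).hasMFDerivAt

theorem RProj.dbase_mfderiv {E' : Type*} [NormedAddCommGroup E'] [NormedSpace ℂ E']
    {B' : Type*} [TopologicalSpace B'] [ChartedSpace E' B'] [IsManifold 𝓘(ℂ, E') ω B']
    {f' : ContMDiffMap 𝓘(ℂ, E') 𝓘(ℂ, EX) B' X ω} {F : RProj L f → RProj L f'} {φ : B → B'}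
    {z : RProj L f}
    (hF : MDifferentiableAt (𝓘(ℝ, E).prod 𝓘(ℝ, ℝ)) (𝓘(ℝ, E').prod 𝓘(ℝ, ℝ)) F z)
    (hφ : MDifferentiableAt 𝓘(ℂ, E) 𝓘(ℂ, E') φ z.base) (hbase : ∀ w, (F w).base = φ w.base)
    (u : E × ℝ) :
    (F z).dbase (mfderiv (𝓘(ℝ, E).prod 𝓘(ℝ, ℝ)) (𝓘(ℝ, E').prod 𝓘(ℝ, ℝ)) F z u) =
      (mfderiv 𝓘(ℂ, E) 𝓘(ℂ, E') φ z.base (z.dbase u) : E') := by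
  have hφ' : HasMFDerivAt 𝓘(ℝ, E) 𝓘(ℝ, E') φ z.base _ :=
    hasMFDerivAt_restrictScalars ℝ hφ.hasMFDerivAt rfl rfl
  exact hasMFDerivAt_comp_apply_eq hbase (F z).hasMFDerivAt_base hF.hasMFDerivAt hφ'
    z.hasMFDerivAt_base u

section

variable {x₀ : X} {c : ℂ}

theorem RProj.hasMFDerivAt_rprojTriv {z : RProj L f}
    (hz : z ∈ (rprojTriv (L := L) (f := f) x₀ c).source) :
    HasMFDerivAt (𝓘(ℝ, E).prod 𝓘(ℝ, ℝ)) (𝓘(ℝ, E).prod 𝓘(ℝ, ℝ)) (rprojTriv x₀ c) z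
      (mfderiv (𝓘(ℝ, E).prod 𝓘(ℝ, ℝ)) (𝓘(ℝ, E).prod 𝓘(ℝ, ℝ)) (rprojTriv x₀ c) z) :=
  (((contMDiffOn_rprojTriv x₀ c).contMDiffAt
    ((isOpen_rprojTriv_source x₀ c).mem_nhds hz)).mdifferentiableAt (by simp)).hasMFDerivAt

theorem RProj.fst_mfderiv_rprojTriv {z : RProj L f}
    (hz : z ∈ (rprojTriv (L := L) (f := f) x₀ c).source) (u : E × ℝ) :
    (mfderiv (𝓘(ℝ, E).prod 𝓘(ℝ, ℝ)) (𝓘(ℝ, E).prod 𝓘(ℝ, ℝ)) (rprojTriv x₀ c) z u : E × ℝ).1 =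
      z.dbase u :=
  DFunLike.congr_fun (hasMFDerivAt_unique
    ((hasMFDerivAt_fst _).comp z (RProj.hasMFDerivAt_rprojTriv hz)) z.hasMFDerivAt_base) u

theorem RProj.mfderiv_rprojTriv_bijective {z : RProj L f}
    (hz : z ∈ (rprojTriv (L := L) (f := f) x₀ c).source) :
    Function.Bijective
      (mfderiv (𝓘(ℝ, E).prod 𝓘(ℝ, ℝ)) (𝓘(ℝ, E).prod 𝓘(ℝ, ℝ)) (rprojTriv x₀ c) z) := by
  have hq := (rprojTriv x₀ c).map_source hz
  have hsymm := (((contMDiffOn_rprojTriv_symm x₀ c).contMDiffAt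
    ((isOpen_rprojTriv_target x₀ c).mem_nhds hq)).mdifferentiableAt (by simp)).hasMFDerivAt
  have hleft := (hsymm.comp z (RProj.hasMFDerivAt_rprojTriv hz)).congr_of_eventuallyEq
    (f₁ := id) (by
      filter_upwards [(isOpen_rprojTriv_source x₀ c).mem_nhds hz] with y hy
      exact ((rprojTriv x₀ c).left_inv hy).symm)
  have hright := ((hasMFDerivAt_of_eq ((rprojTriv x₀ c).left_inv hz).symm
    (RProj.hasMFDerivAt_rprojTriv hz)).comp _ hsymm).congr_of_eventuallyEq (f₁ := id) (by
      filter_upwards [(isOpen_rprojTriv_target x₀ c).mem_nhds hq] with y hy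
      exact ((rprojTriv x₀ c).right_inv hy).symm)
  exact Function.bijective_iff_has_inverse.2
    ⟨_, DFunLike.congr_fun (hasMFDerivAt_unique hleft (hasMFDerivAt_id _)),
      DFunLike.congr_fun (hasMFDerivAt_unique hright (hasMFDerivAt_id _))⟩

end

theorem RProj.dbase_surjective (z : RProj L f) : Function.Surjective z.dbase := by
  intro v
  obtain ⟨c, hz⟩ := z.exists_mem_source
  obtain ⟨u, hu⟩ := (RProj.mfderiv_rprojTriv_bijective hz).surjective ((v, 0) : E × ℝ)
  exact ⟨u, (RProj.fst_mfderiv_rprojTriv hz u).symm.trans (congrArg Prod.fst hu)⟩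

end TangentOfProjectiveBundle

section HatGroupoid

variable {EX : Type*} [NormedAddCommGroup EX] [NormedSpace ℂ EX]
  {X : Type*} [TopologicalSpace X] [ChartedSpace EX X]
  {EG : Type*} [NormedAddCommGroup EG] [NormedSpace ℂ EG]
  {G : Type*} [TopologicalSpace G] [ChartedSpace EG G]
  {Γ : LieGroupoid 𝓘(ℂ, EG) 𝓘(ℂ, EX) ω G X}
  {L : X → Type*} [∀ x, AddCommGroup (L x)] [∀ x, Module ℂ (L x)] [∀ x, TopologicalSpace (L x)]

section

variable [TopologicalSpace (TotalSpace ℂ L)] [FiberBundle ℂ L] [VectorBundle ℂ ℂ L]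
  (A : LineAction Γ L)

/-- The map `(g, ε) ↦ ε ∘ g`, a lift of the source map of `Ĝ` to `L_G^* ∖ 0 → L^* ∖ 0`. -/
def srcTilde (p : ArrowTilde Γ L) : Slit L (idMap (EX := EX) X) :=
  ⟨Γ.src p.base, A.dual p.base p.covec,
    fun h => p.ne_zero (A.dual_injective p.base (h.trans (map_zero _).symm))⟩

theorem slitTriv_srcTilde {p : ArrowTilde Γ L} {g₀ : G}
    (hp : p ∈ (slitTriv (L := L) (f := Γ.tgtMap) (Γ.tgt g₀)).source) :
    slitTriv (Γ.src g₀) (srcTilde A p) = (Γ.src p.base,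
      (slitTriv (L := L) (f := Γ.tgtMap) (Γ.tgt g₀) p).2 *
        ContinuousLinearMap.inCoordinates ℂ L ℂ L (Γ.src g₀) (Γ.src p.base) (Γ.tgt g₀)
          (Γ.tgt p.base) (A.act p.base : L (Γ.src p.base) →L[ℂ] L (Γ.tgt p.base)) 1) := by
  refine Prod.ext rfl ?_
  change lineCoord L (Γ.src g₀) (Γ.src p.base) (A.dual p.base p.covec) = _
  conv_lhs => rw [← ofLineCoord_lineCoord hp p.covec]
  rfl

end

variable [IsManifold 𝓘(ℂ, EX) ω X] [IsManifold 𝓘(ℂ, EG) ω G]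
  [TopologicalSpace (TotalSpace ℂ L)] [FiberBundle ℂ L] [VectorBundle ℂ ℂ L]
  [ContMDiffVectorBundle ω ℂ L 𝓘(ℂ, EX)]

theorem contMDiff_tgtHat :
    ContMDiff (𝓘(ℝ, EG).prod 𝓘(ℝ, ℝ)) (𝓘(ℝ, EX).prod 𝓘(ℝ, ℝ)) ∞
      (tgtHat : ArrowHat Γ L → BaseHat Γ L) := by
  intro z
  obtain ⟨c, hz⟩ := z.exists_mem_source
  have hsource := (isOpen_rprojTriv_source (L := L) (f := Γ.tgtMap) (Γ.tgt z.base) c).mem_nhds hz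
  have htriv := (contMDiffOn_rprojTriv (L := L) (f := Γ.tgtMap) (Γ.tgt z.base) c).contMDiffAt
    hsource
  have htgt : ContMDiff 𝓘(ℝ, EG) 𝓘(ℝ, EX) ∞ Γ.tgt :=
    (contMDiff_restrictScalars ℝ Γ.contMDiff_tgt rfl rfl).of_le le_top
  exact RProj.contMDiffWithinAt_of_rprojTriv (Γ.tgt z.base) c hz
    (mem_nhdsWithin_of_mem_nhds hsource)
    (((htgt.comp RProj.contMDiff_base) z).prodMk (contMDiff_snd.contMDiffAt.comp z htriv))

theorem contMDiffWithinAt_arrowHat {F : Type*} [NormedAddCommGroup F] [NormedSpace ℝ F]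
    {K : Type*} [TopologicalSpace K] {J : ModelWithCorners ℝ F K}
    {N : Type*} [TopologicalSpace N] [ChartedSpace K N]
    {Φ : N → ArrowHat Γ L} {s : Set N} {x : N}
    (hbase : ContMDiffWithinAt J 𝓘(ℝ, EG) ∞ (fun y => (Φ y).base) s x)
    (htgt : ContMDiffWithinAt J (𝓘(ℝ, EX).prod 𝓘(ℝ, ℝ)) ∞ (fun y => tgtHat (Φ y)) s x) :
    ContMDiffWithinAt J (𝓘(ℝ, EG).prod 𝓘(ℝ, ℝ)) ∞ Φ s x := by
  obtain ⟨c, hz⟩ := (Φ x).exists_mem_source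
  have hsource : (rprojTriv (L := L) (f := idMap (EX := EX) X) (Γ.tgt (Φ x).base) c).source ∈
      𝓝 (tgtHat (Φ x)) := (isOpen_rprojTriv_source _ _).mem_nhds hz
  exact RProj.contMDiffWithinAt_of_rprojTriv (Γ.tgt (Φ x).base) c hz
    (htgt.continuousWithinAt.preimage_mem_nhdsWithin hsource)
    (hbase.prodMk (contMDiff_snd.contMDiffAt.comp_contMDiffWithinAt x
      (((contMDiffOn_rprojTriv _ c).contMDiffAt hsource).comp_contMDiffWithinAt x htgt)))

variable (A : LineAction Γ L)

theorem contMDiff_srcTilde :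
    ContMDiff (𝓘(ℝ, EG).prod 𝓘(ℝ, ℂ)) (𝓘(ℝ, EX).prod 𝓘(ℝ, ℂ)) ∞ (srcTilde A) := by
  intro p
  have hsource := (isOpen_slitTriv_source (L := L) (f := Γ.tgtMap) (Γ.tgt p.base)).mem_nhds
    p.mem_slitTriv_source
  have hbase : ContMDiff (𝓘(ℝ, EG).prod 𝓘(ℝ, ℂ)) 𝓘(ℝ, EG) ∞ (Slit.base : ArrowTilde Γ L → G) :=
    (contMDiff_restrictScalars ℝ Slit.contMDiff_base rfl rfl).of_le le_top
  have hsrc : ContMDiff (𝓘(ℝ, EG).prod 𝓘(ℝ, ℂ)) 𝓘(ℝ, EX) ∞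
      (fun q : ArrowTilde Γ L => Γ.src q.base) :=
    ((contMDiff_restrictScalars ℝ Γ.contMDiff_src rfl rfl).of_le le_top).comp hbase
  have hact : ContMDiffAt 𝓘(ℝ, EG) 𝓘(ℝ, ℂ) ∞
      (fun g => ContinuousLinearMap.inCoordinates ℂ L ℂ L (Γ.src p.base) (Γ.src g)
        (Γ.tgt p.base) (Γ.tgt g) (A.act g : L (Γ.src g) →L[ℂ] L (Γ.tgt g)) 1) p.base :=
    (contMDiffWithinAt_restrictScalars ℝ ((A.holomorphic p.base).clm_apply contMDiffAt_const)
      rfl rfl).of_le le_top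
  have htriv := (contMDiffOn_real_slitTriv (L := L) (f := Γ.tgtMap) (Γ.tgt p.base)).contMDiffAt
    hsource
  have hmul : ContDiff ℝ ∞ (fun w : ℂ × ℂ => w.1 * w.2) := contDiff_fst.mul contDiff_snd
  refine Slit.contMDiffAt_of_slitTriv (Γ.src p.base) ?_ ?_
  · exact hsrc.continuous.continuousAt.preimage_mem_nhds
      ((trivializationAt ℂ L (Γ.src p.base)).open_baseSet.mem_nhds
        (FiberBundle.mem_baseSet_trivializationAt' _))
  · refine (hsrc.contMDiffAt.prodMk (hmul.contMDiff.contMDiffAt.comp p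
      ((contMDiff_snd.contMDiffAt.comp p htriv).prodMk_space
        (hact.comp p hbase.contMDiffAt)))).congr_of_eventuallyEq ?_
    filter_upwards [hsource] with q hq using slitTriv_srcTilde A hq

theorem contMDiff_srcHat :
    ContMDiff (𝓘(ℝ, EG).prod 𝓘(ℝ, ℝ)) (𝓘(ℝ, EX).prod 𝓘(ℝ, ℝ)) ∞ (srcHat A) := by
  intro z
  obtain ⟨p, rfl⟩ := Slit.toRProj_surjective z
  exact contMDiffAt_of_comp_toRProj
    ((Slit.contMDiff_toRProj.comp (contMDiff_srcTilde A)).contMDiffAt)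

theorem contMDiff_unitHat :
    ContMDiff (𝓘(ℝ, EX).prod 𝓘(ℝ, ℝ)) (𝓘(ℝ, EG).prod 𝓘(ℝ, ℝ)) ∞ (groupoidHat A).unit := by
  intro p
  have htgt : (fun q => tgtHat ((groupoidHat A).unit q)) = id := funext (groupoidHat A).tgt_unit
  exact contMDiffWithinAt_arrowHat
    ((((contMDiff_restrictScalars ℝ Γ.contMDiff_unit rfl rfl).of_le le_top).comp
      RProj.contMDiff_base) p) (htgt ▸ contMDiff_id p)

theorem contMDiff_invHat :
    ContMDiff (𝓘(ℝ, EG).prod 𝓘(ℝ, ℝ)) (𝓘(ℝ, EG).prod 𝓘(ℝ, ℝ)) ∞ (groupoidHat A).inv := by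
  intro z
  have htgt : (fun w => tgtHat ((groupoidHat A).inv w)) = srcHat A :=
    funext (groupoidHat A).tgt_inv
  exact contMDiffWithinAt_arrowHat
    ((((contMDiff_restrictScalars ℝ Γ.contMDiff_inv rfl rfl).of_le le_top).comp
      RProj.contMDiff_base) z) (htgt ▸ contMDiff_srcHat A z)

theorem contMDiffOn_mulHat :
    ContMDiffOn ((𝓘(ℝ, EG).prod 𝓘(ℝ, ℝ)).prod (𝓘(ℝ, EG).prod 𝓘(ℝ, ℝ)))
      (𝓘(ℝ, EG).prod 𝓘(ℝ, ℝ)) ∞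
      (fun q : ArrowHat Γ L × ArrowHat Γ L => (groupoidHat A).mul q.1 q.2)
      (groupoidHat A).composable := by
  intro q hq
  have hcomp : ∀ r ∈ (groupoidHat A).composable, Γ.src r.1.base = Γ.tgt r.2.base :=
    fun r hr => congrArg RProj.base hr
  have hmul : ContMDiffWithinAt (𝓘(ℝ, EG).prod 𝓘(ℝ, EG)) 𝓘(ℝ, EG) ∞
      (fun p : G × G => Γ.mul p.1 p.2) Γ.composable (q.1.base, q.2.base) :=
    (contMDiffWithinAt_restrictScalars ℝ (Γ.contMDiffOn_mul _ (hcomp q hq)) rfl rfl).of_le le_top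
  have hbase : ContMDiff ((𝓘(ℝ, EG).prod 𝓘(ℝ, ℝ)).prod (𝓘(ℝ, EG).prod 𝓘(ℝ, ℝ)))
      (𝓘(ℝ, EG).prod 𝓘(ℝ, EG)) ∞
      (fun r : ArrowHat Γ L × ArrowHat Γ L => (r.1.base, r.2.base)) :=
    (RProj.contMDiff_base.comp contMDiff_fst).prodMk (RProj.contMDiff_base.comp contMDiff_snd)
  have hmaps : (groupoidHat A).composable ⊆
      (fun r : ArrowHat Γ L × ArrowHat Γ L => (r.1.base, r.2.base)) ⁻¹' Γ.composable := hcomp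
  have hmulbase := hmul.comp q hbase.contMDiffAt.contMDiffWithinAt hmaps
  exact contMDiffWithinAt_arrowHat
    (hmulbase.congr (fun r hr => mulHat_base (hcomp r hr)) (mulHat_base (hcomp q hq)))
    ((contMDiff_tgtHat.comp contMDiff_fst).contMDiffAt.contMDiffWithinAt.congr
      (fun r hr => tgtHat_mulHat (hcomp r hr)) (tgtHat_mulHat (hcomp q hq)))

end HatGroupoid

section TangentOfHatGroupoid

variable {EX : Type*} [NormedAddCommGroup EX] [NormedSpace ℂ EX]
  {X : Type*} [TopologicalSpace X] [ChartedSpace EX X] [IsManifold 𝓘(ℂ, EX) ω X]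
  {EG : Type*} [NormedAddCommGroup EG] [NormedSpace ℂ EG]
  {G : Type*} [TopologicalSpace G] [ChartedSpace EG G] [IsManifold 𝓘(ℂ, EG) ω G]
  {Γ : LieGroupoid 𝓘(ℂ, EG) 𝓘(ℂ, EX) ω G X}
  {L : X → Type*} [∀ x, AddCommGroup (L x)] [∀ x, Module ℂ (L x)] [∀ x, TopologicalSpace (L x)]
  [TopologicalSpace (TotalSpace ℂ L)] [FiberBundle ℂ L] [VectorBundle ℂ ℂ L]
  [ContMDiffVectorBundle ω ℂ L 𝓘(ℂ, EX)]

theorem dbase_mfderiv_tgtHat (z : ArrowHat Γ L) (V : EG × ℝ) :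
    (tgtHat z).dbase (mfderiv (𝓘(ℝ, EG).prod 𝓘(ℝ, ℝ)) (𝓘(ℝ, EX).prod 𝓘(ℝ, ℝ)) tgtHat z V) =
      (mfderiv 𝓘(ℂ, EG) 𝓘(ℂ, EX) Γ.tgt z.base (z.dbase V) : EX) :=
  RProj.dbase_mfderiv (contMDiff_tgtHat.mdifferentiable (by simp) z)
    (Γ.contMDiff_tgt.mdifferentiable (by simp) z.base) (fun _ => rfl) V

theorem dbase_mfderiv_srcHat (A : LineAction Γ L) (z : ArrowHat Γ L) (V : EG × ℝ) :
    (srcHat A z).dbase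
        (mfderiv (𝓘(ℝ, EG).prod 𝓘(ℝ, ℝ)) (𝓘(ℝ, EX).prod 𝓘(ℝ, ℝ)) (srcHat A) z V) =
      (mfderiv 𝓘(ℂ, EG) 𝓘(ℂ, EX) Γ.src z.base (z.dbase V) : EX) :=
  RProj.dbase_mfderiv ((contMDiff_srcHat A).mdifferentiable (by simp) z)
    (Γ.contMDiff_src.mdifferentiable (by simp) z.base) (fun _ => rfl) V

theorem dbase_mfderiv_unitHat (A : LineAction Γ L) (p : BaseHat Γ L) (u : EX × ℝ) :
    ((groupoidHat A).unit p).dbase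
        (mfderiv (𝓘(ℝ, EX).prod 𝓘(ℝ, ℝ)) (𝓘(ℝ, EG).prod 𝓘(ℝ, ℝ)) (groupoidHat A).unit p u) =
      (mfderiv 𝓘(ℂ, EX) 𝓘(ℂ, EG) Γ.unit p.base (p.dbase u) : EG) :=
  RProj.dbase_mfderiv ((contMDiff_unitHat A).mdifferentiable (by simp) p)
    (Γ.contMDiff_unit.mdifferentiable (by simp) p.base) (fun _ => rfl) u

theorem dbase_mfderiv_invHat (A : LineAction Γ L) (z : ArrowHat Γ L) (V : EG × ℝ) :
    ((groupoidHat A).inv z).dbase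
        (mfderiv (𝓘(ℝ, EG).prod 𝓘(ℝ, ℝ)) (𝓘(ℝ, EG).prod 𝓘(ℝ, ℝ)) (groupoidHat A).inv z V) =
      (mfderiv 𝓘(ℂ, EG) 𝓘(ℂ, EG) Γ.inv z.base (z.dbase V) : EG) :=
  RProj.dbase_mfderiv ((contMDiff_invHat A).mdifferentiable (by simp) z)
    (Γ.contMDiff_inv.mdifferentiable (by simp) z.base) (fun _ => rfl) V

theorem exists_dbase_eq_and_mfderiv_tgtHat_eq (z : ArrowHat Γ L) (v : EG) (u : EX × ℝ)
    (h : (mfderiv 𝓘(ℂ, EG) 𝓘(ℂ, EX) Γ.tgt z.base v : EX) = (tgtHat z).dbase u) :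
    ∃ V : EG × ℝ, z.dbase V = v ∧
      (mfderiv (𝓘(ℝ, EG).prod 𝓘(ℝ, ℝ)) (𝓘(ℝ, EX).prod 𝓘(ℝ, ℝ)) tgtHat z V : EX × ℝ) = u := by
  obtain ⟨c, hz⟩ := z.exists_mem_source
  have hz' : tgtHat z ∈ (rprojTriv (L := L) (f := idMap (EX := EX) X) (Γ.tgt z.base) c).source :=
    hz
  have htriv := RProj.hasMFDerivAt_rprojTriv hz
  have htriv' := RProj.hasMFDerivAt_rprojTriv hz'
  set T' : EX × ℝ →L[ℝ] EX × ℝ := mfderiv (𝓘(ℝ, EX).prod 𝓘(ℝ, ℝ)) (𝓘(ℝ, EX).prod 𝓘(ℝ, ℝ))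
    (rprojTriv (Γ.tgt z.base) c) (tgtHat z)
  obtain ⟨V, hV⟩ := (RProj.mfderiv_rprojTriv_bijective hz).surjective ((v, (T' u).2) : EG × ℝ)
  have hdbase : z.dbase V = v :=
    (RProj.fst_mfderiv_rprojTriv hz V).symm.trans (congrArg Prod.fst hV)
  refine ⟨V, hdbase, (RProj.mfderiv_rprojTriv_bijective hz').injective (Prod.ext ?_ ?_)⟩
  · exact (RProj.fst_mfderiv_rprojTriv hz' _).trans ((dbase_mfderiv_tgtHat z V).trans
      ((hdbase ▸ h).trans (RProj.fst_mfderiv_rprojTriv hz' u).symm))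
  · have hsnd := hasMFDerivAt_comp_apply_eq (g := fun q : X × ℝ => q.2)
      (f := fun y : ArrowHat Γ L =>
        rprojTriv (L := L) (f := idMap (EX := EX) X) (Γ.tgt z.base) c (tgtHat y))
      (g₂ := fun q : G × ℝ => q.2) (fun y => rfl) (hasMFDerivAt_snd _)
      (htriv'.comp z (contMDiff_tgtHat.mdifferentiable (by simp) z).hasMFDerivAt)
      (hasMFDerivAt_snd _) htriv V
    exact hsnd.trans (congrArg Prod.snd hV)

theorem exists_dbase_eq_and_mfderiv_srcHat_eq (A : LineAction Γ L) (z : ArrowHat Γ L) (v : EG)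
    (u : EX × ℝ)
    (h : (mfderiv 𝓘(ℂ, EG) 𝓘(ℂ, EX) Γ.src z.base v : EX) = (srcHat A z).dbase u) :
    ∃ V : EG × ℝ, z.dbase V = v ∧
      (mfderiv (𝓘(ℝ, EG).prod 𝓘(ℝ, ℝ)) (𝓘(ℝ, EX).prod 𝓘(ℝ, ℝ)) (srcHat A) z V : EX × ℝ) = u := by
  obtain ⟨w, rfl⟩ : ∃ w, (groupoidHat A).inv w = z :=
    ⟨(groupoidHat A).inv z, (groupoidHat A).inv_inv z⟩
  obtain ⟨v', rfl⟩ := Γ.mfderiv_inv_surjective (by simp) w.base v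
  have hw : (mfderiv 𝓘(ℂ, EG) 𝓘(ℂ, EX) Γ.tgt w.base v' : EX) = (tgtHat w).dbase u :=
    (Γ.mfderiv_src_inv (by simp) w.base v').symm.trans
      (h.trans (congrArg (fun p : BaseHat Γ L => p.dbase u) ((groupoidHat A).src_inv w)))
  obtain ⟨W, rfl, rfl⟩ := exists_dbase_eq_and_mfderiv_tgtHat_eq w v' u hw
  refine ⟨mfderiv (𝓘(ℝ, EG).prod 𝓘(ℝ, ℝ)) (𝓘(ℝ, EG).prod 𝓘(ℝ, ℝ)) (groupoidHat A).inv w W,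
    dbase_mfderiv_invHat A w W, ?_⟩
  exact hasMFDerivAt_comp_apply_eq (g₂ := id) (groupoidHat A).src_inv
    ((contMDiff_srcHat A).mdifferentiable (by simp) _).hasMFDerivAt
    ((contMDiff_invHat A).mdifferentiable (by simp) w).hasMFDerivAt (hasMFDerivAt_id _)
    (contMDiff_tgtHat.mdifferentiable (by simp) w).hasMFDerivAt W

/-- `Ĝ ⇉ M̂` as a real Lie groupoid. -/
def lieGroupoidHat (A : LineAction Γ L) :
    LieGroupoid (𝓘(ℝ, EG).prod 𝓘(ℝ, ℝ)) (𝓘(ℝ, EX).prod 𝓘(ℝ, ℝ)) ∞ (ArrowHat Γ L) (BaseHat Γ L) where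
  toGroupoidStr := groupoidHat A
  contMDiff_src := contMDiff_srcHat A
  contMDiff_tgt := contMDiff_tgtHat
  contMDiff_unit := contMDiff_unitHat A
  contMDiff_inv := contMDiff_invHat A
  contMDiffOn_mul := contMDiffOn_mulHat A
  submersion_src z u := by
    obtain ⟨v, hv⟩ := Γ.submersion_src z.base ((srcHat A z).dbase u)
    obtain ⟨V, -, hV⟩ := exists_dbase_eq_and_mfderiv_srcHat_eq A z v u hv
    exact ⟨V, hV⟩
  submersion_tgt z u := by
    obtain ⟨v, hv⟩ := Γ.submersion_tgt z.base ((tgtHat z).dbase u)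
    obtain ⟨V, -, hV⟩ := exists_dbase_eq_and_mfderiv_tgtHat_eq z v u hv
    exact ⟨V, hV⟩

theorem dbase_tangentMul [FiniteDimensional ℂ EX] [CompleteSpace EG] (A : LineAction Γ L)
    {z w : ArrowHat Γ L} (hzw : srcHat A z = tgtHat w) {V W : EG × ℝ}
    (hVW : (mfderiv (𝓘(ℝ, EG).prod 𝓘(ℝ, ℝ)) (𝓘(ℝ, EX).prod 𝓘(ℝ, ℝ)) (srcHat A) z V : EX × ℝ) =
      (mfderiv (𝓘(ℝ, EG).prod 𝓘(ℝ, ℝ)) (𝓘(ℝ, EX).prod 𝓘(ℝ, ℝ)) tgtHat w W : EX × ℝ)) :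
    ((groupoidHat A).mul z w).dbase
        ((groupoidHat A).tangentMul (𝓘(ℝ, EG).prod 𝓘(ℝ, ℝ)) ⟨z, V⟩ ⟨w, W⟩).snd =
      (Γ.tangentMul 𝓘(ℂ, EG) ⟨z.base, z.dbase V⟩ ⟨w.base, w.dbase W⟩).snd := by
  have hbase : MDifferentiable (𝓘(ℝ, EG).prod 𝓘(ℝ, ℝ)) 𝓘(ℝ, EG)
      (RProj.base : ArrowHat Γ L → G) := fun z => z.hasMFDerivAt_base.mdifferentiableAt
  have hmul : HasMFDerivWithinAt (𝓘(ℝ, EG).prod 𝓘(ℝ, EG)) 𝓘(ℝ, EG)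
      (fun p : G × G => Γ.mul p.1 p.2) Γ.composable (z.base, w.base) _ :=
    hasMFDerivWithinAt_restrictScalars ℝ
      (Γ.hasMFDerivWithinAt_mul (by simp) (congrArg RProj.base hzw)) rfl rfl
  exact LieGroupoid.map_tangentMul (lieGroupoidHat A) (by simp) Γ.toGroupoidStr hbase
    (fun z w h => congrArg RProj.base h) (fun z w h => mulHat_base (congrArg RProj.base h)) hzw
    hVW hmul

end TangentOfHatGroupoid

section ExteriorDerivative

variable {𝕜 : Type*} [NontriviallyNormedField 𝕜] {E : Type*} [NormedAddCommGroup E]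
  [NormedSpace 𝕜 E]

theorem extDerivOne_apply {H : Type*} [TopologicalSpace H] {I : ModelWithCorners 𝕜 E H}
    {M : Type*} [TopologicalSpace M] [ChartedSpace H M] [IsManifold I 1 M]
    (α : ∀ p : M, TangentSpace I p →L[𝕜] 𝕜) (p : M) {a : E → E →L[𝕜] 𝕜}
    (ha : a = fun y => (α ((extChartAt I p).symm y)).comp
      (mfderiv 𝓘(𝕜, E) I (extChartAt I p).symm y)) (u v : E) :
    extDerivOne I α p u v =
      fderiv 𝕜 a (extChartAt I p p) u v - fderiv 𝕜 a (extChartAt I p p) v u := by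
  have hd (w : E) : (mfderiv I 𝓘(𝕜, E) (extChartAt I p) p w : E) = w :=
    congrArg (fun T : E →L[𝕜] E => T w) mfderiv_extChartAt_self
  have happly := congrArg₂ (fun u' v' : E => fderiv 𝕜 a (extChartAt I p p) u' v' -
    fderiv 𝕜 a (extChartAt I p p) v' u') (hd u) (hd v)
  subst ha
  exact happly

/-- This is `ι_Z dα = α` for the form `α = y₂ b(y₁)(dy₁)` and the vector field
`Z = y₂ ∂/∂y₂`. -/
theorem fderiv_homogeneous_form {b : E → E →L[𝕜] 𝕜} {a : E × 𝕜 → E × 𝕜 →L[𝕜] 𝕜}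
    {y₀ : E × 𝕜} (hb : DifferentiableAt 𝕜 b y₀.1)
    (ha : ∀ᶠ y in 𝓝 y₀, ∀ u, a y u = y.2 * b y.1 u.1) (v : E × 𝕜) :
    fderiv 𝕜 a y₀ (0, y₀.2) v - fderiv 𝕜 a y₀ v (0, y₀.2) = y₀.2 * b y₀.1 v.1 := by
  let C : (E →L[𝕜] 𝕜) →L[𝕜] (E × 𝕜 →L[𝕜] 𝕜) :=
    (ContinuousLinearMap.compL 𝕜 (E × 𝕜) E 𝕜).flip (ContinuousLinearMap.fst 𝕜 E 𝕜)
  have haC : a =ᶠ[𝓝 y₀] fun y => y.2 • C (b y.1) := by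
    filter_upwards [ha] with y hy using ContinuousLinearMap.ext hy
  have hderiv := HasFDerivAt.congr_of_eventuallyEq (hasFDerivAt_snd.smul
    (C.hasFDerivAt.comp y₀ (hb.hasFDerivAt.comp y₀ hasFDerivAt_fst))) haC
  have hleibniz (u u' : E × 𝕜) : fderiv 𝕜 a y₀ u u' =
      y₀.2 * fderiv 𝕜 b y₀.1 u.1 u'.1 + u.2 * b y₀.1 u'.1 := by
    rw [hderiv.fderiv]
    rfl
  rw [hleibniz, hleibniz]
  simp only [map_zero, mul_zero, zero_apply, zero_add, add_zero, sub_zero]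

end ExteriorDerivative

section SlitCharts

variable {EX : Type*} [NormedAddCommGroup EX] [NormedSpace ℂ EX]
  {X : Type*} [TopologicalSpace X] [ChartedSpace EX X]
  {L : X → Type*} [∀ x, AddCommGroup (L x)] [∀ x, Module ℂ (L x)] [∀ x, TopologicalSpace (L x)]
  [TopologicalSpace (TotalSpace ℂ L)] [FiberBundle ℂ L] [VectorBundle ℂ ℂ L]
  [ContMDiffVectorBundle ω ℂ L 𝓘(ℂ, EX)]
  {E : Type*} [NormedAddCommGroup E] [NormedSpace ℂ E]
  {B : Type*} [TopologicalSpace B] [ChartedSpace E B]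
  {f : ContMDiffMap 𝓘(ℂ, E) 𝓘(ℂ, EX) B X ω}

theorem Slit.extChartAt_symm_apply (p : Slit L f) (y : E × ℂ) :
    (extChartAt (𝓘(ℂ, E).prod 𝓘(ℂ, ℂ)) p).symm y =
      (slitTriv (f p.base)).symm ((extChartAt 𝓘(ℂ, E) p.base).symm y.1, y.2) := rfl

theorem Slit.mem_target_of_mem_extChartAt_target (p : Slit L f) {y : E × ℂ}
    (hy : y ∈ (extChartAt (𝓘(ℂ, E).prod 𝓘(ℂ, ℂ)) p).target) :
    y.1 ∈ (extChartAt 𝓘(ℂ, E) p.base).target ∧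
      ((extChartAt 𝓘(ℂ, E) p.base).symm y.1, y.2) ∈
        (slitTriv (L := L) (f := f) (f p.base)).target := by
  rw [extChartAt_target] at hy
  obtain ⟨⟨⟨hbase, -⟩, htriv⟩, -⟩ : ((𝓘(ℂ, E).prod 𝓘(ℂ, ℂ)).symm y : ModelProd E ℂ) ∈
    (chartAt (ModelProd E ℂ) (slitTriv (f p.base) p)).target ∩
      (chartAt (ModelProd E ℂ) (slitTriv (f p.base) p)).symm ⁻¹'
        (slitTriv (L := L) (f := f) (f p.base)).target ∧ _ := hy
  refine ⟨?_, htriv⟩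
  rw [extChartAt_target]
  exact ⟨hbase, by simp⟩

theorem Slit.base_extChartAt_symm (p : Slit L f) {y : E × ℂ}
    (hy : y ∈ (extChartAt (𝓘(ℂ, E).prod 𝓘(ℂ, ℂ)) p).target) :
    ((extChartAt (𝓘(ℂ, E).prod 𝓘(ℂ, ℂ)) p).symm y).base =
      (extChartAt 𝓘(ℂ, E) p.base).symm y.1 := by
  rw [Slit.extChartAt_symm_apply,
    slitTriv_symm _ (Slit.mem_target_of_mem_extChartAt_target p hy).2]

variable [IsManifold 𝓘(ℂ, E) ω B]

theorem Slit.hasMFDerivAt_base (p : Slit L f) :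
    HasMFDerivAt (𝓘(ℂ, E).prod 𝓘(ℂ, ℂ)) 𝓘(ℂ, E) (Slit.base : Slit L f → B) p
      (ContinuousLinearMap.fst ℂ E ℂ) := by
  refine ⟨Slit.contMDiff_base.continuous.continuousAt, HasFDerivAt.hasFDerivWithinAt ?_⟩
  refine hasFDerivAt_fst.congr_of_eventuallyEq ?_
  filter_upwards [extChartAt_target_mem_nhds (I := 𝓘(ℂ, E).prod 𝓘(ℂ, ℂ)) p] with y hy
  exact (congrArg (extChartAt 𝓘(ℂ, E) p.base) (Slit.base_extChartAt_symm p hy)).trans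
    ((extChartAt 𝓘(ℂ, E) p.base).right_inv (Slit.mem_target_of_mem_extChartAt_target p hy).1)

theorem Slit.mfderiv_base_mfderiv_extChartAt_symm (p : Slit L f) {y : E × ℂ}
    (hy : y ∈ (extChartAt (𝓘(ℂ, E).prod 𝓘(ℂ, ℂ)) p).target) (v : E × ℂ) :
    (mfderiv (𝓘(ℂ, E).prod 𝓘(ℂ, ℂ)) 𝓘(ℂ, E) (Slit.base : Slit L f → B)
        ((extChartAt (𝓘(ℂ, E).prod 𝓘(ℂ, ℂ)) p).symm y)
        (mfderiv 𝓘(ℂ, E × ℂ) (𝓘(ℂ, E).prod 𝓘(ℂ, ℂ))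
          (extChartAt (𝓘(ℂ, E).prod 𝓘(ℂ, ℂ)) p).symm y v : E × ℂ) : E) =
      mfderiv 𝓘(ℂ, E) 𝓘(ℂ, E) (extChartAt 𝓘(ℂ, E) p.base).symm y.1 v.1 := by
  have htarget := extChartAt_target_mem_nhds' hy
  have hy₁ := (Slit.mem_target_of_mem_extChartAt_target p hy).1
  have hφ := ((mdifferentiableOn_extChartAt_symm y hy).mdifferentiableAt htarget).hasMFDerivAt
  have hχ := ((mdifferentiableOn_extChartAt_symm y.1 hy₁).mdifferentiableAt
    (extChartAt_target_mem_nhds' hy₁)).hasMFDerivAt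
  have hbase := (Slit.contMDiff_base.mdifferentiable (by simp)
    ((extChartAt (𝓘(ℂ, E).prod 𝓘(ℂ, ℂ)) p).symm y)).hasMFDerivAt.comp y hφ
  have hbase' := (hχ.comp y
    (hasFDerivAt_fst (𝕜 := ℂ) (E := E) (F := ℂ) (p := y)).hasMFDerivAt).congr_of_eventuallyEq
    (f₁ := Slit.base ∘ (extChartAt (𝓘(ℂ, E).prod 𝓘(ℂ, ℂ)) p).symm) (by
      filter_upwards [htarget] with q hq using Slit.base_extChartAt_symm p hq)
  exact DFunLike.congr_fun (hasMFDerivAt_unique hbase hbase') v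

end SlitCharts

section Symplectization

variable {EX : Type*} [NormedAddCommGroup EX] [NormedSpace ℂ EX]
  {X : Type*} [TopologicalSpace X] [ChartedSpace EX X]
  {EG : Type*} [NormedAddCommGroup EG] [NormedSpace ℂ EG]
  {G : Type*} [TopologicalSpace G] [ChartedSpace EG G]
  {Γ : LieGroupoid 𝓘(ℂ, EG) 𝓘(ℂ, EX) ω G X}
  {L : X → Type*} [∀ x, AddCommGroup (L x)] [∀ x, Module ℂ (L x)] [∀ x, TopologicalSpace (L x)]
  [TopologicalSpace (TotalSpace ℂ L)] [FiberBundle ℂ L] [VectorBundle ℂ ℂ L]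

section FormCoord

variable [IsManifold 𝓘(ℂ, EG) ω G]

/-- The coordinate expression at `g` of a `t^*L`-valued form `θ`, in the trivializations of `TG`
and `L` preferred at `g₀` and `t(g₀)`. -/
def formCoord (θ : ∀ g, TangentSpace 𝓘(ℂ, EG) g →L[ℂ] L (Γ.tgt g)) (g₀ g : G) : EG →L[ℂ] ℂ :=
  ContinuousLinearMap.inCoordinates EG (TangentSpace 𝓘(ℂ, EG)) ℂ L g₀ g
    (Γ.tgt g₀) (Γ.tgt g) (θ g)

theorem formCoord_extChartAt_symm (θ : ∀ g, TangentSpace 𝓘(ℂ, EG) g →L[ℂ] L (Γ.tgt g)) (g₀ : G)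
    {y : EG} (hy : y ∈ (extChartAt 𝓘(ℂ, EG) g₀).target) (v : EG) :
    formCoord θ g₀ ((extChartAt 𝓘(ℂ, EG) g₀).symm y) v =
      (trivializationAt ℂ L (Γ.tgt g₀)).continuousLinearMapAt ℂ _
        (θ _ (mfderiv 𝓘(ℂ, EG) 𝓘(ℂ, EG) (extChartAt 𝓘(ℂ, EG) g₀).symm y v)) := by
  have hmem := (extChartAt 𝓘(ℂ, EG) g₀).map_target hy
  rw [extChartAt_source] at hmem
  have hsymm := TangentBundle.symmL_trivializationAt (I := 𝓘(ℂ, EG)) hmem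
  rw [(extChartAt 𝓘(ℂ, EG) g₀).right_inv hy, ModelWithCorners.range_eq_univ,
    mfderivWithin_univ] at hsymm
  rw [← hsymm]
  rfl

theorem formCoord_self (θ : ∀ g, TangentSpace 𝓘(ℂ, EG) g →L[ℂ] L (Γ.tgt g)) (g : G) (v : EG) :
    formCoord θ g g v = (trivializationAt ℂ L (Γ.tgt g)).continuousLinearMapAt ℂ _ (θ g v) := by
  have hsymm := TangentBundle.symmL_trivializationAt (I := 𝓘(ℂ, EG)) (mem_chart_source EG g)
  rw [mfderivWithin_range_extChartAt_symm] at hsymm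
  exact congrArg (fun T : EG →L[ℂ] EG =>
    (trivializationAt ℂ L (Γ.tgt g)).continuousLinearMapAt ℂ _ (θ g (T v))) hsymm

theorem differentiableAt_formCoord {θ : ∀ g, TangentSpace 𝓘(ℂ, EG) g →L[ℂ] L (Γ.tgt g)}
    (hθ : IsHolomorphicForm θ) (g : G) :
    DifferentiableAt ℂ (fun y => formCoord θ g ((extChartAt 𝓘(ℂ, EG) g).symm y))
      (extChartAt 𝓘(ℂ, EG) g g) := by
  have hcoord := (contMDiffAt_iff.1 (hθ g)).2
  rw [ModelWithCorners.range_eq_univ, contDiffWithinAt_univ] at hcoord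
  exact hcoord.differentiableAt (by simp)

end FormCoord

variable [ContMDiffVectorBundle ω ℂ L 𝓘(ℂ, EX)]

theorem eulerField_eq (p : ArrowTilde Γ L) :
    (eulerField p : EG × ℂ) = (0, lineCoord L (Γ.tgt p.base) (Γ.tgt p.base) p.covec) := by
  set w := lineCoord L (Γ.tgt p.base) (Γ.tgt p.base) p.covec
  let γ : ℂ → EG × ℂ := fun z => (extChartAt 𝓘(ℂ, EG) p.base p.base, Complex.exp z * w)
  have hγ : HasFDerivAt γ (ContinuousLinearMap.toSpanSingleton ℂ ((0, w) : EG × ℂ)) 0 := by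
    have hexp := (Complex.hasDerivAt_exp 0).mul_const w
    rw [Complex.exp_zero, one_mul] at hexp
    exact ((hasDerivAt_const (0 : ℂ) (extChartAt 𝓘(ℂ, EG) p.base p.base)).prodMk
      hexp).hasFDerivAt
  have hγ₀ : γ 0 = extChartAt (𝓘(ℂ, EG).prod 𝓘(ℂ, ℂ)) p p :=
    Prod.ext rfl ((congrArg (· * w) Complex.exp_zero).trans (one_mul w))
  have hflow : (fun z => (extChartAt (𝓘(ℂ, EG).prod 𝓘(ℂ, ℂ)) p).symm (γ z)) = p.flow := by
    funext z
    have hmem : p.flow z ∈ (slitTriv (L := L) (f := Γ.tgtMap) (Γ.tgt p.base)).source :=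
      (p.flow z).mem_slitTriv_source
    rw [Slit.extChartAt_symm_apply, ← (slitTriv (Γ.tgt p.base)).left_inv hmem]
    exact congrArg _ (Prod.ext (extChartAt_to_inv p.base) rfl)
  have hderiv := hasMFDerivAt_extChartAt_symm_comp hγ₀ hγ
  rw [hflow] at hderiv
  rw [eulerField, hderiv.mfderiv]
  exact one_smul ℂ _

variable [IsManifold 𝓘(ℂ, EG) ω G]

theorem liouvilleForm_apply (θ : ∀ g, TangentSpace 𝓘(ℂ, EG) g →L[ℂ] L (Γ.tgt g))
    (p : ArrowTilde Γ L) (v : EG × ℂ) :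
    liouvilleForm θ p v =
      lineCoord L (Γ.tgt p.base) (Γ.tgt p.base) p.covec * formCoord θ p.base p.base v.1 := by
  have hmem : Γ.tgt p.base ∈ (trivializationAt ℂ L (Γ.tgt p.base)).baseSet :=
    FiberBundle.mem_baseSet_trivializationAt' _
  have hbase : (mfderiv (𝓘(ℂ, EG).prod 𝓘(ℂ, ℂ)) 𝓘(ℂ, EG) Slit.base p v : EG) = v.1 :=
    congrArg (fun T : EG × ℂ →L[ℂ] EG => T v) p.hasMFDerivAt_base.mfderiv
  rw [formCoord_self]
  refine (congrArg (fun u : EG => p.covec (θ p.base u)) hbase).trans ?_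
  conv_lhs => rw [← ofLineCoord_lineCoord hmem p.covec]
  rfl

theorem liouvilleForm_extChartAt_symm (θ : ∀ g, TangentSpace 𝓘(ℂ, EG) g →L[ℂ] L (Γ.tgt g))
    (p : ArrowTilde Γ L) {y : EG × ℂ}
    (hy : y ∈ (extChartAt (𝓘(ℂ, EG).prod 𝓘(ℂ, ℂ)) p).target) (v : EG × ℂ) :
    liouvilleForm θ ((extChartAt (𝓘(ℂ, EG).prod 𝓘(ℂ, ℂ)) p).symm y)
        (mfderiv 𝓘(ℂ, EG × ℂ) (𝓘(ℂ, EG).prod 𝓘(ℂ, ℂ))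
          (extChartAt (𝓘(ℂ, EG).prod 𝓘(ℂ, ℂ)) p).symm y v) =
      y.2 * formCoord θ p.base ((extChartAt 𝓘(ℂ, EG) p.base).symm y.1) v.1 := by
  obtain ⟨hbase, htriv⟩ := p.mem_target_of_mem_extChartAt_target hy
  rw [formCoord_extChartAt_symm θ p.base hbase]
  have hsymm := slitTriv_symm _ htriv
  have hcongr : ∀ {q r : ArrowTilde Γ L} {u u' : EG}, q = r → u = u' →
      q.covec (θ q.base u) = r.covec (θ r.base u') := by
    rintro q _ u _ rfl rfl
    rfl
  exact hcongr hsymm (p.mfderiv_base_mfderiv_extChartAt_symm hy v)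

theorem symplectization_eulerField {θ : ∀ g, TangentSpace 𝓘(ℂ, EG) g →L[ℂ] L (Γ.tgt g)}
    (hθ : IsHolomorphicForm θ) (p : ArrowTilde Γ L) (v : EG × ℂ) :
    symplectization θ p (eulerField p) v = liouvilleForm θ p v := by
  let a : EG × ℂ → EG × ℂ →L[ℂ] ℂ := fun y =>
    (liouvilleForm θ ((extChartAt (𝓘(ℂ, EG).prod 𝓘(ℂ, ℂ)) p).symm y)).comp
      (mfderiv 𝓘(ℂ, EG × ℂ) (𝓘(ℂ, EG).prod 𝓘(ℂ, ℂ))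
        (extChartAt (𝓘(ℂ, EG).prod 𝓘(ℂ, ℂ)) p).symm y)
  let b : EG → EG →L[ℂ] ℂ := fun y => formCoord θ p.base ((extChartAt 𝓘(ℂ, EG) p.base).symm y)
  have hchart : ∀ᶠ y in 𝓝 (extChartAt (𝓘(ℂ, EG).prod 𝓘(ℂ, ℂ)) p p), ∀ u : EG × ℂ,
      a y u = y.2 * b y.1 u.1 := by
    filter_upwards [extChartAt_target_mem_nhds p] with y hy
    exact liouvilleForm_extChartAt_symm θ p hy
  have hself : b (extChartAt 𝓘(ℂ, EG) p.base p.base) = formCoord θ p.base p.base :=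
    congrArg (formCoord θ p.base) (extChartAt_to_inv p.base)
  refine (extDerivOne_apply (a := a) (liouvilleForm θ) p rfl (eulerField p) v).trans ?_
  rw [eulerField_eq, liouvilleForm_apply, ← hself]
  exact fderiv_homogeneous_form (y₀ := extChartAt (𝓘(ℂ, EG).prod 𝓘(ℂ, ℂ)) p p)
    (differentiableAt_formCoord hθ p.base) hchart v

end Symplectization

section Lines

variable {X : Type*} {L : X → Type*} [∀ x, AddCommGroup (L x)] [∀ x, Module ℂ (L x)]
  [∀ x, TopologicalSpace (L x)]

theorem re_rep_mk_eq_zero_iff {x : X} {ε : L x →L[ℂ] ℂ} (hε : ε ≠ 0) (v : L x) :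
    ((Projectivization.mk ℝ ε hε).rep v).re = 0 ↔ (ε v).re = 0 := by
  obtain ⟨a, ha⟩ := Projectivization.exists_smul_eq_mk_rep ℝ ε hε
  rw [← ha, smul_apply, Units.smul_def, Complex.smul_re, smul_eq_mul, mul_eq_zero]
  exact or_iff_right a.ne_zero

variable {EX : Type*} [NormedAddCommGroup EX] [NormedSpace ℂ EX]
  [TopologicalSpace X] [ChartedSpace EX X]

/-- The vector `u` of `L` is annihilated by the real parts of the covectors of the line `b`. Only
vectors over the base point of `b` are of interest: the condition is void for the others. -/
def Annihilates (b : RProj L (idMap (EX := EX) X)) (u : TotalSpace ℂ L) : Prop :=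
  ∀ v : L b.base, (⟨_, v⟩ : TotalSpace ℂ L) = u → ((b.line.rep : L b.base →L[ℂ] ℂ) v).re = 0

theorem annihilates_mk {b : RProj L (idMap (EX := EX) X)} {v : L b.base} :
    Annihilates b ⟨_, v⟩ ↔ ((b.line.rep : L b.base →L[ℂ] ℂ) v).re = 0 := by
  refine ⟨fun h => h v rfl, fun h w hwv => ?_⟩
  obtain rfl := TotalSpace.mk_injective _ hwv
  exact h

theorem annihilates_add_iff {b : RProj L (idMap (EX := EX) X)} {v w : L b.base}
    (hv : Annihilates b ⟨_, v⟩) : Annihilates b ⟨_, v + w⟩ ↔ Annihilates b ⟨_, w⟩ := by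
  have hadd : ((b.line.rep : L b.base →L[ℂ] ℂ) (v + w)).re =
      ((b.line.rep : L b.base →L[ℂ] ℂ) v).re + ((b.line.rep : L b.base →L[ℂ] ℂ) w).re :=
    (congrArg Complex.re (map_add (b.line.rep : L b.base →L[ℂ] ℂ) v w)).trans (Complex.add_re _ _)
  refine annihilates_mk.trans (Iff.trans ?_ annihilates_mk.symm)
  exact Iff.of_eq (congrArg (· = 0) (hadd.trans
    ((congrArg (· + _) (annihilates_mk.1 hv)).trans (zero_add _))))

theorem annihilates_zero {b : RProj L (idMap (EX := EX) X)} {x : X} (hx : b.base = x) :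
    Annihilates b ⟨x, (0 : L x)⟩ := by
  subst hx
  exact annihilates_mk.2 (congrArg Complex.re (map_zero (b.line.rep : L b.base →L[ℂ] ℂ)))

variable [TopologicalSpace (TotalSpace ℂ L)] [FiberBundle ℂ L] [VectorBundle ℂ ℂ L]

variable (L) in
theorem exists_covector_ne_zero_and_injective (x : X) :
    ∃ ε : L x →L[ℂ] ℂ, ε ≠ 0 ∧ Function.Injective ε := by
  have hx : x ∈ (trivializationAt ℂ L x).baseSet := FiberBundle.mem_baseSet_trivializationAt' x
  refine ⟨ofLineCoord L x x 1, ofLineCoord_ne_zero hx one_ne_zero, ?_⟩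
  rw [ofLineCoord, one_smul]
  exact Function.LeftInverse.injective
    ((trivializationAt ℂ L x).symmL_continuousLinearMapAt (R := ℂ) hx)

theorem eq_zero_of_forall_annihilates {x : X} {v : L x}
    (h : ∀ b : RProj L (idMap (EX := EX) X), b.base = x → Annihilates b ⟨x, v⟩) : v = 0 := by
  have hre {ε : L x →L[ℂ] ℂ} (hε : ε ≠ 0) : (ε v).re = 0 :=
    (re_rep_mk_eq_zero_iff hε v).1 (annihilates_mk.1 (h ⟨x, Projectivization.mk ℝ ε hε⟩ rfl))
  obtain ⟨ε, hε, hinj⟩ := exists_covector_ne_zero_and_injective L x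
  have him := hre (smul_ne_zero Complex.I_ne_zero hε)
  rw [smul_apply, smul_eq_mul, Complex.I_mul_re, neg_eq_zero] at him
  exact hinj ((Complex.ext (hre hε) him).trans (map_zero ε).symm)

end Lines

section ContactHat

variable {EX : Type*} [NormedAddCommGroup EX] [NormedSpace ℂ EX]
  {X : Type*} [TopologicalSpace X] [ChartedSpace EX X]
  {EG : Type*} [NormedAddCommGroup EG] [NormedSpace ℂ EG]
  {G : Type*} [TopologicalSpace G] [ChartedSpace EG G]
  {Γ : LieGroupoid 𝓘(ℂ, EG) 𝓘(ℂ, EX) ω G X}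
  {L : X → Type*} [∀ x, AddCommGroup (L x)] [∀ x, Module ℂ (L x)] [∀ x, TopologicalSpace (L x)]

/-- The bundle map `TG → L` over the target map that a `t^*L`-valued form `θ` defines. -/
def formMap (θ : ∀ g, TangentSpace 𝓘(ℂ, EG) g →L[ℂ] L (Γ.tgt g)) (V : TangentBundle 𝓘(ℂ, EG) G) :
    TotalSpace ℂ L := ⟨Γ.tgt V.proj, θ V.proj V.snd⟩

theorem annihilates_formMap_of_eq_zero {θ : ∀ g, TangentSpace 𝓘(ℂ, EG) g →L[ℂ] L (Γ.tgt g)}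
    {b : BaseHat Γ L} {g : G} (hb : b.base = Γ.tgt g) {v : EG} (hv : θ g v = 0) :
    Annihilates b (formMap θ ⟨g, v⟩) := by
  rw [formMap, hv]
  exact annihilates_zero hb

variable [TopologicalSpace (TotalSpace ℂ L)] [FiberBundle ℂ L] [VectorBundle ℂ ℂ L]

theorem annihilates_act_iff (A : LineAction Γ L) (z : ArrowHat Γ L) (v : L (Γ.src z.base)) :
    Annihilates (tgtHat z) ⟨_, A.act z.base v⟩ ↔ Annihilates (srcHat A z) ⟨_, v⟩ := by
  obtain ⟨p, rfl⟩ := Slit.toRProj_surjective z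
  exact (annihilates_mk (b := tgtHat p.toRProj)).trans <|
    (re_rep_mk_eq_zero_iff p.ne_zero (A.act p.base v)).trans <|
      (re_rep_mk_eq_zero_iff (srcTilde A p).ne_zero v).symm.trans
        (annihilates_mk (b := srcHat A p.toRProj)).symm

variable [ContMDiffVectorBundle ω ℂ L 𝓘(ℂ, EX)]

/-- The kernel of the real `1`-form `Re ⟨ε, θ⟩` at a point `(g, [ε])` of `Ĝ`; it is `Ĥ`, see
`contactHat_eq`. -/
def reKernelHat (θ : ∀ g, TangentSpace 𝓘(ℂ, EG) g →L[ℂ] L (Γ.tgt g)) (z : ArrowHat Γ L) :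
    Submodule ℝ (TangentSpace (𝓘(ℝ, EG).prod 𝓘(ℝ, ℝ)) z) :=
  let φ : EG →L[ℂ] ℂ := z.line.rep.comp (θ z.base)
  LinearMap.ker ((Complex.reCLM.comp (φ.restrictScalars ℝ)).comp z.dbase).toLinearMap

theorem mem_reKernelHat {θ : ∀ g, TangentSpace 𝓘(ℂ, EG) g →L[ℂ] L (Γ.tgt g)} {z : ArrowHat Γ L}
    {v : EG × ℝ} :
    v ∈ reKernelHat θ z ↔ (z.line.rep (θ z.base (z.dbase v))).re = 0 := Iff.rfl

variable [IsManifold 𝓘(ℂ, EG) ω G]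

theorem dbase_mfderiv_toRProj (p : ArrowTilde Γ L) (v : EG × ℂ) :
    p.toRProj.dbase
        (mfderiv (𝓘(ℝ, EG).prod 𝓘(ℝ, ℂ)) (𝓘(ℝ, EG).prod 𝓘(ℝ, ℝ)) Slit.toRProj p v) =
      (mfderiv (𝓘(ℂ, EG).prod 𝓘(ℂ, ℂ)) 𝓘(ℂ, EG) (Slit.base : ArrowTilde Γ L → G) p v : EG) := by
  have hcomp := p.toRProj.hasMFDerivAt_base.comp p
    (Slit.contMDiff_toRProj.mdifferentiable (by simp) p).hasMFDerivAt
  have hbase : HasMFDerivAt (𝓘(ℝ, EG).prod 𝓘(ℝ, ℂ)) 𝓘(ℝ, EG)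
      (Slit.base : ArrowTilde Γ L → G) p _ :=
    hasMFDerivAt_restrictScalars ℝ p.hasMFDerivAt_base rfl rfl
  rw [p.hasMFDerivAt_base.mfderiv]
  exact DFunLike.congr_fun (hasMFDerivAt_unique hcomp hbase) v

theorem mfderiv_toRProj_surjective (p : ArrowTilde Γ L) :
    Function.Surjective
      (mfderiv (𝓘(ℝ, EG).prod 𝓘(ℝ, ℂ)) (𝓘(ℝ, EG).prod 𝓘(ℝ, ℝ)) Slit.toRProj p) := by
  intro u
  obtain ⟨σ, hσ, hσp, hsection⟩ := p.exists_section_toRProj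
  have hproj := hasMFDerivAt_of_eq hσp.symm
    (Slit.contMDiff_toRProj.mdifferentiable (by simp) p).hasMFDerivAt
  have hcomp := (hproj.comp p.toRProj (hσ.mdifferentiableAt (by simp)).hasMFDerivAt
    ).congr_of_eventuallyEq (f₁ := id) (by
      filter_upwards [hsection] with z hz using hz.symm)
  exact ⟨_, DFunLike.congr_fun (hasMFDerivAt_unique hcomp (hasMFDerivAt_id _)) u⟩

theorem reKernel_eq_comap {θ : ∀ g, TangentSpace 𝓘(ℂ, EG) g →L[ℂ] L (Γ.tgt g)}
    (hθ : IsHolomorphicForm θ) (p : ArrowTilde Γ L) :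
    reKernel θ p = (reKernelHat θ p.toRProj).comap
      (mfderiv (𝓘(ℝ, EG).prod 𝓘(ℝ, ℂ)) (𝓘(ℝ, EG).prod 𝓘(ℝ, ℝ)) Slit.toRProj p).toLinearMap := by
  ext v
  have heuler : v ∈ reKernel θ p ↔ (liouvilleForm θ p v).re = 0 :=
    Iff.of_eq (congrArg (fun c : ℂ => c.re = 0) (symplectization_eulerField hθ p v))
  refine heuler.trans ((re_rep_mk_eq_zero_iff p.ne_zero _).symm.trans ?_)
  exact Iff.of_eq (congrArg (fun u : EG => (p.toRProj.line.rep (θ p.base u)).re = 0)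
    (dbase_mfderiv_toRProj p v).symm)

theorem contactHat_eq {θ : ∀ g, TangentSpace 𝓘(ℂ, EG) g →L[ℂ] L (Γ.tgt g)}
    (hθ : IsHolomorphicForm θ) (z : ArrowHat Γ L) : contactHat θ z = reKernelHat θ z := by
  have hmap (p : ArrowTilde Γ L) : (reKernel θ p).map
      (mfderiv (𝓘(ℝ, EG).prod 𝓘(ℝ, ℂ)) (𝓘(ℝ, EG).prod 𝓘(ℝ, ℝ)) Slit.toRProj p).toLinearMap =
        reKernelHat θ p.toRProj := by
    rw [reKernel_eq_comap hθ]
    exact Submodule.map_comap_eq_of_surjective (mfderiv_toRProj_surjective p) _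
  apply le_antisymm
  · refine iSup₂_le fun p hp => ?_
    subst hp
    exact (hmap p).le
  · obtain ⟨p, rfl⟩ := Slit.toRProj_surjective z
    exact (hmap p).ge.trans (le_iSup₂_of_le p rfl le_rfl)

theorem mem_contactHat_iff {θ : ∀ g, TangentSpace 𝓘(ℂ, EG) g →L[ℂ] L (Γ.tgt g)}
    (hθ : IsHolomorphicForm θ) {z : ArrowHat Γ L} {V : EG × ℝ} :
    V ∈ contactHat θ z ↔ Annihilates (tgtHat z) (formMap θ ⟨z.base, z.dbase V⟩) := by
  rw [contactHat_eq hθ, mem_reKernelHat]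
  exact (annihilates_mk (b := tgtHat z)).symm

end ContactHat

theorem tangentBundle_mk_eq {𝕜 : Type*} [NontriviallyNormedField 𝕜]
    {E : Type*} [NormedAddCommGroup E] [NormedSpace 𝕜 E] {H : Type*} [TopologicalSpace H]
    {I : ModelWithCorners 𝕜 E H} {M : Type*} [TopologicalSpace M] [ChartedSpace H M]
    {x y : M} (hxy : x = y) {u v : E} (huv : u = v) :
    (⟨x, u⟩ : TangentBundle I M) = ⟨y, v⟩ := by
  subst hxy huv
  rfl

theorem exists_totalSpace_mk_eq {B : Type*} {F : Type*} {L : B → Type*} {x y : B} (h : x = y)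
    (v : L y) : ∃ w : L x, (⟨x, w⟩ : TotalSpace F L) = ⟨y, v⟩ := by
  subst h
  exact ⟨v, rfl⟩

/-- If some `k ∈ ker σ` has `φ k ≠ 0`, a lift of `u` can be corrected by a multiple of `k`. If not,
`Re φ = 0` by hypothesis, so that `φ = 0`. -/
theorem exists_apply_eq_zero_and_apply_eq {E F : Type*} [AddCommGroup E] [Module ℂ E]
    [AddCommGroup F] [Module ℂ F] {φ : E →ₗ[ℂ] ℂ} {σ : E →ₗ[ℂ] F} (hσ : Function.Surjective σ)
    (hre : ∀ u, ∃ v, (φ v).re = 0 ∧ σ v = u) (u : F) : ∃ v, φ v = 0 ∧ σ v = u := by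
  obtain ⟨v, rfl⟩ := hσ u
  by_cases hker : ∃ k, σ k = 0 ∧ φ k ≠ 0
  · obtain ⟨k, hk, hk'⟩ := hker
    refine ⟨v - (φ v / φ k) • k, ?_, ?_⟩
    · rw [map_sub, map_smul, smul_eq_mul, div_mul_cancel₀ _ hk', sub_self]
    · rw [map_sub, map_smul, hk, smul_zero, sub_zero]
  · push Not at hker
    have hre_zero (v : E) : (φ v).re = 0 := by
      obtain ⟨w, hw, hwv⟩ := hre (σ v)
      have hφ := hker (w - v) (by rw [map_sub, hwv, sub_self])
      rwa [← sub_eq_zero.1 ((map_sub φ w v).symm.trans hφ)]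
    have him := hre_zero (Complex.I • v)
    rw [map_smul, smul_eq_mul, Complex.I_mul_re, neg_eq_zero] at him
    exact ⟨v, Complex.ext (hre_zero v) him, rfl⟩

section Multiplicativity

variable {EX : Type*} [NormedAddCommGroup EX] [NormedSpace ℂ EX]
  {X : Type*} [TopologicalSpace X] [ChartedSpace EX X]
  {EG : Type*} [NormedAddCommGroup EG] [NormedSpace ℂ EG]
  {G : Type*} [TopologicalSpace G] [ChartedSpace EG G]
  {Γ : LieGroupoid 𝓘(ℂ, EG) 𝓘(ℂ, EX) ω G X}
  {L : X → Type*} [∀ x, AddCommGroup (L x)] [∀ x, Module ℂ (L x)] [∀ x, TopologicalSpace (L x)]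

variable [TopologicalSpace (TotalSpace ℂ L)] [FiberBundle ℂ L] [VectorBundle ℂ ℂ L]

theorem exists_base_eq_and_tgtHat_eq {g : G} {b : BaseHat Γ L} (hb : b.base = Γ.tgt g) :
    ∃ z : ArrowHat Γ L, z.base = g ∧ tgtHat z = b :=
  ⟨arrowOf g b hb.symm, rfl, tgtHat_arrowOf g b hb.symm⟩

theorem exists_base_eq_and_srcHat_eq (A : LineAction Γ L) {g : G} {b : BaseHat Γ L}
    (hb : b.base = Γ.src g) : ∃ z : ArrowHat Γ L, z.base = g ∧ srcHat A z = b := by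
  obtain ⟨w, hw, rfl⟩ := exists_base_eq_and_tgtHat_eq (hb.trans (Γ.tgt_inv g).symm)
  exact ⟨(groupoidHat A).inv w, (congrArg Γ.inv hw).trans (Γ.inv_inv g),
    (groupoidHat A).src_inv w⟩

variable {θ : ∀ g, TangentSpace 𝓘(ℂ, EG) g →L[ℂ] L (Γ.tgt g)} {A : LineAction Γ L}

theorem IsGroupoidMap.annihilates_tangentMul_iff (hA : IsGroupoidMap A θ) {z : ArrowHat Γ L}
    {v : EG} {W : TangentBundle 𝓘(ℂ, EG) G}
    (hvW : tangentMap 𝓘(ℂ, EG) 𝓘(ℂ, EX) Γ.src ⟨z.base, v⟩ = tangentMap 𝓘(ℂ, EG) 𝓘(ℂ, EX) Γ.tgt W)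
    (hv : Annihilates (tgtHat z) (formMap θ ⟨z.base, v⟩)) :
    Annihilates (tgtHat z) (formMap θ (Γ.tangentMul 𝓘(ℂ, EG) ⟨z.base, v⟩ W)) ↔
      Annihilates (srcHat A z) (formMap θ W) := by
  obtain ⟨ℓ, hℓ⟩ := exists_totalSpace_mk_eq (F := ℂ) (L := L) (congrArg TotalSpace.proj hvW)
    (θ W.proj W.snd)
  have hmul : formMap θ (Γ.tangentMul 𝓘(ℂ, EG) ⟨z.base, v⟩ W) =
      ⟨_, θ z.base v + A.act z.base ℓ⟩ := hA ⟨z.base, v⟩ W hvW ℓ hℓ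
  exact (Iff.of_eq (congrArg (Annihilates _) hmul)).trans
    ((annihilates_add_iff (b := tgtHat z) hv).trans
      ((annihilates_act_iff A z ℓ).trans (Iff.of_eq (congrArg (Annihilates (srcHat A z)) hℓ))))

variable [ContMDiffVectorBundle ω ℂ L 𝓘(ℂ, EX)] [IsManifold 𝓘(ℂ, EG) ω G]

theorem mem_contactHat_of_eq_zero (hθ : IsHolomorphicForm θ) {z : ArrowHat Γ L} {V : EG × ℝ}
    (hV : θ z.base (z.dbase V) = 0) : V ∈ contactHat θ z :=
  (mem_contactHat_iff hθ).2 (annihilates_formMap_of_eq_zero rfl hV)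

variable [IsManifold 𝓘(ℂ, EX) ω X]

theorem mfderiv_unitHat_mem_contactHat_iff (hθ : IsHolomorphicForm θ) (A : LineAction Γ L)
    (b : BaseHat Γ L) (u : EX × ℝ) :
    (mfderiv (𝓘(ℝ, EX).prod 𝓘(ℝ, ℝ)) (𝓘(ℝ, EG).prod 𝓘(ℝ, ℝ)) (groupoidHat A).unit b u : EG × ℝ) ∈
        contactHat θ ((groupoidHat A).unit b) ↔
      Annihilates b
        (formMap θ (tangentMap 𝓘(ℂ, EX) 𝓘(ℂ, EG) Γ.unit ⟨b.base, b.dbase u⟩)) :=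
  (mem_contactHat_iff hθ).trans (Iff.of_eq (congrArg₂ Annihilates ((groupoidHat A).tgt_unit b)
    (congrArg (formMap θ) (tangentBundle_mk_eq rfl (dbase_mfderiv_unitHat A b u)))))

theorem mfderiv_invHat_mem_contactHat_iff (hθ : IsHolomorphicForm θ) (A : LineAction Γ L)
    (z : ArrowHat Γ L) (V : EG × ℝ) :
    (mfderiv (𝓘(ℝ, EG).prod 𝓘(ℝ, ℝ)) (𝓘(ℝ, EG).prod 𝓘(ℝ, ℝ)) (groupoidHat A).inv z V : EG × ℝ) ∈
        contactHat θ ((groupoidHat A).inv z) ↔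
      Annihilates (srcHat A z)
        (formMap θ (tangentMap 𝓘(ℂ, EG) 𝓘(ℂ, EG) Γ.inv ⟨z.base, z.dbase V⟩)) :=
  (mem_contactHat_iff hθ).trans (Iff.of_eq (congrArg₂ Annihilates ((groupoidHat A).tgt_inv z)
    (congrArg (formMap θ) (tangentBundle_mk_eq rfl (dbase_mfderiv_invHat A z V)))))

theorem tangentMul_mem_contactHat_iff [FiniteDimensional ℂ EX] [CompleteSpace EG]
    (hθ : IsHolomorphicForm θ) (A : LineAction Γ L) {z w : ArrowHat Γ L}
    (hzw : srcHat A z = tgtHat w) {V W : EG × ℝ}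
    (hVW : (mfderiv (𝓘(ℝ, EG).prod 𝓘(ℝ, ℝ)) (𝓘(ℝ, EX).prod 𝓘(ℝ, ℝ)) (srcHat A) z V : EX × ℝ) =
      (mfderiv (𝓘(ℝ, EG).prod 𝓘(ℝ, ℝ)) (𝓘(ℝ, EX).prod 𝓘(ℝ, ℝ)) tgtHat w W : EX × ℝ)) :
    ((groupoidHat A).tangentMul (𝓘(ℝ, EG).prod 𝓘(ℝ, ℝ)) ⟨z, V⟩ ⟨w, W⟩).snd ∈
        contactHat θ ((groupoidHat A).mul z w) ↔
      Annihilates (tgtHat z) (formMap θ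
        (Γ.tangentMul 𝓘(ℂ, EG) ⟨z.base, z.dbase V⟩ ⟨w.base, w.dbase W⟩)) :=
  have hbase : Γ.src z.base = Γ.tgt w.base := congrArg RProj.base hzw
  (mem_contactHat_iff hθ).trans (Iff.of_eq (congrArg₂ Annihilates (tgtHat_mulHat hbase)
    (congrArg (formMap θ) (tangentBundle_mk_eq (mulHat_base hbase) (dbase_tangentMul A hzw hVW)))))

theorem mfderiv_src_dbase_eq {z w : ArrowHat Γ L} (hzw : srcHat A z = tgtHat w) {V W : EG × ℝ}
    (hVW : (mfderiv (𝓘(ℝ, EG).prod 𝓘(ℝ, ℝ)) (𝓘(ℝ, EX).prod 𝓘(ℝ, ℝ)) (srcHat A) z V : EX × ℝ) =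
      (mfderiv (𝓘(ℝ, EG).prod 𝓘(ℝ, ℝ)) (𝓘(ℝ, EX).prod 𝓘(ℝ, ℝ)) tgtHat w W : EX × ℝ)) :
    (mfderiv 𝓘(ℂ, EG) 𝓘(ℂ, EX) Γ.src z.base (z.dbase V) : EX) =
      mfderiv 𝓘(ℂ, EG) 𝓘(ℂ, EX) Γ.tgt w.base (w.dbase W) :=
  (dbase_mfderiv_srcHat A z V).symm.trans
    ((congrArg₂ (fun (b : BaseHat Γ L) (u : EX × ℝ) => b.dbase u) hzw hVW).trans
      (dbase_mfderiv_tgtHat w W))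

section FromKernel

theorem contactHat_covers (hθ : IsHolomorphicForm θ)
    (hcovers : ∀ g (u : EX), ∃ v : EG, θ g v = 0 ∧
      (mfderiv 𝓘(ℂ, EG) 𝓘(ℂ, EX) Γ.src g v : EX) = u)
    (z : ArrowHat Γ L) (u : EX × ℝ) :
    ∃ V : EG × ℝ, V ∈ contactHat θ z ∧
      (mfderiv (𝓘(ℝ, EG).prod 𝓘(ℝ, ℝ)) (𝓘(ℝ, EX).prod 𝓘(ℝ, ℝ)) (srcHat A) z V : EX × ℝ) = u := by
  obtain ⟨v, hv, hvu⟩ := hcovers z.base ((srcHat A z).dbase u)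
  obtain ⟨V, rfl, hVu⟩ := exists_dbase_eq_and_mfderiv_srcHat_eq A z v u hvu
  exact ⟨V, mem_contactHat_of_eq_zero hθ hv, hVu⟩

theorem IsGroupoidMap.mfderiv_invHat_mem_contactHat (hA : IsGroupoidMap A θ)
    (hθ : IsHolomorphicForm θ)
    (hunit : ∀ x (u : EX), θ (Γ.unit x) (mfderiv 𝓘(ℂ, EX) 𝓘(ℂ, EG) Γ.unit x u) = 0)
    {z : ArrowHat Γ L} {V : EG × ℝ} (hV : V ∈ contactHat θ z) :
    (mfderiv (𝓘(ℝ, EG).prod 𝓘(ℝ, ℝ)) (𝓘(ℝ, EG).prod 𝓘(ℝ, ℝ)) (groupoidHat A).inv z V : EG × ℝ) ∈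
      contactHat θ ((groupoidHat A).inv z) := by
  set v : EG := z.dbase V
  have hcomp : tangentMap 𝓘(ℂ, EG) 𝓘(ℂ, EX) Γ.src ⟨z.base, v⟩ = tangentMap 𝓘(ℂ, EG) 𝓘(ℂ, EX) Γ.tgt
      (tangentMap 𝓘(ℂ, EG) 𝓘(ℂ, EG) Γ.inv ⟨z.base, v⟩) :=
    tangentBundle_mk_eq (Γ.tgt_inv z.base).symm (Γ.mfderiv_tgt_inv (by simp) z.base v).symm
  have hmul : Γ.tangentMul 𝓘(ℂ, EG) ⟨z.base, v⟩
      (tangentMap 𝓘(ℂ, EG) 𝓘(ℂ, EG) Γ.inv ⟨z.base, v⟩) =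
        ⟨Γ.unit (Γ.tgt z.base), mfderiv 𝓘(ℂ, EX) 𝓘(ℂ, EG) Γ.unit (Γ.tgt z.base)
          (mfderiv 𝓘(ℂ, EG) 𝓘(ℂ, EX) Γ.tgt z.base v)⟩ :=
    tangentBundle_mk_eq (Γ.mul_inv z.base) (Γ.tangentMul_inv (by simp) z.base v)
  refine (mfderiv_invHat_mem_contactHat_iff hθ A z V).2
    ((hA.annihilates_tangentMul_iff hcomp ((mem_contactHat_iff hθ).1 hV)).1 ?_)
  rw [hmul]
  exact annihilates_formMap_of_eq_zero (Γ.tgt_unit _).symm (hunit _ _)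

theorem IsGroupoidMap.tangentMul_mem_contactHat [FiniteDimensional ℂ EX] [CompleteSpace EG]
    (hA : IsGroupoidMap A θ) (hθ : IsHolomorphicForm θ) {z w : ArrowHat Γ L}
    (hzw : srcHat A z = tgtHat w) {V W : EG × ℝ}
    (hVW : (mfderiv (𝓘(ℝ, EG).prod 𝓘(ℝ, ℝ)) (𝓘(ℝ, EX).prod 𝓘(ℝ, ℝ)) (srcHat A) z V : EX × ℝ) =
      (mfderiv (𝓘(ℝ, EG).prod 𝓘(ℝ, ℝ)) (𝓘(ℝ, EX).prod 𝓘(ℝ, ℝ)) tgtHat w W : EX × ℝ))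
    (hV : V ∈ contactHat θ z) (hW : W ∈ contactHat θ w) :
    ((groupoidHat A).tangentMul (𝓘(ℝ, EG).prod 𝓘(ℝ, ℝ)) ⟨z, V⟩ ⟨w, W⟩).snd ∈
      contactHat θ ((groupoidHat A).mul z w) := by
  refine (tangentMul_mem_contactHat_iff hθ A hzw hVW).2
    ((hA.annihilates_tangentMul_iff ?_ ((mem_contactHat_iff hθ).1 hV)).2 ?_)
  · exact tangentBundle_mk_eq (congrArg RProj.base hzw) (mfderiv_src_dbase_eq hzw hVW)
  · rw [hzw]
    exact (mem_contactHat_iff hθ).1 hW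

theorem IsGroupoidMap.isMultiplicative_contactHat [FiniteDimensional ℂ EX] [CompleteSpace EG]
    (hA : IsGroupoidMap A θ) (hθ : IsHolomorphicForm θ)
    (hM : IsMultiplicative Γ.toGroupoidStr 𝓘(ℂ, EG) 𝓘(ℂ, EX)
      fun g => LinearMap.ker (θ g).toLinearMap) :
    IsMultiplicative (groupoidHat A) (𝓘(ℝ, EG).prod 𝓘(ℝ, ℝ)) (𝓘(ℝ, EX).prod 𝓘(ℝ, ℝ))
      (contactHat θ) where
  covers := contactHat_covers hθ hM.covers
  unit_mem b u := (mfderiv_unitHat_mem_contactHat_iff hθ A b u).2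
    (annihilates_formMap_of_eq_zero (Γ.tgt_unit b.base).symm (hM.unit_mem b.base (b.dbase u)))
  inv_mem _ _ hV := hA.mfderiv_invHat_mem_contactHat hθ hM.unit_mem hV
  mul_mem _ _ hVW hV hW := hA.tangentMul_mem_contactHat hθ (congrArg TotalSpace.proj hVW)
    (congrArg (fun u : TangentBundle (𝓘(ℝ, EX).prod 𝓘(ℝ, ℝ)) (BaseHat Γ L) =>
      (u.snd : EX × ℝ)) hVW) hV hW

end FromKernel

section FromContactHat

theorem ker_covers_of_contactHat_covers (hθ : IsHolomorphicForm θ)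
    (hcovers : ∀ (z : ArrowHat Γ L) (u : EX × ℝ), ∃ V : EG × ℝ, V ∈ contactHat θ z ∧
      (mfderiv (𝓘(ℝ, EG).prod 𝓘(ℝ, ℝ)) (𝓘(ℝ, EX).prod 𝓘(ℝ, ℝ)) (srcHat A) z V : EX × ℝ) = u)
    (g : G) (u : EX) :
    ∃ v : EG, θ g v = 0 ∧ (mfderiv 𝓘(ℂ, EG) 𝓘(ℂ, EX) Γ.src g v : EX) = u := by
  obtain ⟨ε, hε, hinj⟩ := exists_covector_ne_zero_and_injective L (Γ.tgt g)
  let φ : EG →L[ℂ] ℂ := ε.comp (θ g)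
  let σ : EG →L[ℂ] EX := mfderiv 𝓘(ℂ, EG) 𝓘(ℂ, EX) Γ.src g
  have hre (u : EX) : ∃ v, (φ v).re = 0 ∧ σ v = u := by
    let z : ArrowHat Γ L := ⟨g, Projectivization.mk ℝ ε hε⟩
    obtain ⟨u, rfl⟩ := (srcHat A z).dbase_surjective u
    obtain ⟨V, hV, rfl⟩ := hcovers z u
    rw [contactHat_eq hθ] at hV
    exact ⟨z.dbase V, (re_rep_mk_eq_zero_iff hε _).1 hV, (dbase_mfderiv_srcHat A z V).symm⟩
  obtain ⟨v, hv, hvu⟩ := exists_apply_eq_zero_and_apply_eq (φ := φ.toLinearMap)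
    (σ := σ.toLinearMap) (Γ.submersion_src g) hre u
  exact ⟨v, hinj (hv.trans (map_zero ε).symm), hvu⟩

theorem apply_mfderiv_unit_eq_zero (hθ : IsHolomorphicForm θ)
    (hunit : ∀ (b : BaseHat Γ L) (u : EX × ℝ), (mfderiv (𝓘(ℝ, EX).prod 𝓘(ℝ, ℝ))
      (𝓘(ℝ, EG).prod 𝓘(ℝ, ℝ)) (groupoidHat A).unit b u : EG × ℝ) ∈
        contactHat θ ((groupoidHat A).unit b))
    (x : X) (u : EX) : θ (Γ.unit x) (mfderiv 𝓘(ℂ, EX) 𝓘(ℂ, EG) Γ.unit x u) = 0 := by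
  refine eq_zero_of_forall_annihilates (EX := EX) fun b hb => ?_
  obtain rfl := hb.trans (Γ.tgt_unit x)
  obtain ⟨u, rfl⟩ := b.dbase_surjective u
  exact (mfderiv_unitHat_mem_contactHat_iff hθ A b u).1 (hunit b u)

theorem apply_mfderiv_inv_eq_zero (hθ : IsHolomorphicForm θ)
    (hinv : ∀ (z : ArrowHat Γ L) (V : EG × ℝ), V ∈ contactHat θ z →
      (mfderiv (𝓘(ℝ, EG).prod 𝓘(ℝ, ℝ)) (𝓘(ℝ, EG).prod 𝓘(ℝ, ℝ)) (groupoidHat A).inv z V : EG × ℝ) ∈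
        contactHat θ ((groupoidHat A).inv z))
    {g : G} {v : EG} (hv : θ g v = 0) :
    θ (Γ.inv g) (mfderiv 𝓘(ℂ, EG) 𝓘(ℂ, EG) Γ.inv g v) = 0 := by
  refine eq_zero_of_forall_annihilates (EX := EX) fun b hb => ?_
  obtain ⟨z, rfl, rfl⟩ := exists_base_eq_and_srcHat_eq A (hb.trans (Γ.tgt_inv g))
  obtain ⟨V, rfl⟩ := z.dbase_surjective v
  exact (mfderiv_invHat_mem_contactHat_iff hθ A z V).1
    (hinv z V (mem_contactHat_of_eq_zero hθ hv))

theorem apply_tangentMul_eq_zero [FiniteDimensional ℂ EX] [CompleteSpace EG]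
    (hθ : IsHolomorphicForm θ)
    (hmul : ∀ V W : TangentBundle (𝓘(ℝ, EG).prod 𝓘(ℝ, ℝ)) (ArrowHat Γ L),
      tangentMap (𝓘(ℝ, EG).prod 𝓘(ℝ, ℝ)) (𝓘(ℝ, EX).prod 𝓘(ℝ, ℝ)) (srcHat A) V =
        tangentMap (𝓘(ℝ, EG).prod 𝓘(ℝ, ℝ)) (𝓘(ℝ, EX).prod 𝓘(ℝ, ℝ)) tgtHat W →
      V.snd ∈ contactHat θ V.proj → W.snd ∈ contactHat θ W.proj →
      ((groupoidHat A).tangentMul (𝓘(ℝ, EG).prod 𝓘(ℝ, ℝ)) V W).snd ∈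
        contactHat θ ((groupoidHat A).tangentMul (𝓘(ℝ, EG).prod 𝓘(ℝ, ℝ)) V W).proj)
    {V W : TangentBundle 𝓘(ℂ, EG) G}
    (hVW : tangentMap 𝓘(ℂ, EG) 𝓘(ℂ, EX) Γ.src V = tangentMap 𝓘(ℂ, EG) 𝓘(ℂ, EX) Γ.tgt W)
    (hV : θ V.proj V.snd = 0) (hW : θ W.proj W.snd = 0) :
    θ _ (Γ.tangentMul 𝓘(ℂ, EG) V W).snd = 0 := by
  obtain ⟨g, v⟩ := V
  obtain ⟨h, w⟩ := W
  have hgh : Γ.src g = Γ.tgt h := congrArg TotalSpace.proj hVW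
  have hvw : (mfderiv 𝓘(ℂ, EG) 𝓘(ℂ, EX) Γ.src g v : EX) = mfderiv 𝓘(ℂ, EG) 𝓘(ℂ, EX) Γ.tgt h w :=
    congrArg (fun u : TangentBundle 𝓘(ℂ, EX) X => (u.snd : EX)) hVW
  refine eq_zero_of_forall_annihilates (EX := EX) fun b hb => ?_
  obtain ⟨z, rfl, rfl⟩ := exists_base_eq_and_tgtHat_eq (hb.trans (Γ.tgt_mul g h hgh))
  obtain ⟨z', rfl, hz'⟩ := exists_base_eq_and_tgtHat_eq (b := srcHat A z) hgh
  obtain ⟨V, rfl⟩ := z.dbase_surjective v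
  obtain ⟨W, rfl, hVW'⟩ := exists_dbase_eq_and_mfderiv_tgtHat_eq z' w
    (mfderiv (𝓘(ℝ, EG).prod 𝓘(ℝ, ℝ)) (𝓘(ℝ, EX).prod 𝓘(ℝ, ℝ)) (srcHat A) z V)
    (hvw.symm.trans ((dbase_mfderiv_srcHat A z V).symm.trans
      (congrArg (fun b : BaseHat Γ L => (b.dbase _ : EX)) hz'.symm)))
  exact (tangentMul_mem_contactHat_iff hθ A hz'.symm hVW'.symm).1
    (hmul ⟨z, V⟩ ⟨z', W⟩ (tangentBundle_mk_eq hz'.symm hVW'.symm)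
      (mem_contactHat_of_eq_zero hθ hV) (mem_contactHat_of_eq_zero hθ hW))

theorem isMultiplicative_ker_of_contactHat [FiniteDimensional ℂ EX] [CompleteSpace EG]
    (hθ : IsHolomorphicForm θ)
    (hM : IsMultiplicative (groupoidHat A) (𝓘(ℝ, EG).prod 𝓘(ℝ, ℝ)) (𝓘(ℝ, EX).prod 𝓘(ℝ, ℝ))
      (contactHat θ)) :
    IsMultiplicative Γ.toGroupoidStr 𝓘(ℂ, EG) 𝓘(ℂ, EX)
      fun g => LinearMap.ker (θ g).toLinearMap where
  covers := ker_covers_of_contactHat_covers hθ hM.covers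
  unit_mem := apply_mfderiv_unit_eq_zero hθ hM.unit_mem
  inv_mem _ _ hv := apply_mfderiv_inv_eq_zero hθ hM.inv_mem hv
  mul_mem _ _ hVW hV hW := apply_tangentMul_eq_zero hθ hM.mul_mem hVW hV hW

end FromContactHat

end Multiplicativity

end

end HolContact

theorem mainTheorem10_general
    {EX : Type*} [NormedAddCommGroup EX] [NormedSpace ℂ EX] [FiniteDimensional ℂ EX]
    {X : Type*} [TopologicalSpace X] [ChartedSpace EX X] [IsManifold 𝓘(ℂ, EX) ω X]
    {EG : Type*} [NormedAddCommGroup EG] [NormedSpace ℂ EG] [CompleteSpace EG]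
    {G : Type*} [TopologicalSpace G] [ChartedSpace EG G] [IsManifold 𝓘(ℂ, EG) ω G]
    (Γ : HolContact.LieGroupoid 𝓘(ℂ, EG) 𝓘(ℂ, EX) ω G X)
    (L : X → Type*) [∀ x, AddCommGroup (L x)] [∀ x, Module ℂ (L x)]
    [∀ x, TopologicalSpace (L x)] [TopologicalSpace (Bundle.TotalSpace ℂ L)]
    [FiberBundle ℂ L] [VectorBundle ℂ ℂ L] [ContMDiffVectorBundle ω ℂ L 𝓘(ℂ, EX)]
    (A : HolContact.LineAction Γ L)
    (H : ∀ g, Submodule ℂ (TangentSpace 𝓘(ℂ, EG) g))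
    (θ : ∀ g, TangentSpace 𝓘(ℂ, EG) g →L[ℂ] L (Γ.tgt g))
    (hθ : HolContact.IsHolomorphicForm θ)
    (hker : ∀ g, LinearMap.ker (θ g).toLinearMap = H g)
    (hLB : HolContact.IsMultiplicative Γ.toGroupoidStr 𝓘(ℂ, EG) 𝓘(ℂ, EX) H →
      HolContact.IsGroupoidMap A θ) :
    HolContact.IsMultiplicative (HolContact.groupoidHat A)
        (𝓘(ℝ, EG).prod 𝓘(ℝ, ℝ)) (𝓘(ℝ, EX).prod 𝓘(ℝ, ℝ)) (HolContact.contactHat θ) ↔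
      HolContact.IsMultiplicative Γ.toGroupoidStr 𝓘(ℂ, EG) 𝓘(ℂ, EX) H := by
  obtain rfl : (fun g => LinearMap.ker (θ g).toLinearMap) = H := funext hker
  exact ⟨HolContact.isMultiplicative_ker_of_contactHat hθ,
    fun h => (hLB h).isMultiplicative_contactHat hθ h⟩

theorem mainTheorem10
    {EX : Type*} [NormedAddCommGroup EX] [NormedSpace ℂ EX] [FiniteDimensional ℂ EX]
    {X : Type*} [TopologicalSpace X] [ChartedSpace EX X] [IsManifold 𝓘(ℂ, EX) ω X]
    {EG : Type*} [NormedAddCommGroup EG] [NormedSpace ℂ EG] [FiniteDimensional ℂ EG]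
    {G : Type*} [TopologicalSpace G] [ChartedSpace EG G] [IsManifold 𝓘(ℂ, EG) ω G]
    -- a complex Lie groupoid `G ⇉ X`
    (Γ : HolContact.LieGroupoid 𝓘(ℂ, EG) 𝓘(ℂ, EX) ω G X)
    -- a holomorphic line bundle `L → X` with an action of `G`, i.e. an LB-groupoid `t^*L`
    (L : X → Type*) [∀ x, AddCommGroup (L x)] [∀ x, Module ℂ (L x)]
    [∀ x, TopologicalSpace (L x)] [TopologicalSpace (Bundle.TotalSpace ℂ L)]
    [FiberBundle ℂ L] [VectorBundle ℂ ℂ L] [ContMDiffVectorBundle ω ℂ L 𝓘(ℂ, EX)]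
    (A : HolContact.LineAction Γ L)
    -- a holomorphic contact structure `H` on `G` with `TG / H ≅ t^*L` through `θ`
    (H : ∀ g, Submodule ℂ (TangentSpace 𝓘(ℂ, EG) g))
    (hH : HolContact.IsMaximallyNonintegrable 𝓘(ℂ, EG) ω H)
    (θ : ∀ g, TangentSpace 𝓘(ℂ, EG) g →L[ℂ] L (Γ.tgt g))
    (hθ : HolContact.IsHolomorphicForm θ)
    (hsurj : ∀ g, Function.Surjective (θ g))
    (hker : ∀ g, LinearMap.ker (θ g).toLinearMap = H g)
    -- if `H` is multiplicative, then `t^*L` is `TG / H` as an LB-groupoid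
    (hLB : HolContact.IsMultiplicative Γ.toGroupoidStr 𝓘(ℂ, EG) 𝓘(ℂ, EX) H →
      HolContact.IsGroupoidMap A θ) :
    HolContact.IsMultiplicative (HolContact.groupoidHat A)
        (𝓘(ℝ, EG).prod 𝓘(ℝ, ℝ)) (𝓘(ℝ, EX).prod 𝓘(ℝ, ℝ)) (HolContact.contactHat θ) ↔
      HolContact.IsMultiplicative Γ.toGroupoidStr 𝓘(ℂ, EG) 𝓘(ℂ, EX) H :=
  have : CompleteSpace EG := FiniteDimensional.complete ℂ EG
  mainTheorem10_general Γ L A H θ hθ hker hLB
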